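/- Let $M$ be a closed surface (a compact smooth surface without boundary; orientation is not needed), let $p_1,\dots,p_n\in M$ be distinct points, $S=M\setminus\{p_1,\dots,p_n\}$ and $\alpha_1,\dots,\alpha_n\in(0,\tfrac12)$. Let $g$ be a hyperbolic metric on $S$ with cone singularities of angles $2\pi\alpha_i<\pi$ at the $p_i$: a Riemannian metric of class $C^2$ on $S$, of constant curvature $-1$, such that a punctured neighbourhood of each $p_i$ has $C^2$ cylindrical coordinates $(\rho,\theta)\in(0,r_i)\times\mathbb R/2\pi\alpha_i\mathbb Z$, with $\rho\to0$ at $p_i$, in which $g=d\rho^2+\sinh^2\!\rho\,d\theta^2$. Let $S^k$ be the bundle of symmetric $k$-covariant tensors over $S$ with the metric $(\cdot,\cdot)_g$ induced by $g$, and $\langle u,v\rangle=\int_S (u,v)_g\,d\mathrm{vol}_g$ the scalar product of $L^2(S^k)$. On $C^1$ sections $h$ of $S^{k+1}$ let $(\operatorname{div}h)(X_1,\dots,X_k)=-\sum_{i}(\nabla_{e_i}h)(e_i,X_1,\dots,X_k)$, where $(e_1,e_2)$ is an orthonormal frame, and let $\mathring\delta$ be this operator with domain the compactly supported $C^1$ sections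 of $S^{k+1}$, as an unbounded operator $L^2(S^{k+1})\to L^2(S^k)$. Let $\delta$ be the closure of $\mathring\delta$ and $\delta^*$ its Hilbert space adjoint. Put $H^1(S^1)=\mathcal D(\delta^*)$ for $\delta^*:L^2(S^1)\to L^2(S^2)$, $H^1(S^2)=\mathcal D(\delta)$ for $\delta:L^2(S^2)\to L^2(S^1)$, and $H^1(S)=\mathcal D(\delta^*)$ for $\delta^*:L^2(S)\to L^2(S^1)$. Let $\operatorname{Sym}\nabla$ denote the symmetrized covariant derivative of a $C^1$ section; on functions it is $d$. 1. For all $u\in H^1(S^1)\cap C^1(S^1)$ and $h\in H^1(S^2)\cap C^1(S^2)$ one has $\delta^*u=\operatorname{Sym}\nabla u$ and $\delta h=\operatorname{div}h$ almost everywhere, both pairings below are integrable, and $$\langle\delta^*u,h\rangle=\langle u,\delta h\rangle .$$ More generally, for $u\in H^1(S^1)\cap C^1(S^1)$ and every $h\in C^1(S^2)\cap L^2(S^2)$ with $\operatorname{div}h\in L^2(S^1)$, both pairings are integrable and $\langle\delta^*u,h\rangle=\langle u,\operatorname{div}h\rangle$. 2. For all $f\in H^1(S)\cap C^1(S)$ and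 $\beta\in H^1(S^1)\cap C^1(S^1)$ one has $\delta^*f=df$ and $\delta^*\beta=\operatorname{Sym}\nabla\beta$ almost everywhere, $\beta$ is in the domain of $\delta:L^2(S^1)\to L^2(S)$ with $\delta\beta=\operatorname{div}\beta$, both pairings below are integrable, and $$\langle\delta^*f,\beta\rangle=\langle f,\delta\beta\rangle .$$ -/

import Mathlib

open Set Filter Topology MeasureTheory
open scoped Manifold ContDiff ENNReal

noncomputable section

namespace ConeSurface

/-- The model plane. -/
abbrev Plane : Type := EuclideanSpace ℝ (Fin 2)

/-- The `i`-th standard basis vector of the plane. -/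
def stdVec (i : Fin 2) : Plane := EuclideanSpace.single i 1

/-- The partial derivative `∂ᵢ f` at `y` of a function on the plane. -/
def pderiv (i : Fin 2) (f : Plane → ℝ) (y : Plane) : ℝ := fderiv ℝ f y (stdVec i)

section Tensors

variable {M : Type*} [TopologicalSpace M] [ChartedSpace Plane M]

/-- A (not necessarily continuous) field of `k`-covariant tensors on the surface `M`. -/
abbrev TensorField (M : Type*) [TopologicalSpace M] [ChartedSpace Plane M] (k : ℕ) : Type _ :=
  ∀ x : M, ContinuousMultilinearMap ℝ (fun _ : Fin k => TangentSpace (𝓡 2) x) ℝ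

/-- A function, seen as a field of `0`-covariant tensors. -/
def ofFun (f : M → ℝ) : TensorField M 0 := fun x =>
  ContinuousMultilinearMap.constOfIsEmpty ℝ (fun _ : Fin 0 => TangentSpace (𝓡 2) x) (f x)

/-- The components `u_{i₁ ⋯ i_k}` at the point `y` of the tensor field `u` in the chart `e`. -/
def comp {k : ℕ} (e : OpenPartialHomeomorph M Plane) (u : TensorField M k) (y : Plane)
    (I : Fin k → Fin 2) : ℝ :=
  u (e.symm y) (fun a => mfderiv (𝓡 2) (𝓡 2) e.symm y (stdVec (I a)))

/-- The part of the target of the chart `e` that corresponds to points of `S`. -/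
def chartDom (e : OpenPartialHomeomorph M Plane) (S : Set M) : Set Plane :=
  e.target ∩ e.symm ⁻¹' S

/-- The tensor at `x` with components `c` in the preferred chart at `x`. -/
def ofComp {k : ℕ} (x : M) (c : (Fin k → Fin 2) → ℝ) :
    ContinuousMultilinearMap ℝ (fun _ : Fin k => TangentSpace (𝓡 2) x) ℝ :=
  ∑ I : Fin k → Fin 2, c I •
    (ContinuousMultilinearMap.mkPiAlgebra ℝ (Fin k) ℝ).compContinuousLinearMap
      (fun a => (EuclideanSpace.proj (I a) : Plane →L[ℝ] ℝ).comp
        (mfderiv (𝓡 2) (𝓡 2) (chartAt Plane x) x))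

/-- `u` is of class `C^r` on the open set `S` (its components in all charts are). -/
def IsCr {k : ℕ} (r : WithTop ℕ∞) (S : Set M) (u : TensorField M k) : Prop :=
  ∀ e ∈ atlas Plane M, ∀ I : Fin k → Fin 2,
    ContDiffOn ℝ r (fun y => comp e u y I) (chartDom e S)

/-- The tensor `u x` is symmetric. -/
def IsSymmAt {k : ℕ} (u : TensorField M k) (x : M) : Prop :=
  ∀ (σ : Equiv.Perm (Fin k)) (X : Fin k → TangentSpace (𝓡 2) x),
    u x (fun a => X (σ a)) = u x X

/-- `u` is a section of class `C¹` over `S` of the bundle of symmetric `k`-tensors. -/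
def IsC1Symm {k : ℕ} (S : Set M) (u : TensorField M k) : Prop :=
  IsCr 1 S u ∧ ∀ x ∈ S, IsSymmAt u x

/-- `u` is a `C¹` section over `S` of the bundle of symmetric `k`-tensors, with compact support
in `S`. -/
def IsC1SymmCompact {k : ℕ} (S : Set M) (u : TensorField M k) : Prop :=
  IsC1Symm S u ∧ ∃ K : Set M, IsCompact K ∧ K ⊆ S ∧ ∀ x ∈ S, x ∉ K → u x = 0

/-! ### Riemannian geometry in charts -/

/-- The Gram matrix `g_{ij}`. -/
def gram (e : OpenPartialHomeomorph M Plane) (g : TensorField M 2) (y : Plane) :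
    Matrix (Fin 2) (Fin 2) ℝ :=
  Matrix.of fun i j => comp e g y ![i, j]

/-- The inverse matrix `g^{ij}`. -/
def gramInv (e : OpenPartialHomeomorph M Plane) (g : TensorField M 2) (y : Plane) :
    Matrix (Fin 2) (Fin 2) ℝ :=
  (gram e g y)⁻¹

/-- The Christoffel symbol `Γ^l_{ij}` of the Levi-Civita connection of `g`. -/
def christoffel (e : OpenPartialHomeomorph M Plane) (g : TensorField M 2) (y : Plane)
    (l i j : Fin 2) : ℝ :=
  (1 / 2) * ∑ m : Fin 2, gramInv e g y l m *
    (pderiv i (fun z => gram e g z j m) y + pderiv j (fun z => gram e g z i m) y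
      - pderiv m (fun z => gram e g z i j) y)

/-- The component along `∂_l` of `R(∂_i, ∂_j)∂_k`, where
`R(X, Y) = ∇_X ∇_Y - ∇_Y ∇_X - ∇_{[X, Y]}`. -/
def riemann (e : OpenPartialHomeomorph M Plane) (g : TensorField M 2) (y : Plane)
    (l i j k : Fin 2) : ℝ :=
  pderiv i (fun z => christoffel e g z l j k) y - pderiv j (fun z => christoffel e g z l i k) y
    + ∑ m : Fin 2, (christoffel e g y l i m * christoffel e g y m j k
      - christoffel e g y l j m * christoffel e g y m i k)

/-- The Gauss curvature `g(R(∂₀, ∂₁)∂₁, ∂₀) / det g`. -/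
def gaussCurvature (e : OpenPartialHomeomorph M Plane) (g : TensorField M 2) (y : Plane) : ℝ :=
  (∑ l : Fin 2, gram e g y l 0 * riemann e g y l 0 1 1) / (gram e g y).det

/-- The component `(∇_{∂_i} u)(∂_{J 0}, ∂_{J 1}, …)` of the covariant derivative of `u`. -/
def covDeriv {k : ℕ} (e : OpenPartialHomeomorph M Plane) (g : TensorField M 2)
    (u : TensorField M k) (y : Plane) (i : Fin 2) (J : Fin k → Fin 2) : ℝ :=
  pderiv i (fun z => comp e u z J) y
    - ∑ a : Fin k, ∑ l : Fin 2,
        christoffel e g y l i (J a) * comp e u y (Function.update J a l)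

/-- The symmetrized covariant derivative of `u`, the classical form of `δ*` on `C¹` sections.
On functions it is the differential. -/
def symCovDeriv {k : ℕ} (g : TensorField M 2) (u : TensorField M k) : TensorField M (k + 1) :=
  fun x => ofComp x fun I : Fin (k + 1) → Fin 2 =>
    ((Nat.factorial (k + 1) : ℕ) : ℝ)⁻¹ * ∑ σ : Equiv.Perm (Fin (k + 1)),
      covDeriv (chartAt Plane x) g u (chartAt Plane x x) (I (σ 0)) (fun a => I (σ a.succ))

/-- The divergence `(δh)(X₁, …, X_k) = - ∑ᵢ (∇_{eᵢ} h)(eᵢ, X₁, …, X_k)` for an orthonormal frame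
`(e₁, e₂)`, that is `(δh)_J = - g^{ij} (∇_{∂_i} h)_{j J}`. -/
def divergence {k : ℕ} (g : TensorField M 2) (h : TensorField M (k + 1)) : TensorField M k :=
  fun x => ofComp x fun J : Fin k → Fin 2 =>
    -∑ i : Fin 2, ∑ j : Fin 2, gramInv (chartAt Plane x) g (chartAt Plane x x) i j *
      covDeriv (chartAt Plane x) g h (chartAt Plane x x) i
        (Fin.cons j J : Fin (k + 1) → Fin 2)

/-- The inner product that `g` induces on `k`-covariant tensors,
`(u, v)_g = g^{i₁ j₁} ⋯ g^{i_k j_k} u_{i₁ ⋯ i_k} v_{j₁ ⋯ j_k}`, at `y` in the chart `e`. -/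
def coordInner {k : ℕ} (e : OpenPartialHomeomorph M Plane) (g : TensorField M 2)
    (u v : TensorField M k) (y : Plane) : ℝ :=
  ∑ I : Fin k → Fin 2, ∑ J : Fin k → Fin 2,
    (∏ a : Fin k, gramInv e g y (I a) (J a)) * comp e u y I * comp e v y J

/-- The pointwise inner product `(u, v)_g` as a function on `M`. -/
def tensorInner {k : ℕ} (g : TensorField M 2) (u v : TensorField M k) (x : M) : ℝ :=
  coordInner (chartAt Plane x) g u v (chartAt Plane x x)

end Tensors

section Integration

variable {M : Type*} [TopologicalSpace M] [ChartedSpace Plane M] [MeasurableSpace M]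

/-- The measure `√det g dy¹ dy²` on the part in `S` of the domain of the chart `e`. -/
def chartVolume (g : TensorField M 2) (S : Set M) (e : OpenPartialHomeomorph M Plane) :
    Measure M :=
  (((volume : Measure Plane).restrict (chartDom e S)).withDensity
    (fun y => ENNReal.ofReal (Real.sqrt (gram e g y).det))).map e.symm

/-- The Riemannian area measure of `g` on `S`. The measures `chartVolume g S e` agree on the
overlaps of the charts; their supremum is the measure obtained by gluing them. -/
def areaMeasure (g : TensorField M 2) (S : Set M) : Measure M :=
  ⨆ e ∈ atlas Plane M, chartVolume g S e

/-- The square of the `L²` norm, `∫ |u|² dvol_g`. -/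
def normSq {k : ℕ} (g : TensorField M 2) (S : Set M) (u : TensorField M k) : ℝ≥0∞ :=
  ∫⁻ x, ENNReal.ofReal (tensorInner g u u x) ∂(areaMeasure g S)

/-- The `L²` scalar product `∫ (u, v)_g dvol_g`. -/
def l2Inner {k : ℕ} (g : TensorField M 2) (S : Set M) (u v : TensorField M k) : ℝ :=
  ∫ x, tensorInner g u v x ∂(areaMeasure g S)

/-- `u` is a square integrable section over `S` of the bundle of symmetric `k`-tensors. -/
def IsL2Symm {k : ℕ} (g : TensorField M 2) (S : Set M) (u : TensorField M k) : Prop :=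
  (∀ e ∈ atlas Plane M, ∀ I : Fin k → Fin 2,
    AEMeasurable (fun y => comp e u y I) ((volume : Measure Plane).restrict (chartDom e S))) ∧
  (∀ᵐ x ∂(areaMeasure g S), IsSymmAt u x) ∧
  normSq g S u < (⊤ : ℝ≥0∞)

/-- `u` is in the domain of `δ*` and `δ* u = v`. Here `δ*`, from `L²` symmetric `k`-tensors to
`L²` symmetric `(k+1)`-tensors, is the Hilbert space adjoint of the divergence with domain the
compactly supported `C¹` symmetric `(k+1)`-tensors. -/
def HasDeltaStar {k : ℕ} (g : TensorField M 2) (S : Set M)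
    (u : TensorField M k) (v : TensorField M (k + 1)) : Prop :=
  IsL2Symm g S u ∧ IsL2Symm g S v ∧
    ∀ h : TensorField M (k + 1), IsC1SymmCompact S h →
      l2Inner g S (divergence g h) u = l2Inner g S h v

/-- `h` is in the domain of `δ` and `δ h = w`. Here `δ`, from `L²` symmetric `(k+1)`-tensors to
`L²` symmetric `k`-tensors, is the closure of the divergence with domain the compactly supported
`C¹` symmetric `(k+1)`-tensors. -/
def HasDelta {k : ℕ} (g : TensorField M 2) (S : Set M)
    (h : TensorField M (k + 1)) (w : TensorField M k) : Prop :=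
  IsL2Symm g S h ∧ IsL2Symm g S w ∧
    ∃ H : ℕ → TensorField M (k + 1), (∀ m, IsC1SymmCompact S (H m)) ∧
      Tendsto (fun m => normSq g S (H m - h)) atTop (𝓝 0) ∧
      Tendsto (fun m => normSq g S (divergence g (H m) - w)) atTop (𝓝 0)

end Integration

section Metric

variable {M : Type*} [TopologicalSpace M] [ChartedSpace Plane M]

/-- Cylindrical coordinates `(ρ, θ) ∈ (0, r) × ℝ/2πaℤ` around the cone point `q`, in which the
metric is `dρ² + sinh² ρ dθ²`. They identify a punctured neighbourhood of `q` with a punctured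
neighbourhood of the cone point of the hyperbolic disk with a cone singularity of angle `2πa`. -/
structure IsCylindrical (g : TensorField M 2) (S : Set M) (q : M) (a r : ℝ)
    (Φ : ℝ × ℝ → M) : Prop where
  radius_pos : 0 < r
  mem : ∀ z ∈ Ioo 0 r ×ˢ (univ : Set ℝ), Φ z ∈ S
  contMDiffOn : ContMDiffOn 𝓘(ℝ, ℝ × ℝ) (𝓡 2) 2 Φ (Ioo 0 r ×ˢ univ)
  eq_iff : ∀ ρ ∈ Ioo 0 r, ∀ ρ' ∈ Ioo 0 r, ∀ θ θ' : ℝ,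
    Φ (ρ, θ) = Φ (ρ', θ') ↔ ρ = ρ' ∧ ∃ m : ℤ, θ' = θ + m * (2 * Real.pi * a)
  /-- The images of the sets `(0, s) × ℝ` form a basis of punctured neighbourhoods of `q`. -/
  map_eq : Filter.map Φ (𝓝[>] (0 : ℝ) ×ˢ (⊤ : Filter ℝ)) = 𝓝[≠] q
  metric_rho : ∀ z ∈ Ioo 0 r ×ˢ (univ : Set ℝ),
    g (Φ z) ![mfderiv 𝓘(ℝ, ℝ × ℝ) (𝓡 2) Φ z ((1, 0) : ℝ × ℝ),
      mfderiv 𝓘(ℝ, ℝ × ℝ) (𝓡 2) Φ z ((1, 0) : ℝ × ℝ)] = 1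
  metric_mixed : ∀ z ∈ Ioo 0 r ×ˢ (univ : Set ℝ),
    g (Φ z) ![mfderiv 𝓘(ℝ, ℝ × ℝ) (𝓡 2) Φ z ((1, 0) : ℝ × ℝ),
      mfderiv 𝓘(ℝ, ℝ × ℝ) (𝓡 2) Φ z ((0, 1) : ℝ × ℝ)] = 0
  metric_theta : ∀ z ∈ Ioo 0 r ×ˢ (univ : Set ℝ),
    g (Φ z) ![mfderiv 𝓘(ℝ, ℝ × ℝ) (𝓡 2) Φ z ((0, 1) : ℝ × ℝ),
      mfderiv 𝓘(ℝ, ℝ × ℝ) (𝓡 2) Φ z ((0, 1) : ℝ × ℝ)] = Real.sinh z.1 ^ 2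

/-- `g` is a hyperbolic metric on `M ∖ {p₁, …, p_n}` with cone singularities of angle `2π αᵢ` at
the points `pᵢ`: a Riemannian metric of class `C²` and of curvature `-1` on the punctured surface,
isometric near each `pᵢ` to a neighbourhood of the cone point in the hyperbolic disk with a cone
singularity. The values of `g` at the points `pᵢ` are irrelevant. -/
structure IsHyperbolicConeMetric {n : ℕ} (p : Fin n → M) (α : Fin n → ℝ)
    (g : TensorField M 2) : Prop where
  contDiff : IsCr 2 (range p)ᶜ g
  symm : ∀ x ∈ (range p)ᶜ, IsSymmAt g x
  pos : ∀ x ∈ (range p)ᶜ, ∀ X : TangentSpace (𝓡 2) x, X ≠ 0 → 0 < g x ![X, X]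
  curvature : ∀ e ∈ atlas Plane M, ∀ y ∈ chartDom e (range p)ᶜ, gaussCurvature e g y = -1
  cone : ∀ i, ∃ (r : ℝ) (Φ : ℝ × ℝ → M), IsCylindrical g (range p)ᶜ (p i) (α i) r Φ

end Metric

end ConeSurface

end

set_option linter.unusedSectionVars false

open Set Filter Topology MeasureTheory
open scoped Manifold ContDiff ENNReal

noncomputable section

namespace ConeSurface

/-! ### The action of matrices on the components of covariant tensors -/

/-! With the sign convention for `divergence`, the 1-form γ = h(u♯, ·) satisfies div γ = (div h, u)
− (h, Sym∇u), and γ = fβ satisfies div γ = f div β − (df, β) (`val_divergence_contract`,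
`val_divergence_smul`). Each Green formula therefore says that div γ, which is integrable, has
integral zero over S. For γ with compact support in S this is the divergence theorem
`integral_divergence`. The point is that nothing is lost at the cone points, although u and h are
merely square integrable there.

Multiply γ by a cutoff χ_N that vanishes near the cone points. Then ∫ χ_N div γ = ∫ (dχ_N, γ), and
|(dχ_N, γ)| ≤ |dχ_N| |u| |h|. As h is in L² and dχ_N is eventually zero at each point, dominated
convergence finishes the proof once |dχ_N|²|u|² has an integrable bound independent of N. For χ_N
take logarithmic cutoffs, going from 0 to 1 while log ρ runs from −2N to −N. Where dχ_N does not
vanish, N is comparable to |log ρ|, so that |dχ_N| ≤ C/(Nρ) ≤ C'/(ρ|log ρ|). What is needed is thus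
the finiteness of ∫ |u|²/(ρ log ρ)² near each cone point. `IsCutoffSeq` records exactly these
properties.

This finiteness is a Hardy inequality, `lintegral_hardy_lt_top`, and only Sym∇u, not ∇u, is at hand
to prove it. Put κ = 1/log(1/ρ), s = sinh ρ, and u = a dρ + b dθ. The 1-form (8κa²/s + κ²b²/s³) dρ +
(2κ²ab/s) dθ is chosen so that ∂_ρ b and ∂_θ a enter its trace divergence only through their sum,
hence through Sym∇u. Completing squares shows that this divergence is at least κ²|u|²/s² −
64|Sym∇u|² (`hardy_bound`, `hardy_pointwise`). The field is multiplied by a function ψ_m of ρ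
supported away from the cone point and integrated. The rising part of ψ_m has a steep slope but
contributes with the favourable sign, so the bounds do not depend on m and Fatou's lemma applies.

The operators δ and δ* are linked to the classical ones by testing against compactly supported C¹
tensors (`ae_eq_of_forall_l2Inner`). That a 1-form β in H¹ lies in the domain of δ follows from the
same cutoffs: χ_N β converges to β in the graph norm (`IsCutoffSeq.hasDelta`), because |div β|² ≤
2|Sym∇β|² and because the Hardy inequality controls |dχ_N||β|.

The cylindrical coordinates are only of class C², and the differential operators are defined through
the preferred chart at each point. The groundwork therefore consists in showing that ∇ and the area
measure are given by the usual formulas in every chart of the maximal C² atlas. -/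

/-- The action of a matrix on all indices of a family of components. -/
def tact {k : ℕ} (B : Matrix (Fin 2) (Fin 2) ℝ) (u : (Fin k → Fin 2) → ℝ) :
    (Fin k → Fin 2) → ℝ :=
  fun K => ∑ I : Fin k → Fin 2, (∏ a, B (K a) (I a)) * u I

theorem sum_prod_apply {k : ℕ} (f : Fin k → Fin 2 → ℝ) :
    ∑ I : Fin k → Fin 2, ∏ a, f a (I a) = ∏ a, ∑ i, f a i := by
  rw [Finset.prod_univ_sum, Fintype.piFinset_univ]

theorem tact_mul {k : ℕ} (B C : Matrix (Fin 2) (Fin 2) ℝ) (u : (Fin k → Fin 2) → ℝ) :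
    tact (B * C) u = tact B (tact C u) := by
  funext K
  simp only [tact, Finset.mul_sum]
  rw [Finset.sum_comm]
  refine Finset.sum_congr rfl fun J _ => ?_
  simp only [Matrix.mul_apply]
  rw [← sum_prod_apply (fun a i => B (K a) i * C i (J a)), Finset.sum_mul]
  refine Finset.sum_congr rfl fun I _ => ?_
  rw [Finset.prod_mul_distrib, mul_assoc]

theorem tact_one {k : ℕ} (u : (Fin k → Fin 2) → ℝ) : tact 1 u = u := by
  funext K
  simp only [tact]
  rw [Finset.sum_eq_single K]
  · simp
  · intro I _ hI
    obtain ⟨a, ha⟩ := Function.ne_iff.1 hI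
    rw [Finset.prod_eq_zero (Finset.mem_univ a), zero_mul]
    exact Matrix.one_apply_ne (Ne.symm ha)
  · simp

theorem tact_smul {k : ℕ} (B : Matrix (Fin 2) (Fin 2) ℝ) (c : ℝ) (u : (Fin k → Fin 2) → ℝ) :
    tact B (c • u) = c • tact B u := by
  funext K
  simp only [tact, Pi.smul_apply, smul_eq_mul, Finset.mul_sum]
  exact Finset.sum_congr rfl fun _ _ => by ring

theorem tact_zero {k : ℕ} (B : Matrix (Fin 2) (Fin 2) ℝ) :
    tact B (0 : (Fin k → Fin 2) → ℝ) = 0 := by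
  funext K
  simp [tact]

theorem dotProduct_tact {k : ℕ} (B : Matrix (Fin 2) (Fin 2) ℝ) (u v : (Fin k → Fin 2) → ℝ) :
    u ⬝ᵥ tact B v = tact B.transpose u ⬝ᵥ v := by
  simp only [dotProduct, tact, Finset.mul_sum, Finset.sum_mul, Matrix.transpose_apply]
  rw [Finset.sum_comm]
  exact Finset.sum_congr rfl fun _ _ => Finset.sum_congr rfl fun _ _ => by ring

theorem tact_perm {k : ℕ} (B : Matrix (Fin 2) (Fin 2) ℝ) (u : (Fin k → Fin 2) → ℝ)
    (hu : ∀ (σ : Equiv.Perm (Fin k)) I, u (fun a => I (σ a)) = u I)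
    (σ : Equiv.Perm (Fin k)) (K : Fin k → Fin 2) :
    tact B u (fun a => K (σ a)) = tact B u K := by
  simp only [tact]
  rw [← (Equiv.arrowCongr σ.symm (Equiv.refl (Fin 2))).sum_comp]
  refine Finset.sum_congr rfl fun I _ => ?_
  have h1 : ((σ.symm.arrowCongr (Equiv.refl (Fin 2))) I) = fun a => I (σ a) := by
    funext a; simp [Equiv.arrowCongr]
  rw [h1, hu σ I, Equiv.prod_comp σ (fun a => B (K a) (I a))]

/-! ### Components of tensors and changes of charts of class `C²` -/

section Charts

variable {M : Type*} [TopologicalSpace M] [ChartedSpace Plane M]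

theorem plane_eq_sum (v : Plane) : v = ∑ p : Fin 2, v p • stdVec p := by
  ext i
  fin_cases i <;> simp [stdVec, Fin.sum_univ_two]

/-- The components of a multilinear form in a family of vectors obtained by a matrix. -/
theorem multilinear_sum_apply {k : ℕ} {E : Type*} [AddCommGroup E] [Module ℝ E]
    [TopologicalSpace E]
    (u : ContinuousMultilinearMap ℝ (fun _ : Fin k => E) ℝ) (X Y : Fin 2 → E)
    (A : Matrix (Fin 2) (Fin 2) ℝ) (hY : ∀ i, Y i = ∑ p, A p i • X p) (I : Fin k → Fin 2) :
    u (fun a => Y (I a)) = tact A.transpose (fun J => u (fun a => X (J a))) I := by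
  simp only [hY, tact]
  have := u.map_sum (fun (a : Fin k) (p : Fin 2) => A p (I a) • X p)
  rw [this]
  refine Finset.sum_congr rfl fun J _ => ?_
  rw [u.map_smul_univ (fun a => A (J a) (I a)) (fun a => X (J a))]
  rfl

/-- The change of charts from `e` to `e'`. -/
def trans (e e' : OpenPartialHomeomorph M Plane) (y : Plane) : Plane := e' (e.symm y)

/-- The Jacobian matrix of the change of charts from `e` to `e'`. -/
def jac (e e' : OpenPartialHomeomorph M Plane) (y : Plane) : Matrix (Fin 2) (Fin 2) ℝ :=
  Matrix.of fun p i => pderiv i (fun z => trans e e' z p) y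

variable {e e' : OpenPartialHomeomorph M Plane}

/-- The set on which the change of charts is defined. -/
def transDom (e e' : OpenPartialHomeomorph M Plane) : Set Plane :=
  e.target ∩ e.symm ⁻¹' e'.source

theorem isOpen_transDom : IsOpen (transDom e e') :=
  e.isOpen_inter_preimage_symm e'.open_source

theorem isOpen_chartDom {S : Set M} (hS : IsOpen S) : IsOpen (chartDom e S) :=
  e.isOpen_inter_preimage_symm hS

theorem trans_mem {y : Plane} (hy : y ∈ transDom e e') : trans e e' y ∈ transDom e' e := by
  refine ⟨e'.map_source hy.2, ?_⟩
  simp only [mem_preimage, trans, e'.left_inv hy.2]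
  exact e.map_target hy.1

theorem symm_trans {y : Plane} (hy : y ∈ transDom e e') : e'.symm (trans e e' y) = e.symm y :=
  e'.left_inv hy.2

theorem trans_trans {y : Plane} (hy : y ∈ transDom e e') :
    trans e' e (trans e e' y) = y := by
  simp only [trans]
  rw [e'.left_inv hy.2, e.right_inv hy.1]

theorem trans_mem_chartDom {S : Set M} {y : Plane} (hy : y ∈ transDom e e')
    (hyS : y ∈ chartDom e S) : trans e e' y ∈ chartDom e' S := by
  refine ⟨e'.map_source hy.2, ?_⟩
  simpa [mem_preimage, symm_trans hy] using hyS.2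

variable [IsManifold (𝓡 2) 2 M]

theorem contDiffOn_trans (he : e ∈ IsManifold.maximalAtlas (𝓡 2) 2 M)
    (he' : e' ∈ IsManifold.maximalAtlas (𝓡 2) 2 M) :
    ContDiffOn ℝ 2 (trans e e') (transDom e e') := by
  rw [← contMDiffOn_iff_contDiffOn]
  exact (contMDiffOn_of_mem_maximalAtlas he').comp
    ((contMDiffOn_symm_of_mem_maximalAtlas he).mono inter_subset_left) (fun _ h => h.2)

theorem contDiffAt_trans (he : e ∈ IsManifold.maximalAtlas (𝓡 2) 2 M)
    (he' : e' ∈ IsManifold.maximalAtlas (𝓡 2) 2 M) {y : Plane} (hy : y ∈ transDom e e') :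
    ContDiffAt ℝ 2 (trans e e') y :=
  (contDiffOn_trans he he').contDiffAt (isOpen_transDom.mem_nhds hy)

theorem jac_apply_eq (he : e ∈ IsManifold.maximalAtlas (𝓡 2) 2 M)
    (he' : e' ∈ IsManifold.maximalAtlas (𝓡 2) 2 M) {y : Plane} (hy : y ∈ transDom e e')
    (p i : Fin 2) : jac e e' y p i = (fderiv ℝ (trans e e') y (stdVec i)) p := by
  have h := ((contDiffAt_trans he he' hy).differentiableAt (by norm_num)).hasFDerivAt
  have h2 := (EuclideanSpace.proj p : Plane →L[ℝ] ℝ).hasFDerivAt.comp y h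
  simp only [jac, Matrix.of_apply, pderiv]
  have h3 : (fun z => trans e e' z p) = (EuclideanSpace.proj p : Plane →L[ℝ] ℝ) ∘ trans e e' := by
    funext z; simp
  rw [h3, h2.fderiv]
  simp

theorem fderiv_trans_stdVec (he : e ∈ IsManifold.maximalAtlas (𝓡 2) 2 M)
    (he' : e' ∈ IsManifold.maximalAtlas (𝓡 2) 2 M) {y : Plane} (hy : y ∈ transDom e e')
    (i : Fin 2) : fderiv ℝ (trans e e') y (stdVec i) = ∑ p, jac e e' y p i • stdVec p := by
  rw [plane_eq_sum (fderiv ℝ (trans e e') y (stdVec i))]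
  simp only [jac_apply_eq he he' hy]

theorem mdifferentiableAt_symm (he : e ∈ IsManifold.maximalAtlas (𝓡 2) 2 M) {y : Plane}
    (hy : y ∈ e.target) : MDifferentiableAt (𝓡 2) (𝓡 2) e.symm y :=
  ((contMDiffOn_symm_of_mem_maximalAtlas he).contMDiffAt
    (e.open_target.mem_nhds hy)).mdifferentiableAt (by norm_num)

theorem mdifferentiableAt_chart (he : e ∈ IsManifold.maximalAtlas (𝓡 2) 2 M) {x : M}
    (hx : x ∈ e.source) : MDifferentiableAt (𝓡 2) (𝓡 2) e x :=
  ((contMDiffOn_of_mem_maximalAtlas he).contMDiffAt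
    (e.open_source.mem_nhds hx)).mdifferentiableAt (by norm_num)

theorem eventually_symm_eq {y : Plane} (hy : y ∈ transDom e e') :
    (e.symm : Plane → M) =ᶠ[𝓝 y] e'.symm ∘ trans e e' := by
  filter_upwards [isOpen_transDom.mem_nhds hy] with z hz
  exact (symm_trans hz).symm

theorem mfderiv_symm_stdVec (he : e ∈ IsManifold.maximalAtlas (𝓡 2) 2 M)
    (he' : e' ∈ IsManifold.maximalAtlas (𝓡 2) 2 M) {y : Plane} (hy : y ∈ transDom e e')
    (i : Fin 2) : (mfderiv (𝓡 2) (𝓡 2) e.symm y (stdVec i) : Plane) =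
      ∑ p, jac e e' y p i • (mfderiv (𝓡 2) (𝓡 2) e'.symm (trans e e' y) (stdVec p) : Plane) := by
  have h1 : mfderiv (𝓡 2) (𝓡 2) e.symm y
      = mfderiv (𝓡 2) (𝓡 2) (e'.symm ∘ trans e e') y :=
    (eventually_symm_eq hy).mfderiv_eq
  have hd : MDifferentiableAt (𝓡 2) (𝓡 2) (trans e e') y :=
    ((contDiffAt_trans he he' hy).differentiableAt (by norm_num)).mdifferentiableAt
  have h2 := mfderiv_comp y (mdifferentiableAt_symm he' (trans_mem hy).1) hd
  have h3 : mfderiv (𝓡 2) (𝓡 2) e.symm y (stdVec i)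
      = (mfderiv (𝓡 2) (𝓡 2) e'.symm (trans e e' y)) (fderiv ℝ (trans e e') y (stdVec i)) := by
    rw [h1, h2, mfderiv_eq_fderiv]; rfl
  refine h3.trans ?_
  rw [fderiv_trans_stdVec he he' hy i]
  exact (map_sum (mfderiv (𝓡 2) (𝓡 2) e'.symm (trans e e' y)) _ _).trans
    (Finset.sum_congr rfl fun p _ => map_smul _ _ _)

/-- The transformation of the components of a tensor under a change of charts. -/
theorem comp_eq_tact {k : ℕ} (he : e ∈ IsManifold.maximalAtlas (𝓡 2) 2 M)
    (he' : e' ∈ IsManifold.maximalAtlas (𝓡 2) 2 M) {y : Plane} (hy : y ∈ transDom e e')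
    (u : TensorField M k) :
    comp e u y = tact (jac e e' y).transpose (comp e' u (trans e e' y)) := by
  have hx := symm_trans hy
  -- The fibres over `e'.symm (trans e e' y)` and `e.symm y` are equal only propositionally.
  -- Quantifying over the base point, with the frame read in the model plane, lets `rfl` identify
  -- them.
  have key : ∀ x, x = e.symm y → ∀ X : Fin 2 → Plane,
      (∀ i, (mfderiv (𝓡 2) (𝓡 2) e.symm y (stdVec i) : Plane) = ∑ p, jac e e' y p i • X p) →
      comp e u y = tact (jac e e' y).transpose
        (fun J => u x (fun a => X (J a))) := by
    rintro x rfl X hX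
    funext I
    exact multilinear_sum_apply (E := TangentSpace (𝓡 2) (e.symm y)) (u (e.symm y)) X
      (fun i => mfderiv (𝓡 2) (𝓡 2) e.symm y (stdVec i)) (jac e e' y) hX I
  exact key _ hx _ (mfderiv_symm_stdVec he he' hy)

theorem jac_mul_jac (he : e ∈ IsManifold.maximalAtlas (𝓡 2) 2 M)
    (he' : e' ∈ IsManifold.maximalAtlas (𝓡 2) 2 M) {y : Plane} (hy : y ∈ transDom e e') :
    jac e' e (trans e e' y) * jac e e' y = 1 := by
  have h1 := ((contDiffAt_trans he he' hy).differentiableAt (by norm_num)).hasFDerivAt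
  have h2 := ((contDiffAt_trans he' he (trans_mem hy)).differentiableAt (by norm_num)).hasFDerivAt
  have h3 := h2.comp y h1
  have h4 : (trans e' e ∘ trans e e') =ᶠ[𝓝 y] id := by
    filter_upwards [isOpen_transDom.mem_nhds hy] with z hz using trans_trans hz
  have h5 := (h3.congr_of_eventuallyEq h4.symm).unique (hasFDerivAt_id y)
  ext p i
  have h6 := congrArg (fun L : Plane →L[ℝ] Plane => (L (stdVec i)) p) h5
  simp only [ContinuousLinearMap.comp_apply, fderiv_trans_stdVec he he' hy, map_sum, map_smul,
    ContinuousLinearMap.id_apply] at h6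
  rw [Matrix.mul_apply]
  simp only [jac_apply_eq he' he (trans_mem hy)]
  simp only [PiLp.smul_apply, WithLp.ofLp_sum, Finset.sum_apply, smul_eq_mul] at h6
  calc _ = _ := Finset.sum_congr rfl fun q _ => mul_comm _ _
    _ = _ := h6
    _ = _ := by
      simp [stdVec, Matrix.one_apply]

theorem jac_mul_jac' (he : e ∈ IsManifold.maximalAtlas (𝓡 2) 2 M)
    (he' : e' ∈ IsManifold.maximalAtlas (𝓡 2) 2 M) {y : Plane} (hy : y ∈ transDom e e') :
    jac e e' y * jac e' e (trans e e' y) = 1 :=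
  mul_eq_one_comm.1 (jac_mul_jac he he' hy)

theorem det_jac_ne_zero (he : e ∈ IsManifold.maximalAtlas (𝓡 2) 2 M)
    (he' : e' ∈ IsManifold.maximalAtlas (𝓡 2) 2 M) {y : Plane} (hy : y ∈ transDom e e') :
    (jac e e' y).det ≠ 0 := by
  intro h
  have := congrArg Matrix.det (jac_mul_jac he he' hy)
  rw [Matrix.det_mul, h] at this
  simp at this

end Charts

/-! ### Transformation laws of the metric, of inner products and of components. -/

section Gram

variable {M : Type*} [TopologicalSpace M] [ChartedSpace Plane M] [IsManifold (𝓡 2) 2 M]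
variable {e e' : OpenPartialHomeomorph M Plane}

theorem sum_fin_two_arrow (f : (Fin 2 → Fin 2) → ℝ) :
    ∑ I, f I = ∑ i, ∑ j, f ![i, j] := by
  rw [← (finTwoArrowEquiv (Fin 2)).symm.sum_comp, Fintype.sum_prod_type]
  rfl

theorem sum_fin_one_arrow (f : (Fin 1 → Fin 2) → ℝ) :
    ∑ I, f I = ∑ i, f ![i] := by
  rw [← (Equiv.funUnique (Fin 1) (Fin 2)).symm.sum_comp]
  refine Finset.sum_congr rfl fun i _ => congrArg f ?_
  funext a
  fin_cases a
  rfl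

theorem mem_maximalAtlas (he : e ∈ atlas Plane M) :
    e ∈ IsManifold.maximalAtlas (𝓡 2) 2 M :=
  IsManifold.subset_maximalAtlas he

theorem chartAt_mem_maximalAtlas (x : M) :
    chartAt Plane x ∈ IsManifold.maximalAtlas (𝓡 2) 2 M :=
  IsManifold.chart_mem_maximalAtlas x

theorem mem_transDom_chartAt {y : Plane} (hy : y ∈ e.target) :
    y ∈ transDom e (chartAt Plane (e.symm y)) :=
  ⟨hy, mem_chart_source Plane (e.symm y)⟩

theorem gram_eq (he : e ∈ IsManifold.maximalAtlas (𝓡 2) 2 M)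
    (he' : e' ∈ IsManifold.maximalAtlas (𝓡 2) 2 M) {y : Plane} (hy : y ∈ transDom e e')
    (h : TensorField M 2) :
    gram e h y = (jac e e' y).transpose * gram e' h (trans e e' y) * jac e e' y := by
  ext i j
  simp only [gram, Matrix.of_apply, Matrix.mul_apply]
  rw [comp_eq_tact he he' hy h]
  simp only [tact, sum_fin_two_arrow, Fin.prod_univ_two, Matrix.transpose_apply, Fin.sum_univ_two,
    Matrix.cons_val_zero, Matrix.cons_val_one]
  ring

theorem gramInv_eq (he : e ∈ IsManifold.maximalAtlas (𝓡 2) 2 M)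
    (he' : e' ∈ IsManifold.maximalAtlas (𝓡 2) 2 M) {y : Plane} (hy : y ∈ transDom e e')
    (h : TensorField M 2) :
    gramInv e' h (trans e e' y) = jac e e' y * gramInv e h y * (jac e e' y).transpose := by
  have h1 := jac_mul_jac' he he' hy
  have h2 : IsUnit (jac e e' y).det := (det_jac_ne_zero he he' hy).isUnit
  have h3 : IsUnit (jac e e' y).transpose.det := by rwa [Matrix.det_transpose]
  simp only [gramInv]
  rw [gram_eq he he' hy h, Matrix.mul_inv_rev, Matrix.mul_inv_rev]
  simp only [Matrix.mul_assoc]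
  rw [Matrix.nonsing_inv_mul _ h3, Matrix.mul_one, ← Matrix.mul_assoc,
    Matrix.mul_nonsing_inv _ h2, Matrix.one_mul]

theorem coordInner_eq {k : ℕ} (g : TensorField M 2) (u v : TensorField M k) (y : Plane) :
    coordInner e g u v y = comp e u y ⬝ᵥ tact (gramInv e g y) (comp e v y) := by
  simp only [coordInner, dotProduct, tact, Finset.mul_sum]
  exact Finset.sum_congr rfl fun _ _ => Finset.sum_congr rfl fun _ _ => by ring

/-- The Jacobian A acts on components through Aᵀ and on the inverse metric by W ↦ A W Aᵀ. Moving one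
factor across the dot product by transposition matches the two expressions. -/
theorem coordInner_trans {k : ℕ} (he : e ∈ IsManifold.maximalAtlas (𝓡 2) 2 M)
    (he' : e' ∈ IsManifold.maximalAtlas (𝓡 2) 2 M) {y : Plane} (hy : y ∈ transDom e e')
    (g : TensorField M 2) (u v : TensorField M k) :
    coordInner e g u v y = coordInner e' g u v (trans e e' y) := by
  rw [coordInner_eq, coordInner_eq, gramInv_eq he he' hy, comp_eq_tact he he' hy u,
    comp_eq_tact he he' hy v, Matrix.mul_assoc, tact_mul, dotProduct_tact (jac e e' y), tact_mul]

theorem tensorInner_symm_apply {k : ℕ} (he : e ∈ IsManifold.maximalAtlas (𝓡 2) 2 M)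
    {y : Plane} (hy : y ∈ e.target) (g : TensorField M 2) (u v : TensorField M k) :
    tensorInner g u v (e.symm y) = coordInner e g u v y :=
  (coordInner_trans he (chartAt_mem_maximalAtlas _) (mem_transDom_chartAt hy) g u v).symm

/-! ### Linearity of components -/

theorem comp_sub {k : ℕ} (u v : TensorField M k) (y : Plane) :
    comp e (u - v) y = comp e u y - comp e v y := rfl

theorem comp_smul {k : ℕ} (f : M → ℝ) (u : TensorField M k) (y : Plane) :
    comp e (fun x => f x • u x) y = f (e.symm y) • comp e u y := rfl

theorem comp_ofFun (f : M → ℝ) (y : Plane) (I : Fin 0 → Fin 2) :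
    comp e (ofFun f) y I = f (e.symm y) := rfl

theorem comp_congr_point {k : ℕ} {u v : TensorField M k} {y : Plane}
    (h : u (e.symm y) = v (e.symm y)) : comp e u y = comp e v y := by
  funext I
  simp only [comp, h]

theorem comp_perm {k : ℕ} {u : TensorField M k} {y : Plane} (h : IsSymmAt u (e.symm y))
    (σ : Equiv.Perm (Fin k)) (I : Fin k → Fin 2) :
    comp e u y (fun a => I (σ a)) = comp e u y I :=
  h σ (fun a => mfderiv (𝓡 2) (𝓡 2) e.symm y (stdVec (I a)))

/-! ### Bases of the tangent spaces -/

theorem mfderiv_symm_comp_mfderiv (he : e ∈ IsManifold.maximalAtlas (𝓡 2) 2 M) {x : M}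
    (hx : x ∈ e.source) (X : TangentSpace (𝓡 2) x) :
    mfderiv (𝓡 2) (𝓡 2) e.symm (e x) (mfderiv (𝓡 2) (𝓡 2) e x X) = X := by
  have h1 : MDifferentiableAt (𝓡 2) (𝓡 2) e.symm (e x) :=
    mdifferentiableAt_symm he (e.map_source hx)
  have h2 := mfderiv_comp x h1 (mdifferentiableAt_chart he hx)
  have h3 : (e.symm ∘ e) =ᶠ[𝓝 x] id := by
    filter_upwards [e.open_source.mem_nhds hx] with z hz using e.left_inv hz
  rw [h3.mfderiv_eq, mfderiv_id] at h2
  exact (congrArg (fun L => L X) h2).symm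

theorem mfderiv_comp_mfderiv_symm (he : e ∈ IsManifold.maximalAtlas (𝓡 2) 2 M) {y : Plane}
    (hy : y ∈ e.target) (v : Plane) :
    (mfderiv (𝓡 2) (𝓡 2) e (e.symm y) (mfderiv (𝓡 2) (𝓡 2) e.symm y v) : Plane) = v := by
  have h1 : MDifferentiableAt (𝓡 2) (𝓡 2) e (e.symm y) :=
    mdifferentiableAt_chart he (e.map_target hy)
  have h2 := mfderiv_comp y h1 (mdifferentiableAt_symm he hy)
  have h3 : (e ∘ e.symm) =ᶠ[𝓝 y] id := by
    filter_upwards [e.open_target.mem_nhds hy] with z hz using e.right_inv hz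
  rw [h3.mfderiv_eq, mfderiv_id] at h2
  exact (congrArg (fun L => L v) h2).symm

/-- A tensor at `e.symm y` is determined by its components. -/
theorem eq_of_comp_eq {k : ℕ} (he : e ∈ IsManifold.maximalAtlas (𝓡 2) 2 M) {x : M}
    (hx : x ∈ e.source) {u v : TensorField M k} (h : comp e u (e x) = comp e v (e x)) :
    u x = v x := by
  have hex : e.symm (e x) = x := e.left_inv hx
  have key : ∀ x', e.symm (e x) = x' → x' = x → u x' = v x' := by
    rintro x' rfl _
    ext X
    have hX : ∀ a, ∃ c : Fin 2 → ℝ, X a =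
        ∑ p, c p • mfderiv (𝓡 2) (𝓡 2) e.symm (e x) (stdVec p) := by
      intro a
      obtain ⟨w, hw⟩ : ∃ w : Plane, X a = mfderiv (𝓡 2) (𝓡 2) e.symm (e x) w := by
        have h5 := mfderiv_symm_comp_mfderiv he (x := e.symm (e x))
          (e.map_target (e.map_source hx)) (X a)
        have h6 : e (e.symm (e x)) = e x := e.right_inv (e.map_source hx)
        refine ⟨mfderiv (𝓡 2) (𝓡 2) e (e.symm (e x)) (X a), ?_⟩
        rw [h6] at h5
        exact h5.symm
      refine ⟨fun p => w p, ?_⟩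
      rw [hw, plane_eq_sum w]
      refine (map_sum (mfderiv (𝓡 2) (𝓡 2) e.symm (e x)) _ _).trans
        (Finset.sum_congr rfl fun p _ => ?_)
      rw [← plane_eq_sum w]
      exact map_smul (mfderiv (𝓡 2) (𝓡 2) e.symm (e x)) _ _
    choose c hc using hX
    have h7 : X = fun a => ∑ p, c a p • mfderiv (𝓡 2) (𝓡 2) e.symm (e x) (stdVec p) := funext hc
    rw [h7]
    rw [(u _).map_sum (fun (a : Fin k) (p : Fin 2) =>
        c a p • mfderiv (𝓡 2) (𝓡 2) e.symm (e x) (stdVec p)),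
      (v _).map_sum (fun (a : Fin k) (p : Fin 2) =>
        c a p • mfderiv (𝓡 2) (𝓡 2) e.symm (e x) (stdVec p))]
    refine Finset.sum_congr rfl fun J _ => ?_
    rw [(u _).map_smul_univ (fun a => c a (J a))
        (fun a => mfderiv (𝓡 2) (𝓡 2) e.symm (e x) (stdVec (J a))),
      (v _).map_smul_univ (fun a => c a (J a))
        (fun a => mfderiv (𝓡 2) (𝓡 2) e.symm (e x) (stdVec (J a)))]
    exact congrArg _ (congrFun h J)
  exact key x hex rfl

/-- The tensor at `x` with components `c` in the chart `e`. -/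
def ofCompIn {k : ℕ} (e : OpenPartialHomeomorph M Plane) (x : M) (c : (Fin k → Fin 2) → ℝ) :
    ContinuousMultilinearMap ℝ (fun _ : Fin k => TangentSpace (𝓡 2) x) ℝ :=
  ∑ I : Fin k → Fin 2, c I •
    (ContinuousMultilinearMap.mkPiAlgebra ℝ (Fin k) ℝ).compContinuousLinearMap
      (fun a => (EuclideanSpace.proj (I a) : Plane →L[ℝ] ℝ).comp
        (mfderiv (𝓡 2) (𝓡 2) e x))

theorem ofCompIn_apply {k : ℕ} (x : M) (c : (Fin k → Fin 2) → ℝ)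
    (X : Fin k → TangentSpace (𝓡 2) x) :
    ofCompIn e x c X = ∑ I : Fin k → Fin 2, c I *
      ∏ a, (EuclideanSpace.proj (I a) : Plane →L[ℝ] ℝ) (mfderiv (𝓡 2) (𝓡 2) e x (X a)) := by
  rw [ofCompIn, sum_apply]
  rfl

theorem comp_ofCompIn {k : ℕ} (he : e ∈ IsManifold.maximalAtlas (𝓡 2) 2 M) {y : Plane}
    (hy : y ∈ e.target) (c : M → (Fin k → Fin 2) → ℝ) :
    comp e (fun x => ofCompIn e x (c x)) y = c (e.symm y) := by
  funext I
  simp only [comp]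
  rw [ofCompIn_apply]
  have h1 : ∀ i, (mfderiv (𝓡 2) (𝓡 2) e (e.symm y)
      (mfderiv (𝓡 2) (𝓡 2) e.symm y (stdVec i)) : Plane) = stdVec i :=
    fun i => mfderiv_comp_mfderiv_symm he hy (stdVec i)
  have h2 : ∀ J : Fin k → Fin 2, (∏ a, (EuclideanSpace.proj (J a) : Plane →L[ℝ] ℝ)
      (mfderiv (𝓡 2) (𝓡 2) e (e.symm y)
        (mfderiv (𝓡 2) (𝓡 2) e.symm y (stdVec (I a))))) = if J = I then 1 else 0 := by
    intro J
    have h3 : ∀ a, (EuclideanSpace.proj (J a) : Plane →L[ℝ] ℝ)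
        (mfderiv (𝓡 2) (𝓡 2) e (e.symm y) (mfderiv (𝓡 2) (𝓡 2) e.symm y (stdVec (I a))))
        = stdVec (I a) (J a) := fun a => congrArg (fun w : Plane => w (J a)) (h1 (I a))
    rw [Finset.prod_congr rfl fun a _ => h3 a]
    split_ifs with hJ
    · subst hJ; simp [stdVec]
    · obtain ⟨a, ha⟩ := Function.ne_iff.1 hJ
      refine Finset.prod_eq_zero (Finset.mem_univ a) ?_
      simp [stdVec, ha]
  simp only [h2]
  simp

theorem comp_ofComp {k : ℕ} (x : M) (c : M → (Fin k → Fin 2) → ℝ) :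
    comp (chartAt Plane x) (fun z => ofComp z (c z)) (chartAt Plane x x) = c x := by
  have h := comp_ofCompIn (chartAt_mem_maximalAtlas x)
    ((chartAt Plane x).map_source (mem_chart_source Plane x)) c
  have h0 : (chartAt Plane x).symm (chartAt Plane x x) = x :=
    (chartAt Plane x).left_inv (mem_chart_source Plane x)
  rw [h0] at h
  rw [← h]
  refine comp_congr_point ?_
  rw [h0]
  rfl

end Gram

/-! ### Pointwise linear algebra of a Riemannian metric. -/

section Pointwise

variable {M : Type*} [TopologicalSpace M] [ChartedSpace Plane M] [IsManifold (𝓡 2) 2 M]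
variable {e e' : OpenPartialHomeomorph M Plane}

/-- `g` is a Riemannian metric of class `C¹` on the open set `S`. -/
structure IsRiem (S : Set M) (g : TensorField M 2) : Prop where
  isOpen : IsOpen S
  contDiff : IsCr 1 S g
  symm : ∀ x ∈ S, IsSymmAt g x
  pos : ∀ x ∈ S, ∀ X : TangentSpace (𝓡 2) x, X ≠ 0 → 0 < g x ![X, X]

variable {S : Set M} {g : TensorField M 2}

theorem gram_apply_comm {h : TensorField M 2} {y : Plane} (hh : IsSymmAt h (e.symm y))
    (i j : Fin 2) : gram e h y i j = gram e h y j i := by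
  have h1 := comp_perm (e := e) hh (Equiv.swap 0 1) ![j, i]
  simp only [gram, Matrix.of_apply]
  rw [← h1]
  congr 1
  funext a
  fin_cases a <;> simp

theorem quadratic_gram (e : OpenPartialHomeomorph M Plane) (h : TensorField M 2) (y : Plane)
    (c : Fin 2 → ℝ) :
    h (e.symm y) ![∑ p, c p • mfderiv (𝓡 2) (𝓡 2) e.symm y (stdVec p),
      ∑ p, c p • mfderiv (𝓡 2) (𝓡 2) e.symm y (stdVec p)]
      = ∑ i, ∑ j, c i * c j * gram e h y i j := by
  have h1 : (![∑ p, c p • mfderiv (𝓡 2) (𝓡 2) e.symm y (stdVec p),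
      ∑ p, c p • mfderiv (𝓡 2) (𝓡 2) e.symm y (stdVec p)] :
      Fin 2 → TangentSpace (𝓡 2) (e.symm y))
      = fun _ => ∑ p, c p • mfderiv (𝓡 2) (𝓡 2) e.symm y (stdVec p) := by
    funext a
    fin_cases a <;> rfl
  rw [h1, (h _).map_sum (fun (a : Fin 2) (p : Fin 2) =>
        c p • mfderiv (𝓡 2) (𝓡 2) e.symm y (stdVec p))]
  rw [sum_fin_two_arrow]
  refine Finset.sum_congr rfl fun i _ => Finset.sum_congr rfl fun j _ => ?_
  rw [(h _).map_smul_univ (fun a => c (![i, j] a))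
        (fun a => mfderiv (𝓡 2) (𝓡 2) e.symm y (stdVec (![i, j] a)))]
  rw [Fin.prod_univ_two]
  rfl

theorem quadratic_gram_pos (hg : IsRiem S g) (he : e ∈ IsManifold.maximalAtlas (𝓡 2) 2 M)
    {y : Plane} (hy : y ∈ chartDom e S) (c : Fin 2 → ℝ) (hc : c ≠ 0) :
    0 < ∑ i, ∑ j, c i * c j * gram e g y i j := by
  rw [← quadratic_gram]
  refine hg.pos _ hy.2 _ ?_
  intro h0
  apply hc
  set w : Plane := ∑ p, c p • stdVec p with hw
  have h1 : mfderiv (𝓡 2) (𝓡 2) e.symm y w = 0 := by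
    rw [← h0, hw]
    exact (map_sum (mfderiv (𝓡 2) (𝓡 2) e.symm y) _ _).trans
      (Finset.sum_congr rfl fun p _ => map_smul (mfderiv (𝓡 2) (𝓡 2) e.symm y) _ _)
  have h2 := mfderiv_comp_mfderiv_symm he hy.1 w
  rw [h1] at h2
  have h3 : w = 0 := h2.symm.trans (map_zero (mfderiv (𝓡 2) (𝓡 2) e (e.symm y)))
  funext i
  have h4 := congrArg (fun v : Plane => v i) h3
  rw [hw] at h4
  fin_cases i <;> simpa [stdVec, Fin.sum_univ_two] using h4

theorem gram_zero_zero_pos (hg : IsRiem S g) (he : e ∈ IsManifold.maximalAtlas (𝓡 2) 2 M)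
    {y : Plane} (hy : y ∈ chartDom e S) : 0 < gram e g y 0 0 := by
  have := quadratic_gram_pos hg he hy ![1, 0] (fun h => by simpa using congrFun h 0)
  simpa [Fin.sum_univ_two] using this

theorem det_gram_pos (hg : IsRiem S g) (he : e ∈ IsManifold.maximalAtlas (𝓡 2) 2 M)
    {y : Plane} (hy : y ∈ chartDom e S) : 0 < (gram e g y).det := by
  have h0 := gram_zero_zero_pos hg he hy
  have hs := gram_apply_comm (e := e) (hg.symm _ hy.2) 1 0
  -- On the vector (−G₀₁, G₀₀) the quadratic form takes the value G₀₀ · det G.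
  have := quadratic_gram_pos hg he hy ![-gram e g y 0 1, gram e g y 0 0]
    (fun h => h0.ne' (by simpa using congrFun h 1))
  simp only [Fin.sum_univ_two, Matrix.cons_val_zero, Matrix.cons_val_one, hs] at this
  rw [Matrix.det_fin_two, hs]
  by_contra hneg
  push Not at hneg
  nlinarith

/-- Cholesky: G = L Lᵀ with L lower triangular, and P is the inverse transpose of L. It turns every
pointwise inequality for `tensorInner` into one for a Euclidean dot product. -/
theorem exists_gramInv_eq (hg : IsRiem S g) (he : e ∈ IsManifold.maximalAtlas (𝓡 2) 2 M)
    {y : Plane} (hy : y ∈ chartDom e S) :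
    ∃ P : Matrix (Fin 2) (Fin 2) ℝ, IsUnit P.det ∧ gramInv e g y = P * P.transpose := by
  have h0 := gram_zero_zero_pos hg he hy
  have hd := det_gram_pos hg he hy
  have hs := gram_apply_comm (e := e) (hg.symm _ hy.2) 1 0
  set G := gram e g y with hG
  set s := Real.sqrt (G 0 0)
  have hs0 : 0 < s := Real.sqrt_pos.2 h0
  have hss : s * s = G 0 0 := Real.mul_self_sqrt h0.le
  set t := Real.sqrt (G.det / G 0 0)
  have ht0 : 0 < t := Real.sqrt_pos.2 (div_pos hd h0)
  have htt : t * t = G.det / G 0 0 := Real.mul_self_sqrt (div_pos hd h0).le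
  set L : Matrix (Fin 2) (Fin 2) ℝ := !![s, 0; G 0 1 / s, t] with hL
  have hLL : G = L * L.transpose := by
    rw [Matrix.det_fin_two, hs] at htt
    ext i j
    fin_cases i <;> fin_cases j <;>
      simp [hL, Matrix.mul_apply, Fin.sum_univ_two]
    · exact hss.symm
    · field_simp
    · rw [hs]; field_simp
    · have : G 0 1 / s * (G 0 1 / s) = G 0 1 * G 0 1 / G 0 0 := by
        rw [← hss]; field_simp
      rw [this, htt]; field_simp; ring
  have hdet : L.det ≠ 0 := by
    rw [hL, Matrix.det_fin_two_of]
    simp [hs0.ne', ht0.ne']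
  refine ⟨(L⁻¹).transpose, ?_, ?_⟩
  · rw [Matrix.det_transpose, Matrix.det_nonsing_inv]
    exact (IsUnit.mk0 _ (by simpa using hdet))
  · rw [gramInv, ← hG, hLL, Matrix.mul_inv_rev, Matrix.transpose_transpose,
      Matrix.transpose_nonsing_inv]

/-- In suitable coordinates the inner product is the Euclidean one. -/
theorem exists_orthonormal (hg : IsRiem S g) (he : e ∈ IsManifold.maximalAtlas (𝓡 2) 2 M)
    {y : Plane} (hy : y ∈ chartDom e S) :
    ∃ P : Matrix (Fin 2) (Fin 2) ℝ, IsUnit P.det ∧ gramInv e g y = P * P.transpose ∧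
      ∀ (k : ℕ) (u v : TensorField M k), coordInner e g u v y =
        tact P.transpose (comp e u y) ⬝ᵥ tact P.transpose (comp e v y) := by
  obtain ⟨P, hP, h⟩ := exists_gramInv_eq hg he hy
  refine ⟨P, hP, h, fun k u v => ?_⟩
  rw [coordInner_eq, h, tact_mul, dotProduct_tact]

theorem exists_orthonormal_tensorInner (hg : IsRiem S g) {x : M} (hx : x ∈ S) :
    ∃ P : Matrix (Fin 2) (Fin 2) ℝ, IsUnit P.det ∧
      gramInv (chartAt Plane x) g (chartAt Plane x x) = P * P.transpose ∧
      ∀ (k : ℕ) (u v : TensorField M k), tensorInner g u v x =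
        tact P.transpose (comp (chartAt Plane x) u (chartAt Plane x x)) ⬝ᵥ
          tact P.transpose (comp (chartAt Plane x) v (chartAt Plane x x)) :=
  exists_orthonormal hg (chartAt_mem_maximalAtlas x) ⟨mem_chart_target Plane x, by
    rw [mem_preimage, (chartAt Plane x).left_inv (mem_chart_source Plane x)]; exact hx⟩

theorem abs_dotProduct_le {ι : Type*} [Fintype ι] (a b : ι → ℝ) :
    |a ⬝ᵥ b| ≤ Real.sqrt (a ⬝ᵥ a) * Real.sqrt (b ⬝ᵥ b) := by
  have h := Finset.sum_mul_sq_le_sq_mul_sq Finset.univ a b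
  have h0 : 0 ≤ a ⬝ᵥ a := Finset.sum_nonneg fun i _ => mul_self_nonneg (a i)
  rw [← Real.sqrt_mul h0, ← Real.sqrt_sq_eq_abs]
  refine Real.sqrt_le_sqrt ?_
  simpa only [dotProduct, pow_two] using h

theorem tensorInner_self_nonneg {k : ℕ} (hg : IsRiem S g) {x : M} (hx : x ∈ S)
    (u : TensorField M k) : 0 ≤ tensorInner g u u x := by
  obtain ⟨P, -, -, h⟩ := exists_orthonormal_tensorInner hg hx
  rw [h]
  exact Finset.sum_nonneg fun i _ => mul_self_nonneg _

theorem abs_tensorInner_le {k : ℕ} (hg : IsRiem S g) {x : M} (hx : x ∈ S)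
    (u v : TensorField M k) :
    |tensorInner g u v x| ≤ Real.sqrt (tensorInner g u u x) * Real.sqrt (tensorInner g v v x) := by
  obtain ⟨P, -, -, h⟩ := exists_orthonormal_tensorInner hg hx
  rw [h, h, h]
  exact abs_dotProduct_le _ _

theorem tensorInner_comm {k : ℕ} (hg : IsRiem S g) {x : M} (hx : x ∈ S)
    (u v : TensorField M k) : tensorInner g u v x = tensorInner g v u x := by
  obtain ⟨P, -, -, h⟩ := exists_orthonormal_tensorInner hg hx
  rw [h, h, dotProduct_comm]

theorem tensorInner_sub_left {k : ℕ} (g : TensorField M 2) (u v w : TensorField M k) (x : M) :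
    tensorInner g (u - v) w x = tensorInner g u w x - tensorInner g v w x := by
  simp only [tensorInner, coordInner_eq, comp_sub, sub_dotProduct]

theorem tact_sub {k : ℕ} (B : Matrix (Fin 2) (Fin 2) ℝ) (u v : (Fin k → Fin 2) → ℝ) :
    tact B (u - v) = tact B u - tact B v := by
  funext K
  simp [tact, mul_sub, Finset.sum_sub_distrib]

theorem tensorInner_sub_right {k : ℕ} (g : TensorField M 2) (u v w : TensorField M k) (x : M) :
    tensorInner g w (u - v) x = tensorInner g w u x - tensorInner g w v x := by
  simp only [tensorInner, coordInner_eq, comp_sub, tact_sub, dotProduct_sub]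

theorem tensorInner_smul_left {k : ℕ} (g : TensorField M 2) (f : M → ℝ) (u w : TensorField M k)
    (x : M) : tensorInner g (fun z => f z • u z) w x = f x * tensorInner g u w x := by
  have h0 : (chartAt Plane x).symm (chartAt Plane x x) = x :=
    (chartAt Plane x).left_inv (mem_chart_source Plane x)
  simp only [tensorInner, coordInner_eq, comp_smul, smul_dotProduct, h0, smul_eq_mul]

theorem tensorInner_smul_right {k : ℕ} (g : TensorField M 2) (f : M → ℝ) (u w : TensorField M k)
    (x : M) : tensorInner g u (fun z => f z • w z) x = f x * tensorInner g u w x := by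
  have h0 : (chartAt Plane x).symm (chartAt Plane x x) = x :=
    (chartAt Plane x).left_inv (mem_chart_source Plane x)
  simp only [tensorInner, coordInner_eq, comp_smul, tact_smul, dotProduct_smul, h0, smul_eq_mul]

theorem tensorInner_congr {k : ℕ} (g : TensorField M 2) {u u' v v' : TensorField M k} {x : M}
    (hu : u x = u' x) (hv : v x = v' x) : tensorInner g u v x = tensorInner g u' v' x := by
  have h0 : (chartAt Plane x).symm (chartAt Plane x x) = x :=
    (chartAt Plane x).left_inv (mem_chart_source Plane x)
  have h1 := comp_congr_point (e := chartAt Plane x) (y := chartAt Plane x x) (u := u) (v := u')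
    (by rw [h0]; exact hu)
  have h2 := comp_congr_point (e := chartAt Plane x) (y := chartAt Plane x x) (u := v) (v := v')
    (by rw [h0]; exact hv)
  simp only [tensorInner, coordInner_eq, h1, h2]

theorem tensorInner_zero (g : TensorField M 2) (u v : TensorField M 0) (x : M) :
    tensorInner g u v x = comp (chartAt Plane x) u (chartAt Plane x x) ![] *
      comp (chartAt Plane x) v (chartAt Plane x x) ![] := by
  rw [tensorInner, coordInner]
  have h : ∀ I : Fin 0 → Fin 2, I = ![] := fun I => Subsingleton.elim _ _
  simp [h]

theorem tensorInner_sub_self_le {k : ℕ} (hg : IsRiem S g) {x : M} (hx : x ∈ S)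
    (u v : TensorField M k) :
    tensorInner g (u - v) (u - v) x ≤ 2 * tensorInner g u u x + 2 * tensorInner g v v x := by
  obtain ⟨P, -, -, h⟩ := exists_orthonormal_tensorInner hg hx
  rw [h, h, h, comp_sub, tact_sub]
  simp only [dotProduct, Finset.mul_sum, ← Finset.sum_add_distrib]
  refine Finset.sum_le_sum fun I _ => ?_
  simp only [Pi.sub_apply]
  nlinarith [sq_nonneg (tact P.transpose (comp (chartAt Plane x) u (chartAt Plane x x)) I
    + tact P.transpose (comp (chartAt Plane x) v (chartAt Plane x x)) I)]

end Pointwise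

/-! ### Partial derivatives -/

section PartialDerivatives

variable {f f' : Plane → ℝ} {y : Plane}

theorem pderiv_add (hf : DifferentiableAt ℝ f y) (hf' : DifferentiableAt ℝ f' y) (i : Fin 2) :
    pderiv i (fun z => f z + f' z) y = pderiv i f y + pderiv i f' y := by
  simp only [pderiv]
  rw [fderiv_fun_add hf hf']
  rfl

theorem pderiv_mul (hf : DifferentiableAt ℝ f y) (hf' : DifferentiableAt ℝ f' y) (i : Fin 2) :
    pderiv i (fun z => f z * f' z) y = pderiv i f y * f' y + f y * pderiv i f' y := by
  simp only [pderiv]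
  rw [fderiv_fun_mul hf hf']
  simp only [add_apply, smul_apply, smul_eq_mul]
  ring

theorem pderiv_sum {ι : Type*} (s : Finset ι) {F : ι → Plane → ℝ}
    (hF : ∀ a ∈ s, DifferentiableAt ℝ (F a) y) (i : Fin 2) :
    pderiv i (fun z => ∑ a ∈ s, F a z) y = ∑ a ∈ s, pderiv i (F a) y := by
  simp only [pderiv]
  rw [fderiv_fun_sum hF]
  simp

theorem pderiv_congr (h : f =ᶠ[𝓝 y] f') (i : Fin 2) : pderiv i f y = pderiv i f' y := by
  simp only [pderiv, h.fderiv_eq]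

theorem pderiv_comp {ψ : Plane → Plane} (hf : DifferentiableAt ℝ f (ψ y))
    (hψ : DifferentiableAt ℝ ψ y) (i : Fin 2) :
    pderiv i (fun z => f (ψ z)) y
      = ∑ m, pderiv m f (ψ y) * pderiv i (fun z => ψ z m) y := by
  have h2 := hf.hasFDerivAt.comp y hψ.hasFDerivAt
  have h3 : ∀ m : Fin 2, pderiv i (fun z => ψ z m) y = (fderiv ℝ ψ y (stdVec i)) m := by
    intro m
    have h4 := (EuclideanSpace.proj m : Plane →L[ℝ] ℝ).hasFDerivAt.comp y hψ.hasFDerivAt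
    simp only [pderiv]
    have h5 : (fun z => ψ z m) = (EuclideanSpace.proj m : Plane →L[ℝ] ℝ) ∘ ψ := by
      funext z; simp
    rw [h5, h4.fderiv]
    simp
  have h6 : pderiv i (fun z => f (ψ z)) y = fderiv ℝ f (ψ y) (fderiv ℝ ψ y (stdVec i)) := by
    simp only [pderiv]
    have : (fun z => f (ψ z)) = f ∘ ψ := rfl
    rw [this, h2.fderiv]
    rfl
  rw [h6, plane_eq_sum (fderiv ℝ ψ y (stdVec i)), map_sum]
  refine Finset.sum_congr rfl fun m _ => ?_
  rw [h3, map_smul, smul_eq_mul, mul_comm]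
  rfl

theorem contDiffAt_pderiv {n m : WithTop ℕ∞} (hf : ContDiffAt ℝ n f y) (h : m + 1 ≤ n)
    (i : Fin 2) : ContDiffAt ℝ m (pderiv i f) y :=
  (hf.fderiv_right h).clm_apply contDiffAt_const

theorem pderiv_comm (hf : ContDiffAt ℝ 2 f y) (i j : Fin 2) :
    pderiv i (pderiv j f) y = pderiv j (pderiv i f) y := by
  have h1 : IsSymmSndFDerivAt ℝ f y := hf.isSymmSndFDerivAt (by simp)
  have h2 : DifferentiableAt ℝ (fderiv ℝ f) y :=
    (hf.fderiv_right (m := 1) (by norm_num)).differentiableAt (by norm_num)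
  have h3 : ∀ i j, pderiv i (pderiv j f) y = fderiv ℝ (fderiv ℝ f) y (stdVec i) (stdVec j) := by
    intro i j
    have h4 : pderiv j f = fun z => fderiv ℝ f z (stdVec j) := rfl
    rw [h4, pderiv, fderiv_clm_apply h2 (differentiableAt_const _)]
    simp
  rw [h3, h3]
  exact h1 _ _

end PartialDerivatives

/-! ### Derivatives of components in C² charts, and the Christoffel symbols. -/

section Regularity

variable {M : Type*} [TopologicalSpace M] [ChartedSpace Plane M] [IsManifold (𝓡 2) 2 M]
variable {e e' : OpenPartialHomeomorph M Plane} {S : Set M} {g : TensorField M 2}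

theorem contDiffAt_trans_apply (he : e ∈ IsManifold.maximalAtlas (𝓡 2) 2 M)
    (he' : e' ∈ IsManifold.maximalAtlas (𝓡 2) 2 M) {y : Plane} (hy : y ∈ transDom e e')
    (p : Fin 2) : ContDiffAt ℝ 2 (fun z => trans e e' z p) y :=
  (EuclideanSpace.proj p : Plane →L[ℝ] ℝ).contDiff.contDiffAt.comp y (contDiffAt_trans he he' hy)

theorem contDiffAt_jac (he : e ∈ IsManifold.maximalAtlas (𝓡 2) 2 M)
    (he' : e' ∈ IsManifold.maximalAtlas (𝓡 2) 2 M) {y : Plane} (hy : y ∈ transDom e e')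
    (p i : Fin 2) : ContDiffAt ℝ 1 (fun z => jac e e' z p i) y :=
  contDiffAt_pderiv (contDiffAt_trans_apply he he' hy p) (by norm_num) i

theorem mem_chartDom_of_mem {x : M} (hx : x ∈ S) (hxe : x ∈ e.source) : e x ∈ chartDom e S :=
  ⟨e.map_source hxe, by rwa [mem_preimage, e.left_inv hxe]⟩

/-- `IsCr` speaks only of the charts of the atlas, whereas the cylindrical charts lie merely in the
maximal C² atlas. Components transform with the Jacobian, which is only C¹; hence the restriction `r
≤ 1`. -/
theorem contDiffAt_comp {k : ℕ} {r : WithTop ℕ∞} (hr : r ≤ 1) (hS : IsOpen S)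
    {u : TensorField M k} (hu : IsCr r S u) (he : e ∈ IsManifold.maximalAtlas (𝓡 2) 2 M)
    {y : Plane} (hy : y ∈ chartDom e S) (I : Fin k → Fin 2) :
    ContDiffAt ℝ r (fun z => comp e u z I) y := by
  set e' := chartAt Plane (e.symm y) with he'd
  have he' : e' ∈ IsManifold.maximalAtlas (𝓡 2) 2 M := chartAt_mem_maximalAtlas _
  have hy' : y ∈ transDom e e' := mem_transDom_chartAt hy.1
  have h1 : (fun z => comp e u z I) =ᶠ[𝓝 y] fun z => ∑ J : Fin k → Fin 2,
      (∏ a, jac e e' z (J a) (I a)) * comp e' u (trans e e' z) J := by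
    filter_upwards [isOpen_transDom.mem_nhds hy'] with z hz
    rw [comp_eq_tact he he' hz]
    rfl
  refine ContDiffAt.congr_of_eventuallyEq ?_ h1
  refine ContDiffAt.sum fun J _ => ContDiffAt.mul ?_ ?_
  · exact contDiffAt_prod fun a _ => (contDiffAt_jac he he' hy' _ _).of_le hr
  · have h2 := (hu e' (chart_mem_atlas Plane _) J).contDiffAt
      ((isOpen_chartDom hS).mem_nhds (trans_mem_chartDom hy' hy))
    exact ContDiffAt.comp y h2 ((contDiffAt_trans he he' hy').of_le (hr.trans (by norm_num)))

theorem differentiableAt_comp {k : ℕ} (hS : IsOpen S)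
    {u : TensorField M k} (hu : IsCr 1 S u) (he : e ∈ IsManifold.maximalAtlas (𝓡 2) 2 M)
    {y : Plane} (hy : y ∈ chartDom e S) (I : Fin k → Fin 2) :
    DifferentiableAt ℝ (fun z => comp e u z I) y :=
  (contDiffAt_comp le_rfl hS hu he hy I).differentiableAt (by norm_num)

theorem IsCr.of_le {k : ℕ} {r r' : WithTop ℕ∞} {u : TensorField M k} (h : IsCr r S u)
    (hr : r' ≤ r) : IsCr r' S u := fun e he I => (h e he I).of_le hr

/-- The partial derivatives of the components of a tensor under a change of charts. -/
theorem pderiv_comp_one (hS : IsOpen S) {u : TensorField M 1} (hu : IsCr 1 S u)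
    (he : e ∈ IsManifold.maximalAtlas (𝓡 2) 2 M)
    (he' : e' ∈ IsManifold.maximalAtlas (𝓡 2) 2 M) {y : Plane} (hy : y ∈ transDom e e')
    (hyS : y ∈ chartDom e S) (i j : Fin 2) :
    pderiv i (fun z => comp e u z ![j]) y = ∑ p,
      (pderiv i (fun z => jac e e' z p j) y * comp e' u (trans e e' y) ![p] +
        jac e e' y p j * ∑ m, pderiv m (fun z => comp e' u z ![p]) (trans e e' y)
          * jac e e' y m i) := by
  have hy' := trans_mem_chartDom hy hyS
  have h1 : (fun z => comp e u z ![j]) =ᶠ[𝓝 y] fun z => ∑ p,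
      jac e e' z p j * comp e' u (trans e e' z) ![p] := by
    filter_upwards [isOpen_transDom.mem_nhds hy] with z hz
    rw [comp_eq_tact he he' hz]
    simp [tact, sum_fin_one_arrow]
  have hT := (contDiffAt_trans he he' hy).differentiableAt (by norm_num)
  have hd1 : ∀ p, DifferentiableAt ℝ (fun z => jac e e' z p j) y := fun p =>
    (contDiffAt_jac he he' hy p j).differentiableAt (by norm_num)
  have hd2 : ∀ p, DifferentiableAt ℝ (fun z => comp e' u z ![p]) (trans e e' y) := fun p =>
    differentiableAt_comp hS hu he' hy' _
  have hd3 : ∀ p, DifferentiableAt ℝ (fun z => comp e' u (trans e e' z) ![p]) y := fun p =>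
    DifferentiableAt.comp y (hd2 p) hT
  rw [pderiv_congr h1, pderiv_sum _ fun p _ => (hd1 p).fun_mul (hd3 p)]
  refine Finset.sum_congr rfl fun p _ => ?_
  rw [pderiv_mul (hd1 p) (hd3 p), pderiv_comp (hd2 p) hT]
  rfl

theorem pderiv_comp_two (hS : IsOpen S) {h : TensorField M 2} (hh : IsCr 1 S h)
    (he : e ∈ IsManifold.maximalAtlas (𝓡 2) 2 M)
    (he' : e' ∈ IsManifold.maximalAtlas (𝓡 2) 2 M) {y : Plane} (hy : y ∈ transDom e e')
    (hyS : y ∈ chartDom e S) (i j k : Fin 2) :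
    pderiv i (fun z => gram e h z j k) y = ∑ p, ∑ q,
      (pderiv i (fun z => jac e e' z p j) y * jac e e' y q k * gram e' h (trans e e' y) p q
        + jac e e' y p j * pderiv i (fun z => jac e e' z q k) y * gram e' h (trans e e' y) p q
        + jac e e' y p j * jac e e' y q k * ∑ m,
          pderiv m (fun z => gram e' h z p q) (trans e e' y) * jac e e' y m i) := by
  have hy' := trans_mem_chartDom hy hyS
  have h1 : (fun z => gram e h z j k) =ᶠ[𝓝 y] fun z => ∑ p, ∑ q,
      jac e e' z p j * jac e e' z q k * gram e' h (trans e e' z) p q := by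
    filter_upwards [isOpen_transDom.mem_nhds hy] with z hz
    rw [gram_eq he he' hz]
    simp only [Matrix.mul_apply, Matrix.transpose_apply, Fin.sum_univ_two]
    ring
  have hT := (contDiffAt_trans he he' hy).differentiableAt (by norm_num)
  have hd1 : ∀ p j, DifferentiableAt ℝ (fun z => jac e e' z p j) y := fun p j =>
    (contDiffAt_jac he he' hy p j).differentiableAt (by norm_num)
  have hd2 : ∀ p q, DifferentiableAt ℝ (fun z => gram e' h z p q) (trans e e' y) := fun p q =>
    differentiableAt_comp hS hh he' hy' _
  have hd3 : ∀ p q, DifferentiableAt ℝ (fun z => gram e' h (trans e e' z) p q) y := fun p q =>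
    DifferentiableAt.comp y (hd2 p q) hT
  have hd4 : ∀ p q, DifferentiableAt ℝ (fun z => jac e e' z p j * jac e e' z q k) y :=
    fun p q => (hd1 p j).fun_mul (hd1 q k)
  rw [pderiv_congr h1, pderiv_sum _ fun p _ =>
    DifferentiableAt.fun_sum fun q _ => (hd4 p q).fun_mul (hd3 p q)]
  refine Finset.sum_congr rfl fun p _ => ?_
  rw [pderiv_sum _ fun q _ => (hd4 p q).fun_mul (hd3 p q)]
  refine Finset.sum_congr rfl fun q _ => ?_
  rw [pderiv_mul (hd4 p q) (hd3 p q), pderiv_mul (hd1 p j) (hd1 q k), pderiv_comp (hd2 p q) hT]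
  simp only [jac, Matrix.of_apply]
  ring

/-- The entries of the Jacobian are first derivatives of a C² map, so this is the symmetry of second
derivatives. The inhomogeneous term in the Christoffel law is thereby symmetric in its lower
indices. -/
theorem pderiv_jac_comm (he : e ∈ IsManifold.maximalAtlas (𝓡 2) 2 M)
    (he' : e' ∈ IsManifold.maximalAtlas (𝓡 2) 2 M) {y : Plane} (hy : y ∈ transDom e e')
    (p i j : Fin 2) :
    pderiv i (fun z => jac e e' z p j) y = pderiv j (fun z => jac e e' z p i) y :=
  pderiv_comm (contDiffAt_trans_apply he he' hy p) i j

/-! ### The Christoffel symbols under a change of charts -/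

theorem gram_mul_gramInv (hg : IsRiem S g) (he : e ∈ IsManifold.maximalAtlas (𝓡 2) 2 M)
    {y : Plane} (hy : y ∈ chartDom e S) : gram e g y * gramInv e g y = 1 :=
  Matrix.mul_nonsing_inv _ (det_gram_pos hg he hy).ne'.isUnit

/-- The Christoffel symbols of the first kind. -/
theorem sum_gram_mul_christoffel (hg : IsRiem S g) (he : e ∈ IsManifold.maximalAtlas (𝓡 2) 2 M)
    {y : Plane} (hy : y ∈ chartDom e S) (i j k : Fin 2) :
    ∑ l, gram e g y k l * christoffel e g y l i j =
      (1 / 2) * (pderiv i (fun z => gram e g z j k) y + pderiv j (fun z => gram e g z i k) y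
      - pderiv k (fun z => gram e g z i j) y) := by
  have h := gram_mul_gramInv hg he hy
  have h1 : ∀ m, ∑ l, gram e g y k l * gramInv e g y l m = (1 : Matrix (Fin 2) (Fin 2) ℝ) k m := by
    intro m; rw [← h, Matrix.mul_apply]
  simp only [christoffel]
  set X : Fin 2 → ℝ := fun m => pderiv i (fun z => gram e g z j m) y
    + pderiv j (fun z => gram e g z i m) y - pderiv m (fun z => gram e g z i j) y with hX
  have h2 : ∑ l, gram e g y k l * (1 / 2 * ∑ m, gramInv e g y l m * X m)
      = 1 / 2 * ∑ m, (∑ l, gram e g y k l * gramInv e g y l m) * X m := by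
    simp only [Fin.sum_univ_two]; ring
  refine h2.trans ?_
  simp only [h1]
  congr 1
  simp [Matrix.one_apply, hX]

/-- The algebra behind the transformation of the Christoffel symbols of the first kind: `A` is the
Jacobian, `B` its derivative and `dG'` the derivative of AᵀGA. In the alternating sum over the three
index positions, the symmetry of `B` makes four of the six terms in `B` cancel and the other two
coincide. -/
theorem christoffel_algebra (G A : Matrix (Fin 2) (Fin 2) ℝ) (dG B : Fin 2 → Fin 2 → Fin 2 → ℝ)
    (hG : G 1 0 = G 0 1) (hdG : ∀ i, dG i 1 0 = dG i 0 1) (hB : ∀ p i j, B p i j = B p j i)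
    (dG' : Fin 2 → Fin 2 → Fin 2 → ℝ)
    (hdG' : ∀ i j k, dG' i j k = ∑ p, ∑ q, (B p i j * A q k * G p q + A p j * B q i k * G p q
      + A p j * A q k * ∑ m, dG m p q * A m i)) (i j k : Fin 2) :
    (1 / 2) * (dG' i j k + dG' j i k - dG' k i j) =
      ∑ p, ∑ l, A p k * G p l * B l i j + ∑ p, ∑ r, ∑ s, A p k *
        ((1 / 2) * (dG r s p + dG s r p - dG p r s)) * A r i * A s j := by
  simp only [hdG', Fin.sum_univ_two, hG, hdG, hB 0 j i, hB 1 j i, hB 0 k i, hB 1 k i,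
    hB 0 k j, hB 1 k j]
  ring

theorem gram_comm_chartDom (hg : IsRiem S g) {y : Plane} (hy : y ∈ chartDom e S) :
    gram e g y 1 0 = gram e g y 0 1 :=
  gram_apply_comm (hg.symm _ hy.2) 1 0

theorem pderiv_gram_comm (hg : IsRiem S g) {y : Plane} (hy : y ∈ chartDom e S) (m i j : Fin 2) :
    pderiv m (fun z => gram e g z i j) y = pderiv m (fun z => gram e g z j i) y := by
  refine pderiv_congr ?_ m
  filter_upwards [(isOpen_chartDom hg.isOpen).mem_nhds hy] with z hz
  exact gram_apply_comm (hg.symm _ hz.2) i j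

/-- The transformation law of the Christoffel symbols. -/
theorem sum_jac_mul_christoffel (hg : IsRiem S g) (he : e ∈ IsManifold.maximalAtlas (𝓡 2) 2 M)
    (he' : e' ∈ IsManifold.maximalAtlas (𝓡 2) 2 M) {y : Plane} (hy : y ∈ transDom e e')
    (hyS : y ∈ chartDom e S) (l i j : Fin 2) :
    ∑ m, jac e e' y l m * christoffel e g y m i j =
      pderiv i (fun z => jac e e' z l j) y + ∑ p, ∑ q,
        christoffel e' g (trans e e' y) l p q * jac e e' y p i * jac e e' y q j := by
  have hy' := trans_mem_chartDom hy hyS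
  set A := jac e e' y with hA
  set G := gram e' g (trans e e' y) with hG
  -- The upper index is lowered by multiplying both sides by AᵀG, which is invertible. What remains
  -- concerns Christoffel symbols of the first kind, in which the inverse metric no longer appears.
  set N : Matrix (Fin 2) (Fin 2) ℝ := A.transpose * G with hN
  have hNd : IsUnit N.det := by
    rw [hN, Matrix.det_mul, Matrix.det_transpose]
    exact ((det_jac_ne_zero he he' hy).isUnit).mul (det_gram_pos hg he' hy').ne'.isUnit
  set L : Fin 2 → ℝ := fun l => ∑ m, A l m * christoffel e g y m i j with hL
  set R : Fin 2 → ℝ := fun l => pderiv i (fun z => jac e e' z l j) y + ∑ p, ∑ q,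
        christoffel e' g (trans e e' y) l p q * A p i * A q j with hR
  suffices h : N.mulVec L = N.mulVec R by
    have h2 := congrArg (N⁻¹.mulVec) h
    rw [Matrix.mulVec_mulVec, Matrix.mulVec_mulVec, Matrix.nonsing_inv_mul _ hNd,
      Matrix.one_mulVec, Matrix.one_mulVec] at h2
    exact congrFun h2 l
  funext k
  have h1 := sum_gram_mul_christoffel hg he hyS i j k
  have hl : N.mulVec L k = ∑ l, gram e g y k l * christoffel e g y l i j := by
    rw [gram_eq he he' hy]
    simp only [Matrix.mulVec, dotProduct, hN, hL, Matrix.mul_apply, Fin.sum_univ_two]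
    ring
  rw [hl, h1]
  have h2 := christoffel_algebra G A
    (fun m p q => pderiv m (fun z => gram e' g z p q) (trans e e' y))
    (fun p i j => pderiv i (fun z => jac e e' z p j) y)
    (gram_comm_chartDom hg hy') (fun m => pderiv_gram_comm hg hy' m 1 0)
    (fun p i j => pderiv_jac_comm he he' hy p i j)
    (fun m p q => pderiv m (fun z => gram e g z p q) y)
    (fun i j k => pderiv_comp_two hg.isOpen hg.contDiff he he' hy hyS i j k) i j k
  rw [h2]
  have h3 := fun r s p => sum_gram_mul_christoffel hg he' hy' r s p
  simp only [← h3]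
  simp only [Matrix.mulVec, dotProduct, hN, hR, Matrix.mul_apply, Fin.sum_univ_two,
    Matrix.transpose_apply, ← hG]
  ring

end Regularity

/-! ### Tensoriality of the covariant derivative, the divergence and Sym∇. -/

section Covariant

variable {M : Type*} [TopologicalSpace M] [ChartedSpace Plane M] [IsManifold (𝓡 2) 2 M]
variable {e e' : OpenPartialHomeomorph M Plane} {S : Set M} {g : TensorField M 2}

/-- The components of the covariant derivative of a `1`-form. -/
def cov1 (e : OpenPartialHomeomorph M Plane) (g : TensorField M 2) (u : TensorField M 1)
    (y : Plane) (i j : Fin 2) : ℝ :=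
  pderiv i (fun z => comp e u z ![j]) y - ∑ l, christoffel e g y l i j * comp e u y ![l]

/-- The components of the covariant derivative of a `2`-tensor. -/
def cov2 (e : OpenPartialHomeomorph M Plane) (g : TensorField M 2) (h : TensorField M 2)
    (y : Plane) (i j k : Fin 2) : ℝ :=
  pderiv i (fun z => gram e h z j k) y - ∑ l, christoffel e g y l i j * gram e h y l k
    - ∑ l, christoffel e g y l i k * gram e h y j l

theorem covDeriv_one (u : TensorField M 1) (y : Plane) (i j : Fin 2) :
    covDeriv e g u y i ![j] = cov1 e g u y i j := by
  simp only [covDeriv, cov1, Fin.sum_univ_one]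
  congr 1
  refine Finset.sum_congr rfl fun l _ => ?_
  have : Function.update ![j] 0 l = ![l] := by
    funext a; fin_cases a; simp
  rw [this]
  rfl

theorem covDeriv_two (h : TensorField M 2) (y : Plane) (i j k : Fin 2) :
    covDeriv e g h y i ![j, k] = cov2 e g h y i j k := by
  have h1 : ∀ l, Function.update ![j, k] 0 l = ![l, k] := by
    intro l; funext a; fin_cases a <;> simp
  have h2 : ∀ l, Function.update ![j, k] 1 l = ![j, l] := by
    intro l; funext a; fin_cases a <;> simp
  simp only [covDeriv, cov2, Fin.sum_univ_two (f := fun a : Fin 2 => ∑ l : Fin 2, _), h1, h2]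
  rw [← sub_sub]
  rfl

theorem covDeriv_zero (u : TensorField M 0) (y : Plane) (i : Fin 2) (J : Fin 0 → Fin 2) :
    covDeriv e g u y i J = pderiv i (fun z => comp e u z ![]) y := by
  have : J = ![] := Subsingleton.elim _ _
  simp [covDeriv, this]

theorem comp_one_eq (he : e ∈ IsManifold.maximalAtlas (𝓡 2) 2 M)
    (he' : e' ∈ IsManifold.maximalAtlas (𝓡 2) 2 M) {y : Plane} (hy : y ∈ transDom e e')
    (u : TensorField M 1) (j : Fin 2) :
    comp e u y ![j] = ∑ p, jac e e' y p j * comp e' u (trans e e' y) ![p] := by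
  rw [comp_eq_tact he he' hy]
  simp [tact, sum_fin_one_arrow]

/-- The derivative of the Jacobian arises twice, from differentiating the transformed components and
from the Christoffel law, with opposite signs. The coefficients of the linear combination are the
components of `u` in the second chart. `cov2_eq` has the same proof with one correction for each
index. -/
theorem cov1_eq (hg : IsRiem S g) (he : e ∈ IsManifold.maximalAtlas (𝓡 2) 2 M)
    (he' : e' ∈ IsManifold.maximalAtlas (𝓡 2) 2 M) {y : Plane} (hy : y ∈ transDom e e')
    (hyS : y ∈ chartDom e S) {u : TensorField M 1} (hu : IsCr 1 S u) (i j : Fin 2) :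
    cov1 e g u y i j = ∑ p, ∑ q, jac e e' y p i * jac e e' y q j *
      cov1 e' g u (trans e e' y) p q := by
  have h := fun l => sum_jac_mul_christoffel hg he he' hy hyS l i j
  simp only [cov1]
  rw [pderiv_comp_one hg.isOpen hu he he' hy hyS]
  simp only [comp_one_eq he he' hy u]
  have h0 := h 0
  have h1 := h 1
  simp only [Fin.sum_univ_two] at h0 h1 ⊢
  linear_combination -(comp e' u (trans e e' y) ![0]) * h0 - (comp e' u (trans e e' y) ![1]) * h1

theorem gram_apply_eq (he : e ∈ IsManifold.maximalAtlas (𝓡 2) 2 M)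
    (he' : e' ∈ IsManifold.maximalAtlas (𝓡 2) 2 M) {y : Plane} (hy : y ∈ transDom e e')
    (h : TensorField M 2) (j k : Fin 2) :
    gram e h y j k = ∑ p, ∑ q, jac e e' y p j * jac e e' y q k *
      gram e' h (trans e e' y) p q := by
  rw [gram_eq he he' hy]
  simp only [Matrix.mul_apply, Matrix.transpose_apply, Fin.sum_univ_two]
  ring

theorem cov2_eq (hg : IsRiem S g) (he : e ∈ IsManifold.maximalAtlas (𝓡 2) 2 M)
    (he' : e' ∈ IsManifold.maximalAtlas (𝓡 2) 2 M) {y : Plane} (hy : y ∈ transDom e e')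
    (hyS : y ∈ chartDom e S) {h : TensorField M 2} (hh : IsCr 1 S h) (i j k : Fin 2) :
    cov2 e g h y i j k = ∑ p, ∑ q, ∑ r, jac e e' y p i * jac e e' y q j * jac e e' y r k *
      cov2 e' g h (trans e e' y) p q r := by
  have hj := fun l => sum_jac_mul_christoffel hg he he' hy hyS l i j
  have hk := fun l => sum_jac_mul_christoffel hg he he' hy hyS l i k
  simp only [cov2]
  rw [pderiv_comp_two hg.isOpen hh he he' hy hyS]
  simp only [gram_apply_eq he he' hy h]
  have hj0 := hj 0
  have hj1 := hj 1
  have hk0 := hk 0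
  have hk1 := hk 1
  simp only [Fin.sum_univ_two] at hj0 hj1 hk0 hk1 ⊢
  generalize trans e e' y = y' at *
  linear_combination
    -(jac e e' y 0 k * gram e' h y' 0 0 + jac e e' y 1 k * gram e' h y' 0 1) * hj0
    - (jac e e' y 0 k * gram e' h y' 1 0 + jac e e' y 1 k * gram e' h y' 1 1) * hj1
    - (jac e e' y 0 j * gram e' h y' 0 0 + jac e e' y 1 j * gram e' h y' 1 0) * hk0
    - (jac e e' y 0 j * gram e' h y' 0 1 + jac e e' y 1 j * gram e' h y' 1 1) * hk1

/-! ### The components of the divergence and of the symmetrized covariant derivative -/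

theorem chartAt_symm_apply (x : M) : (chartAt Plane x).symm (chartAt Plane x x) = x :=
  (chartAt Plane x).left_inv (mem_chart_source Plane x)

theorem chartAt_mem_chartDom {x : M} (hx : x ∈ S) :
    chartAt Plane x x ∈ chartDom (chartAt Plane x) S :=
  mem_chartDom_of_mem hx (mem_chart_source Plane x)

theorem sum_perm_fin_two (f : Equiv.Perm (Fin 2) → ℝ) :
    ∑ σ, f σ = f 1 + f (Equiv.swap 0 1) := by
  have : (Finset.univ : Finset (Equiv.Perm (Fin 2))) = {1, Equiv.swap 0 1} := by decide
  rw [this, Finset.sum_pair (by decide)]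

/-- `symCovDeriv` is defined with a chart that varies with the point, a form that cannot be
differentiated or examined for continuity. Tensoriality of `cov1` gives one formula valid throughout
a fixed C² chart. The lemmas on `comp` of a divergence below serve the same purpose. -/
theorem gram_symCovDeriv (hg : IsRiem S g) (he : e ∈ IsManifold.maximalAtlas (𝓡 2) 2 M)
    {y : Plane} (hyS : y ∈ chartDom e S) {u : TensorField M 1} (hu : IsCr 1 S u) (i j : Fin 2) :
    gram e (symCovDeriv g u) y i j = (1 / 2) * (cov1 e g u y i j + cov1 e g u y j i) := by
  have hy := mem_transDom_chartAt hyS.1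
  have he' := chartAt_mem_maximalAtlas (e.symm y)
  rw [gram_apply_eq he he' hy]
  have h1 : ∀ p q, gram (chartAt Plane (e.symm y)) (symCovDeriv g u)
      (trans e (chartAt Plane (e.symm y)) y) p q = (1 / 2) *
      (cov1 (chartAt Plane (e.symm y)) g u (trans e (chartAt Plane (e.symm y)) y) p q +
       cov1 (chartAt Plane (e.symm y)) g u (trans e (chartAt Plane (e.symm y)) y) q p) := by
    intro p q
    have h2 := comp_ofComp (e.symm y) (fun x => fun I : Fin 2 → Fin 2 =>
      ((Nat.factorial 2 : ℕ) : ℝ)⁻¹ * ∑ σ : Equiv.Perm (Fin 2),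
        covDeriv (chartAt Plane x) g u (chartAt Plane x x) (I (σ 0)) (fun a => I (σ a.succ)))
    refine (congrFun h2 ![p, q]).trans ?_
    simp only [sum_perm_fin_two]
    have h3 : ∀ v : Fin 1 → Fin 2, v = ![v 0] := fun v => by funext a; fin_cases a; rfl
    rw [h3 (fun a => ![p, q] ((1 : Equiv.Perm (Fin 2)) a.succ)),
      h3 (fun a => ![p, q] ((Equiv.swap 0 1 : Equiv.Perm (Fin 2)) a.succ)),
      covDeriv_one, covDeriv_one]
    simp [Nat.factorial, trans]
  simp only [h1]
  rw [cov1_eq hg he he' hy hyS hu i j, cov1_eq hg he he' hy hyS hu j i]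
  simp only [Fin.sum_univ_two]
  ring

theorem comp_symCovDeriv_zero (hS : IsOpen S) (he : e ∈ IsManifold.maximalAtlas (𝓡 2) 2 M)
    {y : Plane} (hyS : y ∈ chartDom e S) {f : TensorField M 0} (hf : IsCr 1 S f) (i : Fin 2) :
    comp e (symCovDeriv g f) y ![i] = pderiv i (fun z => comp e f z ![]) y := by
  have hy := mem_transDom_chartAt hyS.1
  have he' := chartAt_mem_maximalAtlas (e.symm y)
  rw [comp_one_eq he he' hy]
  have h1 : ∀ p, comp (chartAt Plane (e.symm y)) (symCovDeriv g f)
      (trans e (chartAt Plane (e.symm y)) y) ![p] =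
      pderiv p (fun z => comp (chartAt Plane (e.symm y)) f z ![])
        (trans e (chartAt Plane (e.symm y)) y) := by
    intro p
    have h2 := comp_ofComp (e.symm y) (fun x => fun I : Fin 1 → Fin 2 =>
      ((Nat.factorial 1 : ℕ) : ℝ)⁻¹ * ∑ σ : Equiv.Perm (Fin 1),
        covDeriv (chartAt Plane x) g f (chartAt Plane x x) (I (σ 0)) (fun a => I (σ a.succ)))
    refine (congrFun h2 ![p]).trans ?_
    simp [covDeriv_zero, trans]
  simp only [h1]
  have h3 : (fun z => comp e f z ![]) =ᶠ[𝓝 y] fun z =>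
      comp (chartAt Plane (e.symm y)) f (trans e (chartAt Plane (e.symm y)) z) ![] := by
    filter_upwards [isOpen_transDom.mem_nhds hy] with z hz
    rw [comp_eq_tact he he' hz]
    simp [tact, Subsingleton.elim _ (![] : Fin 0 → Fin 2)]
  rw [pderiv_congr h3, pderiv_comp (f := fun z => comp (chartAt Plane (e.symm y)) f z ![])
    (differentiableAt_comp hS hf he' (trans_mem_chartDom hy hyS) _)
    ((contDiffAt_trans he he' hy).differentiableAt (by norm_num))]
  exact Finset.sum_congr rfl fun p _ => mul_comm _ _

theorem gramInv_apply_eq (he : e ∈ IsManifold.maximalAtlas (𝓡 2) 2 M)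
    (he' : e' ∈ IsManifold.maximalAtlas (𝓡 2) 2 M) {y : Plane} (hy : y ∈ transDom e e')
    (p q : Fin 2) :
    gramInv e' g (trans e e' y) p q =
      ∑ i, ∑ j, jac e e' y p i * jac e e' y q j * gramInv e g y i j := by
  rw [gramInv_eq he he' hy]
  simp only [Matrix.mul_apply, Matrix.transpose_apply, Fin.sum_univ_two]
  ring

theorem comp_divergence_one (hg : IsRiem S g) (he : e ∈ IsManifold.maximalAtlas (𝓡 2) 2 M)
    {y : Plane} (hyS : y ∈ chartDom e S) {β : TensorField M 1} (hβ : IsCr 1 S β) :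
    comp e (divergence g β) y ![] = -∑ i, ∑ j, gramInv e g y i j * cov1 e g β y i j := by
  have hy := mem_transDom_chartAt hyS.1
  have he' := chartAt_mem_maximalAtlas (e.symm y)
  rw [comp_eq_tact he he' hy]
  have h2 := comp_ofComp (e.symm y) (fun x => fun J : Fin 0 → Fin 2 =>
    -∑ i : Fin 2, ∑ j : Fin 2, gramInv (chartAt Plane x) g (chartAt Plane x x) i j *
      covDeriv (chartAt Plane x) g β (chartAt Plane x x) i (Fin.cons j J : Fin 1 → Fin 2))
  have h3 : comp (chartAt Plane (e.symm y)) (divergence g β)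
      (trans e (chartAt Plane (e.symm y)) y) ![] =
      -∑ i : Fin 2, ∑ j : Fin 2, gramInv (chartAt Plane (e.symm y)) g
        (trans e (chartAt Plane (e.symm y)) y) i j *
        cov1 (chartAt Plane (e.symm y)) g β (trans e (chartAt Plane (e.symm y)) y) i j := by
    refine (congrFun h2 ![]).trans ?_
    have h4 : ∀ j : Fin 2, (Fin.cons j ![] : Fin 1 → Fin 2) = ![j] := fun j => rfl
    simp only [h4, covDeriv_one]
    rfl
  have h5 : tact (jac e (chartAt Plane (e.symm y)) y).transpose
      (comp (chartAt Plane (e.symm y)) (divergence g β) (trans e (chartAt Plane (e.symm y)) y))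
      ![] = comp (chartAt Plane (e.symm y)) (divergence g β)
        (trans e (chartAt Plane (e.symm y)) y) ![] := by
    simp [tact, Subsingleton.elim _ (![] : Fin 0 → Fin 2)]
  rw [h5, h3]
  simp only [gramInv_apply_eq he he' hy, cov1_eq hg he he' hy hyS hβ]
  simp only [Fin.sum_univ_two]
  ring

theorem comp_divergence_two (hg : IsRiem S g) (he : e ∈ IsManifold.maximalAtlas (𝓡 2) 2 M)
    {y : Plane} (hyS : y ∈ chartDom e S) {h : TensorField M 2} (hh : IsCr 1 S h) (k : Fin 2) :
    comp e (divergence g h) y ![k] = -∑ i, ∑ j, gramInv e g y i j * cov2 e g h y i j k := by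
  have hy := mem_transDom_chartAt hyS.1
  have he' := chartAt_mem_maximalAtlas (e.symm y)
  rw [comp_one_eq he he' hy]
  have h2 := comp_ofComp (e.symm y) (fun x => fun J : Fin 1 → Fin 2 =>
    -∑ i : Fin 2, ∑ j : Fin 2, gramInv (chartAt Plane x) g (chartAt Plane x x) i j *
      covDeriv (chartAt Plane x) g h (chartAt Plane x x) i (Fin.cons j J : Fin 2 → Fin 2))
  have h3 : ∀ k, comp (chartAt Plane (e.symm y)) (divergence g h)
      (trans e (chartAt Plane (e.symm y)) y) ![k] =
      -∑ i : Fin 2, ∑ j : Fin 2, gramInv (chartAt Plane (e.symm y)) g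
        (trans e (chartAt Plane (e.symm y)) y) i j *
        cov2 (chartAt Plane (e.symm y)) g h (trans e (chartAt Plane (e.symm y)) y) i j k := by
    intro k
    refine (congrFun h2 ![k]).trans ?_
    have h4 : ∀ j : Fin 2, (Fin.cons j ![k] : Fin 2 → Fin 2) = ![j, k] := fun j => rfl
    simp only [h4, covDeriv_two]
    rfl
  simp only [h3, gramInv_apply_eq he he' hy, cov2_eq hg he he' hy hyS hh]
  simp only [Fin.sum_univ_two]
  ring

end Covariant

/-! ### Leibniz rules for the divergence and its expression in a chart. -/

section Identities

variable {M : Type*} [TopologicalSpace M] [ChartedSpace Plane M] [IsManifold (𝓡 2) 2 M]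
variable {e e' : OpenPartialHomeomorph M Plane} {S : Set M} {g : TensorField M 2}

/-- The function defined by a field of `0`-tensors. -/
def val (w : TensorField M 0) (x : M) : ℝ := w x 0

theorem comp_zero_eq_val (w : TensorField M 0) (y : Plane) (I : Fin 0 → Fin 2) :
    comp e w y I = val w (e.symm y) := by
  simp only [comp, val]
  congr 1
  exact Subsingleton.elim _ _

theorem val_ofFun (f : M → ℝ) (x : M) : val (ofFun f) x = f x := rfl

theorem tensorInner_val (u v : TensorField M 0) (x : M) :
    tensorInner g u v x = val u x * val v x := by
  rw [tensorInner_zero, comp_zero_eq_val, comp_zero_eq_val, chartAt_symm_apply]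

theorem gramInv_apply (G : Matrix (Fin 2) (Fin 2) ℝ) :
    G⁻¹ = !![G 1 1 * (G.det)⁻¹, -G 0 1 * (G.det)⁻¹; -G 1 0 * (G.det)⁻¹, G 0 0 * (G.det)⁻¹] := by
  rw [Matrix.inv_def, Ring.inverse_eq_inv', Matrix.adjugate_fin_two]
  ext i j
  fin_cases i <;> fin_cases j <;> simp [mul_comm]

theorem contDiffAt_gram (hg : IsRiem S g) (he : e ∈ IsManifold.maximalAtlas (𝓡 2) 2 M)
    {y : Plane} (hy : y ∈ chartDom e S) (i j : Fin 2) :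
    ContDiffAt ℝ 1 (fun z => gram e g z i j) y :=
  contDiffAt_comp le_rfl hg.isOpen hg.contDiff he hy _

theorem contDiffAt_det_gram (hg : IsRiem S g) (he : e ∈ IsManifold.maximalAtlas (𝓡 2) 2 M)
    {y : Plane} (hy : y ∈ chartDom e S) : ContDiffAt ℝ 1 (fun z => (gram e g z).det) y := by
  simp only [Matrix.det_fin_two]
  exact ((contDiffAt_gram hg he hy 0 0).mul (contDiffAt_gram hg he hy 1 1)).sub
    ((contDiffAt_gram hg he hy 0 1).mul (contDiffAt_gram hg he hy 1 0))

theorem contDiffAt_gramInv (hg : IsRiem S g) (he : e ∈ IsManifold.maximalAtlas (𝓡 2) 2 M)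
    {y : Plane} (hy : y ∈ chartDom e S) (i j : Fin 2) :
    ContDiffAt ℝ 1 (fun z => gramInv e g z i j) y := by
  have hd := (contDiffAt_det_gram hg he hy).inv (det_gram_pos hg he hy).ne'
  have h := contDiffAt_gram hg he hy
  simp only [gramInv, gramInv_apply (gram e g _)]
  fin_cases i <;> fin_cases j
  · exact (h 1 1).mul hd
  · exact (h 0 1).neg.mul hd
  · exact (h 1 0).neg.mul hd
  · exact (h 0 0).mul hd

/-- The components of the vector field dual to a `1`-form. -/
def up (e : OpenPartialHomeomorph M Plane) (g : TensorField M 2) (u : TensorField M 1)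
    (y : Plane) (l : Fin 2) : ℝ :=
  ∑ m, gramInv e g y l m * comp e u y ![m]

theorem contDiffAt_up (hg : IsRiem S g) (he : e ∈ IsManifold.maximalAtlas (𝓡 2) 2 M)
    {u : TensorField M 1} (hu : IsCr 1 S u)
    {y : Plane} (hy : y ∈ chartDom e S) (l : Fin 2) :
    ContDiffAt ℝ 1 (fun z => up e g u z l) y :=
  ContDiffAt.sum fun m _ => (contDiffAt_gramInv hg he hy l m).mul
    (contDiffAt_comp le_rfl hg.isOpen hu he hy _)

theorem sum_gram_mul_up (hg : IsRiem S g) (he : e ∈ IsManifold.maximalAtlas (𝓡 2) 2 M)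
    (u : TensorField M 1) {y : Plane} (hy : y ∈ chartDom e S) (k : Fin 2) :
    comp e u y ![k] = ∑ l, gram e g y k l * up e g u y l := by
  have h := gram_mul_gramInv hg he hy
  have h1 : ∀ k m, ∑ l, gram e g y k l * gramInv e g y l m = (1 : Matrix _ _ ℝ) k m := by
    intro k m; rw [← h, Matrix.mul_apply]
  have h2 : ∑ l, gram e g y k l * up e g u y l
      = ∑ m, (∑ l, gram e g y k l * gramInv e g y l m) * comp e u y ![m] := by
    simp only [up, Fin.sum_univ_two]; ring
  rw [h2]
  simp [h1, Matrix.one_apply]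

theorem pderiv_gram (hg : IsRiem S g) (he : e ∈ IsManifold.maximalAtlas (𝓡 2) 2 M)
    {y : Plane} (hy : y ∈ chartDom e S) (i j k : Fin 2) :
    pderiv i (fun z => gram e g z j k) y = ∑ l, gram e g y k l * christoffel e g y l i j
      + ∑ l, gram e g y j l * christoffel e g y l i k := by
  rw [sum_gram_mul_christoffel hg he hy, sum_gram_mul_christoffel hg he hy,
    pderiv_gram_comm hg hy i k j, pderiv_gram_comm hg hy k i j, pderiv_gram_comm hg hy j i k]
  rw [pderiv_gram_comm hg hy k j i, pderiv_gram_comm hg hy j k i]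
  ring

/-- The covariant derivative of a `1`-form in terms of the one of the dual vector field. -/
theorem cov1_eq_up (hg : IsRiem S g) (he : e ∈ IsManifold.maximalAtlas (𝓡 2) 2 M)
    {u : TensorField M 1} (hu : IsCr 1 S u) {y : Plane} (hy : y ∈ chartDom e S) (i k : Fin 2) :
    cov1 e g u y i k = ∑ l, gram e g y k l *
      (pderiv i (fun z => up e g u z l) y + ∑ m, christoffel e g y l i m * up e g u y m) := by
  have h1 : (fun z => comp e u z ![k]) =ᶠ[𝓝 y] fun z => ∑ l, gram e g z k l * up e g u z l := by
    filter_upwards [(isOpen_chartDom hg.isOpen).mem_nhds hy] with z hz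
    exact sum_gram_mul_up hg he u hz k
  have hd1 : ∀ l, DifferentiableAt ℝ (fun z => gram e g z k l) y := fun l =>
    (contDiffAt_gram hg he hy k l).differentiableAt (by norm_num)
  have hd2 : ∀ l, DifferentiableAt ℝ (fun z => up e g u z l) y := fun l =>
    (contDiffAt_up hg he hu hy l).differentiableAt (by norm_num)
  simp only [cov1]
  rw [pderiv_congr h1, pderiv_sum _ fun l _ => (hd1 l).fun_mul (hd2 l)]
  simp only [fun l => pderiv_mul (hd1 l) (hd2 l) i, pderiv_gram hg he hy i k,
    sum_gram_mul_up hg he u hy]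
  simp only [Fin.sum_univ_two, gram_comm_chartDom hg hy]
  ring

theorem tensorInner_one (he : e ∈ IsManifold.maximalAtlas (𝓡 2) 2 M) {y : Plane}
    (hy : y ∈ e.target) (u v : TensorField M 1) :
    tensorInner g u v (e.symm y) =
      ∑ i, ∑ j, gramInv e g y i j * comp e u y ![i] * comp e v y ![j] := by
  rw [tensorInner_symm_apply he hy, coordInner]
  simp only [sum_fin_one_arrow, Fin.prod_univ_one]
  rfl

theorem tensorInner_two (he : e ∈ IsManifold.maximalAtlas (𝓡 2) 2 M) {y : Plane}
    (hy : y ∈ e.target) (u v : TensorField M 2) :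
    tensorInner g u v (e.symm y) =
      ∑ i, ∑ j, ∑ k, ∑ l, gramInv e g y i k * gramInv e g y j l *
        gram e u y i j * gram e v y k l := by
  rw [tensorInner_symm_apply he hy, coordInner]
  simp only [sum_fin_two_arrow, Fin.prod_univ_two]
  rfl

theorem gramInv_comm (hg : IsRiem S g) {y : Plane} (hy : y ∈ chartDom e S) :
    gramInv e g y 1 0 = gramInv e g y 0 1 := by
  simp only [gramInv, gramInv_apply (gram e g y), Matrix.of_apply, Matrix.cons_val',
    Matrix.cons_val_zero, Matrix.cons_val_one]
  simp [gram_comm_chartDom hg hy]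

theorem sum_gramInv_mul_gram (hg : IsRiem S g) (he : e ∈ IsManifold.maximalAtlas (𝓡 2) 2 M)
    {y : Plane} (hy : y ∈ chartDom e S) (k m : Fin 2) :
    gramInv e g y k 0 * gram e g y 0 m + gramInv e g y k 1 * gram e g y 1 m
      = (1 : Matrix (Fin 2) (Fin 2) ℝ) k m := by
  have h : gramInv e g y * gram e g y = 1 := mul_eq_one_comm.1 (gram_mul_gramInv hg he hy)
  rw [← h, Matrix.mul_apply, Fin.sum_univ_two]

/-! ### Contraction of a `2`-tensor with a `1`-form -/

/-- The contraction of a `2`-tensor with the vector field dual to a `1`-form. -/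
def contract (g h : TensorField M 2) (u : TensorField M 1) : TensorField M 1 := fun x =>
  ofComp x fun J : Fin 1 → Fin 2 => ∑ l, gram (chartAt Plane x) h (chartAt Plane x x) (J 0) l *
    up (chartAt Plane x) g u (chartAt Plane x x) l

theorem up_trans (he : e ∈ IsManifold.maximalAtlas (𝓡 2) 2 M)
    (he' : e' ∈ IsManifold.maximalAtlas (𝓡 2) 2 M) {y : Plane} (hy : y ∈ transDom e e')
    (u : TensorField M 1) (p : Fin 2) :
    up e' g u (trans e e' y) p = ∑ i, jac e e' y p i * up e g u y i := by
  simp only [up, gramInv_apply_eq he he' hy, comp_one_eq he he' hy u, Fin.sum_univ_two]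
  ring

theorem comp_contract (he : e ∈ IsManifold.maximalAtlas (𝓡 2) 2 M) {y : Plane}
    (hy : y ∈ e.target) (h : TensorField M 2) (u : TensorField M 1) (j : Fin 2) :
    comp e (contract g h u) y ![j] = ∑ l, gram e h y j l * up e g u y l := by
  have hy' := mem_transDom_chartAt hy
  have he' := chartAt_mem_maximalAtlas (e.symm y)
  rw [comp_one_eq he he' hy']
  have h1 : ∀ p, comp (chartAt Plane (e.symm y)) (contract g h u)
      (trans e (chartAt Plane (e.symm y)) y) ![p] =
      ∑ l, gram (chartAt Plane (e.symm y)) h (trans e (chartAt Plane (e.symm y)) y) p l *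
        up (chartAt Plane (e.symm y)) g u (trans e (chartAt Plane (e.symm y)) y) l := by
    intro p
    exact congrFun (comp_ofComp (e.symm y) (fun x => fun J : Fin 1 → Fin 2 =>
      ∑ l, gram (chartAt Plane x) h (chartAt Plane x x) (J 0) l *
        up (chartAt Plane x) g u (chartAt Plane x x) l)) ![p]
  simp only [h1, up_trans he he' hy', gram_apply_eq he he' hy']
  simp only [Fin.sum_univ_two]
  ring

theorem fin_one_eq (J : Fin 1 → Fin 2) : J = ![J 0] := by
  funext a; fin_cases a; rfl

theorem fin_two_eq (J : Fin 2 → Fin 2) : J = ![J 0, J 1] := by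
  funext a; fin_cases a <;> rfl

theorem isCr_contract (hg : IsRiem S g) {h : TensorField M 2} {u : TensorField M 1}
    (hh : IsCr 1 S h) (hu : IsCr 1 S u) : IsCr 1 S (contract g h u) := by
  intro e he I y hy
  have he2 := mem_maximalAtlas he
  have h1 : (fun z => comp e (contract g h u) z I) =ᶠ[𝓝 y]
      fun z => ∑ l, gram e h z (I 0) l * up e g u z l := by
    filter_upwards [(isOpen_chartDom hg.isOpen).mem_nhds hy] with z hz
    rw [fin_one_eq I, comp_contract he2 hz.1]
    rfl
  refine (ContDiffAt.congr_of_eventuallyEq ?_ h1).contDiffWithinAt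
  exact ContDiffAt.sum fun l _ => ContDiffAt.mul
    (contDiffAt_comp le_rfl hg.isOpen hh he2 hy _) (contDiffAt_up hg he2 hu hy l)

theorem val_divergence (hg : IsRiem S g) (he : e ∈ IsManifold.maximalAtlas (𝓡 2) 2 M)
    {β : TensorField M 1} (hβ : IsCr 1 S β) {y : Plane} (hy : y ∈ chartDom e S) :
    val (divergence g β) (e.symm y) = -∑ i, ∑ j, gramInv e g y i j * cov1 e g β y i j := by
  rw [← comp_divergence_one hg he hy hβ, comp_zero_eq_val]

theorem contract_algebra_one (W G : Matrix (Fin 2) (Fin 2) ℝ)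
    (hW : ∀ k m, W k 0 * G 0 m + W k 1 * G 1 m = (1 : Matrix (Fin 2) (Fin 2) ℝ) k m)
    (X U : Fin 2 → ℝ) :
    ∑ k, ∑ p, W k p * X k * ∑ l, G p l * U l = ∑ k, X k * U k := by
  have h : ∀ j, ∑ l, W j l * ∑ m, G l m * U m = U j := by
    intro j
    have h0 := hW j 0
    have h1 := hW j 1
    simp only [Fin.sum_univ_two]
    fin_cases j <;> simp [Matrix.one_apply] at h0 h1 ⊢ <;> linear_combination U 0 * h0 + U 1 * h1
  calc _ = ∑ k, X k * ∑ p, W k p * ∑ l, G p l * U l := by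
        simp only [Fin.sum_univ_two]; ring
    _ = _ := by simp only [h]

/-- Here `N` stands for the covariant derivative of the vector field dual to u, `W` for the inverse
of the metric `G`. Contracting `W` with `G` undoes the lowering of indices, and since `H` is
symmetric, pairing it with the symmetrization of ∇u is the same as pairing it with ∇u itself. -/
theorem contract_algebra_two (W G H N : Matrix (Fin 2) (Fin 2) ℝ)
    (hW : ∀ k m, W k 0 * G 0 m + W k 1 * G 1 m = (1 : Matrix (Fin 2) (Fin 2) ℝ) k m)
    (hH : H 1 0 = H 0 1) :
    ∑ i, ∑ j, ∑ k, ∑ l, W i k * W j l * H i j *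
      (1 / 2 * (∑ m, G l m * N k m + ∑ m, G k m * N l m)) = ∑ i, ∑ j, W i j * ∑ l, H i l * N j l := by
  have h : ∀ (U : Fin 2 → ℝ) j, ∑ l, W j l * ∑ m, G l m * U m = U j := by
    intro U j
    have h0 := hW j 0
    have h1 := hW j 1
    simp only [Fin.sum_univ_two]
    fin_cases j <;> simp [Matrix.one_apply] at h0 h1 ⊢ <;> linear_combination U 0 * h0 + U 1 * h1
  calc _ = 1 / 2 * (∑ i, ∑ k, W i k * ∑ j, H i j * ∑ l, W j l * ∑ m, G l m * N k m)
      + 1 / 2 * (∑ j, ∑ l, W j l * ∑ i, H i j * ∑ k, W i k * ∑ m, G k m * N l m) := by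
        simp only [Fin.sum_univ_two]; ring
    _ = 1 / 2 * (∑ i, ∑ k, W i k * ∑ j, H i j * N k j)
      + 1 / 2 * (∑ j, ∑ l, W j l * ∑ i, H i j * N l i) := by
        simp only [fun k => h (N k)]
    _ = _ := by simp only [Fin.sum_univ_two, hH]; ring

/-- The Leibniz rule for the divergence of the contraction of a `2`-tensor with a `1`-form. -/
theorem val_divergence_contract_symm (hg : IsRiem S g)
    (he : e ∈ IsManifold.maximalAtlas (𝓡 2) 2 M) {h : TensorField M 2} {u : TensorField M 1}
    (hh : IsC1Symm S h) (hu : IsCr 1 S u) {y : Plane} (hy : y ∈ chartDom e S) :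
    val (divergence g (contract g h u)) (e.symm y) =
      tensorInner g (divergence g h) u (e.symm y)
        - tensorInner g h (symCovDeriv g u) (e.symm y) := by
  rw [val_divergence hg he (isCr_contract hg hh.1 hu) hy, tensorInner_one he hy.1,
    tensorInner_two he hy.1]
  have hI := sum_gramInv_mul_gram hg he hy
  have h4 := contract_algebra_one (gramInv e g y) (gram e g y) hI
    (fun k => comp e (divergence g h) y ![k]) (up e g u y)
  have h5 := contract_algebra_two (gramInv e g y) (gram e g y) (gram e h y)
    (fun i l => pderiv i (fun z => up e g u z l) y + ∑ m, christoffel e g y l i m * up e g u y m)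
    hI (gram_apply_comm (hh.2 _ hy.2) 1 0)
  -- Everything is written in terms of ∂ᵢuˡ + Γˡᵢₘuᵐ for the dual vector field. In this form the
  -- derivatives of the metric enter only through the Christoffel symbols and no derivative of the
  -- inverse metric has to be computed.
  simp only [gram_symCovDeriv hg he hy hu, cov1_eq_up hg he hu hy, sum_gram_mul_up hg he u hy]
  rw [h4, h5]
  simp only [comp_divergence_two hg he hy hh.1]
  have h1 : ∀ j, (fun z => comp e (contract g h u) z ![j]) =ᶠ[𝓝 y]
      fun z => ∑ l, gram e h z j l * up e g u z l := by
    intro j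
    filter_upwards [(isOpen_chartDom hg.isOpen).mem_nhds hy] with z hz
    rw [comp_contract he hz.1]
  have hd1 : ∀ j l, DifferentiableAt ℝ (fun z => gram e h z j l) y := fun j l =>
    differentiableAt_comp hg.isOpen hh.1 he hy _
  have hd2 : ∀ l, DifferentiableAt ℝ (fun z => up e g u z l) y := fun l =>
    (contDiffAt_up hg he hu hy l).differentiableAt (by norm_num)
  have h2 : ∀ i j, cov1 e g (contract g h u) y i j =
      ∑ l, (pderiv i (fun z => gram e h z j l) y * up e g u y l +
        gram e h y j l * pderiv i (fun z => up e g u z l) y)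
      - ∑ m, christoffel e g y m i j * ∑ l, gram e h y m l * up e g u y l := by
    intro i j
    simp only [cov1, comp_contract he hy.1]
    rw [pderiv_congr (h1 j), pderiv_sum _ fun l _ => (hd1 j l).fun_mul (hd2 l)]
    simp only [fun l => pderiv_mul (hd1 j l) (hd2 l) i]
  simp only [h2, cov2]
  simp only [Fin.sum_univ_two, gramInv_comm hg hy]
  ring

theorem val_divergence_contract (hg : IsRiem S g) {h : TensorField M 2} {u : TensorField M 1}
    (hh : IsC1Symm S h) (hu : IsCr 1 S u) {x : M} (hx : x ∈ S) :
    val (divergence g (contract g h u)) x =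
      tensorInner g (divergence g h) u x - tensorInner g h (symCovDeriv g u) x := by
  have := val_divergence_contract_symm hg (chartAt_mem_maximalAtlas x) hh hu
    (chartAt_mem_chartDom hx)
  rwa [chartAt_symm_apply] at this

theorem isCr_smul {k : ℕ} {r : WithTop ℕ∞} {f : M → ℝ} {u : TensorField M k}
    (hf : IsCr r S (ofFun f)) (hu : IsCr r S u) : IsCr r S (fun x => f x • u x) :=
  fun e he I => (hf e he 0).mul (hu e he I)

/-- The Leibniz rule for the divergence of the product of a function and a `1`-form. -/
theorem val_divergence_smul_symm (hg : IsRiem S g)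
    (he : e ∈ IsManifold.maximalAtlas (𝓡 2) 2 M) {f : M → ℝ} {β : TensorField M 1}
    (hf : IsCr 1 S (ofFun f)) (hβ : IsCr 1 S β) {y : Plane} (hy : y ∈ chartDom e S) :
    val (divergence g (fun x => f x • β x)) (e.symm y)
      = f (e.symm y) * val (divergence g β) (e.symm y)
      - tensorInner g (symCovDeriv g (ofFun f)) β (e.symm y) := by
  have hd1 : DifferentiableAt ℝ (fun z => f (e.symm z)) y :=
    differentiableAt_comp hg.isOpen hf he hy ![]
  have hd2 : ∀ j, DifferentiableAt ℝ (fun z => comp e β z ![j]) y := fun j =>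
    differentiableAt_comp hg.isOpen hβ he hy _
  rw [val_divergence hg he (isCr_smul hf hβ) hy, val_divergence hg he hβ hy,
    tensorInner_one he hy.1]
  have h1 : ∀ i, comp e (symCovDeriv g (ofFun f)) y ![i] = pderiv i (fun z => f (e.symm z)) y :=
    fun i => comp_symCovDeriv_zero hg.isOpen he hy hf i
  have h2 : ∀ i j, cov1 e g (fun x => f x • β x) y i j =
      pderiv i (fun z => f (e.symm z)) y * comp e β y ![j] + f (e.symm y) * cov1 e g β y i j := by
    intro i j
    have h3 : (fun z => comp e (fun x => f x • β x) z ![j])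
        = fun z => f (e.symm z) * comp e β z ![j] := rfl
    have h4 : ∀ l, comp e (fun x => f x • β x) y ![l] = f (e.symm y) * comp e β y ![l] :=
      fun l => rfl
    simp only [cov1]
    rw [h3, pderiv_mul hd1 (hd2 j)]
    simp only [h4, Fin.sum_univ_two]
    ring
  simp only [h1, h2, Fin.sum_univ_two]
  ring

theorem val_divergence_smul (hg : IsRiem S g) {f : M → ℝ} {β : TensorField M 1}
    (hf : IsCr 1 S (ofFun f)) (hβ : IsCr 1 S β) {x : M} (hx : x ∈ S) :
    val (divergence g (fun x => f x • β x)) x = f x * val (divergence g β) x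
      - tensorInner g (symCovDeriv g (ofFun f)) β x := by
  have := val_divergence_smul_symm hg (chartAt_mem_maximalAtlas x) hf hβ
    (chartAt_mem_chartDom hx)
  rwa [chartAt_symm_apply] at this

/-! ### The divergence in a chart -/

/-- Metric compatibility expresses the derivatives of the Gram matrix by Christoffel symbols; in the
derivative of the determinant only the trace Γˡₗᵢ survives. -/
theorem pderiv_det_gram (hg : IsRiem S g) (he : e ∈ IsManifold.maximalAtlas (𝓡 2) 2 M)
    {y : Plane} (hy : y ∈ chartDom e S) (i : Fin 2) :
    pderiv i (fun z => (gram e g z).det) y =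
      2 * (gram e g y).det * ∑ l, christoffel e g y l l i := by
  have hd : ∀ j k, DifferentiableAt ℝ (fun z => gram e g z j k) y := fun j k =>
    (contDiffAt_gram hg he hy j k).differentiableAt (by norm_num)
  have h1 : (fun z => (gram e g z).det) =ᶠ[𝓝 y] fun z => gram e g z 0 0 * gram e g z 1 1 +
      (fun _ => (-1 : ℝ)) z * (gram e g z 0 1 * gram e g z 0 1) := by
    filter_upwards [(isOpen_chartDom hg.isOpen).mem_nhds hy] with z hz
    rw [Matrix.det_fin_two, gram_comm_chartDom hg hz]
    ring
  have hm : DifferentiableAt ℝ (fun z => gram e g z 0 1 * gram e g z 0 1) y :=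
    (hd 0 1).fun_mul (hd 0 1)
  rw [pderiv_congr h1, pderiv_add ((hd 0 0).fun_mul (hd 1 1))
    ((differentiableAt_const _).fun_mul hm),
    pderiv_mul (hd 0 0) (hd 1 1), pderiv_mul (differentiableAt_const _) hm,
    pderiv_mul (hd 0 1) (hd 0 1)]
  have h0 : pderiv i (fun _ => (-1 : ℝ)) y = 0 := by simp [pderiv]
  have hsymm : ∀ l, christoffel e g y l i 0 = christoffel e g y l 0 i ∧
      christoffel e g y l i 1 = christoffel e g y l 1 i := by
    intro l
    have : ∀ j, christoffel e g y l i j = christoffel e g y l j i := by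
      intro j
      simp only [christoffel, fun m => pderiv_gram_comm hg hy m i j]
      congr 1
      exact Finset.sum_congr rfl fun m _ => by ring
    exact ⟨this 0, this 1⟩
  rw [h0, pderiv_gram hg he hy, pderiv_gram hg he hy, pderiv_gram hg he hy, Matrix.det_fin_two]
  simp only [Fin.sum_univ_two, (hsymm _).1, (hsymm _).2, gram_comm_chartDom hg hy]
  ring

/-- The trace of ∇β, multiplied by √det g, is the Euclidean divergence ∂ᵢ(√det g βⁱ), because the
logarithmic derivative of √det g is the trace of the Christoffel symbols. This reduces the
divergence theorem in a chart to ∫ ∂ᵢV = 0. -/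
theorem val_divergence_mul_sqrt (hg : IsRiem S g) (he : e ∈ IsManifold.maximalAtlas (𝓡 2) 2 M)
    {β : TensorField M 1} (hβ : IsCr 1 S β) {y : Plane} (hy : y ∈ chartDom e S) :
    Real.sqrt (gram e g y).det * val (divergence g β) (e.symm y) =
      -∑ i, pderiv i (fun z => Real.sqrt (gram e g z).det * up e g β z i) y := by
  have hpos := det_gram_pos hg he hy
  have hdd := (contDiffAt_det_gram hg he hy).differentiableAt (by norm_num)
  have hds : DifferentiableAt ℝ (fun z => Real.sqrt (gram e g z).det) y :=
    hdd.sqrt hpos.ne'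
  have hps : ∀ i, pderiv i (fun z => Real.sqrt (gram e g z).det) y =
      Real.sqrt (gram e g y).det * ∑ l, christoffel e g y l l i := by
    intro i
    have h1 : pderiv i (fun z => (gram e g z).det) y =
        2 * Real.sqrt (gram e g y).det * pderiv i (fun z => Real.sqrt (gram e g z).det) y := by
      have h2 : (fun z => (gram e g z).det) =ᶠ[𝓝 y]
          fun z => Real.sqrt (gram e g z).det * Real.sqrt (gram e g z).det := by
        filter_upwards [(isOpen_chartDom hg.isOpen).mem_nhds hy] with z hz
        exact (Real.mul_self_sqrt (det_gram_pos hg he hz).le).symm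
      rw [pderiv_congr h2, pderiv_mul hds hds]
      ring
    rw [pderiv_det_gram hg he hy, ← Real.mul_self_sqrt hpos.le] at h1
    rw [Real.sqrt_mul_self (Real.sqrt_nonneg _)] at h1
    have h3 := Real.sqrt_pos.2 hpos
    have h4 : 2 * Real.sqrt (gram e g y).det ≠ 0 := by positivity
    apply mul_left_cancel₀ h4
    rw [← h1]
    ring
  have hdu : ∀ l, DifferentiableAt ℝ (fun z => up e g β z l) y := fun l =>
    (contDiffAt_up hg he hβ hy l).differentiableAt (by norm_num)
  have hsymm : ∀ l, christoffel e g y l 1 0 = christoffel e g y l 0 1 := by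
    intro l
    simp only [christoffel, fun m => pderiv_gram_comm hg hy m 1 0]
    congr 1
    exact Finset.sum_congr rfl fun m _ => by ring
  rw [val_divergence hg he hβ hy]
  simp only [fun i => pderiv_mul hds (hdu i) i, hps, cov1_eq_up hg he hβ hy]
  have hI := sum_gramInv_mul_gram hg he hy
  have hc := gramInv_comm hg hy
  have h5 : ∑ i, ∑ j, gramInv e g y i j * ∑ l, gram e g y j l *
      (pderiv i (fun z => up e g β z l) y + ∑ m, christoffel e g y l i m * up e g β y m)
      = ∑ i, (pderiv i (fun z => up e g β z i) y
        + ∑ m, christoffel e g y i i m * up e g β y m) := by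
    have h00 := hI 0 0
    have h01 := hI 0 1
    have h10 := hI 1 0
    have h11 := hI 1 1
    simp only [Matrix.one_apply_eq, Matrix.one_apply_ne (zero_ne_one),
      Matrix.one_apply_ne (one_ne_zero)] at h00 h01 h10 h11
    set N : Fin 2 → Fin 2 → ℝ := fun i l =>
      pderiv i (fun z => up e g β z l) y + ∑ m, christoffel e g y l i m * up e g β y m with hN
    change ∑ i, ∑ j, gramInv e g y i j * ∑ l, gram e g y j l * N i l = ∑ i, N i i
    simp only [Fin.sum_univ_two]
    linear_combination N 0 0 * h00 + N 0 1 * h01 + N 1 0 * h10 + N 1 1 * h11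
  rw [h5]
  simp only [Fin.sum_univ_two, hsymm]
  ring

end Identities

/-! ### The area measure as a gluing of the chart measures. -/

section Area

variable {M : Type*} [TopologicalSpace M] [ChartedSpace Plane M] [IsManifold (𝓡 2) 2 M]
variable [MeasurableSpace M] [BorelSpace M]
variable {e e' : OpenPartialHomeomorph M Plane} {S : Set M} {g : TensorField M 2}

/-- The density of the area measure in a chart. -/
def density (e : OpenPartialHomeomorph M Plane) (g : TensorField M 2) (y : Plane) : ℝ :=
  Real.sqrt (gram e g y).det

theorem density_nonneg (y : Plane) : 0 ≤ density e g y :=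
  Real.sqrt_nonneg (gram e g y).det

theorem density_pos (hg : IsRiem S g) (he : e ∈ IsManifold.maximalAtlas (𝓡 2) 2 M)
    {y : Plane} (hy : y ∈ chartDom e S) : 0 < density e g y :=
  Real.sqrt_pos.2 (det_gram_pos hg he hy)

theorem continuousOn_density (hg : IsRiem S g) (he : e ∈ IsManifold.maximalAtlas (𝓡 2) 2 M) :
    ContinuousOn (density e g) (chartDom e S) := fun y hy =>
  ((contDiffAt_det_gram hg he hy).continuousAt.sqrt).continuousWithinAt

theorem measurableSet_chartDom (hS : IsOpen S) : MeasurableSet (chartDom e S) :=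
  (isOpen_chartDom hS).measurableSet

/-- Charts are total functions that are continuous only on their domain, so preimages become
measurable after intersection with it. -/
theorem measurableSet_inter_preimage {X Y : Type*} [TopologicalSpace X] [MeasurableSpace X]
    [BorelSpace X] [TopologicalSpace Y] [MeasurableSpace Y] [BorelSpace Y] {f : X → Y}
    {s : Set X} (hf : ContinuousOn f s) (hs : MeasurableSet s) {A : Set Y}
    (hA : MeasurableSet A) : MeasurableSet (s ∩ f ⁻¹' A) := by
  have h1 : MeasurableSet (s.domRestrict f ⁻¹' A) :=
    (continuousOn_iff_continuous_domRestrict.1 hf).measurable hA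
  have h2 := hs.subtype_image h1
  convert h2 using 1
  ext x
  simp [Set.domRestrict, and_comm]

/-- The area measure in a chart, on the model plane. -/
def planeVolume (g : TensorField M 2) (S : Set M) (e : OpenPartialHomeomorph M Plane) :
    Measure Plane :=
  ((volume : Measure Plane).restrict (chartDom e S)).withDensity
    (fun y => ENNReal.ofReal (density e g y))

theorem planeVolume_ac :
    planeVolume g S e ≪ (volume : Measure Plane).restrict (chartDom e S) :=
  withDensity_absolutelyContinuous _ _

theorem aemeasurable_ofReal_density (hg : IsRiem S g)
    (he : e ∈ IsManifold.maximalAtlas (𝓡 2) 2 M) :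
    AEMeasurable (fun y => ENNReal.ofReal (density e g y))
      ((volume : Measure Plane).restrict (chartDom e S)) :=
  ((continuousOn_density hg he).aemeasurable (measurableSet_chartDom hg.isOpen)).ennreal_ofReal

theorem ac_planeVolume (hg : IsRiem S g) (he : e ∈ IsManifold.maximalAtlas (𝓡 2) 2 M) :
    (volume : Measure Plane).restrict (chartDom e S) ≪ planeVolume g S e := by
  refine withDensity_absolutelyContinuous' (aemeasurable_ofReal_density hg he) ?_
  filter_upwards [ae_restrict_mem (measurableSet_chartDom hg.isOpen)] with y hy
  simpa using density_pos hg he hy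

theorem aemeasurable_symm (hS : IsOpen S) :
    AEMeasurable e.symm ((volume : Measure Plane).restrict (chartDom e S)) :=
  (e.continuousOn_symm.mono inter_subset_left).aemeasurable (measurableSet_chartDom hS)

theorem chartVolume_eq : chartVolume g S e = (planeVolume g S e).map e.symm := rfl

theorem chartVolume_apply (hS : IsOpen S) {A : Set M} (hA : MeasurableSet A) :
    chartVolume g S e A =
      ∫⁻ y in chartDom e S ∩ e.symm ⁻¹' A, ENNReal.ofReal (density e g y) := by
  have hm : MeasurableSet (chartDom e S ∩ e.symm ⁻¹' A) := measurableSet_inter_preimage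
    (e.continuousOn_symm.mono inter_subset_left) (measurableSet_chartDom (e := e) hS) hA
  have h1 : planeVolume g S e (e.symm ⁻¹' A)
      = planeVolume g S e (chartDom e S ∩ e.symm ⁻¹' A) := by
    refine measure_congr ?_
    have : ∀ᵐ y ∂planeVolume g S e, y ∈ chartDom e S :=
      planeVolume_ac.ae_le (ae_restrict_mem (measurableSet_chartDom hS))
    filter_upwards [this] with y hy
    exact propext ⟨fun h => ⟨hy, h⟩, fun h => h.2⟩
  rw [chartVolume_eq, Measure.map_apply_of_aemeasurable
    ((aemeasurable_symm hS).mono_ac planeVolume_ac) hA, h1, planeVolume,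
    withDensity_apply _ hm, Measure.restrict_restrict hm, inter_right_comm, inter_self]

theorem det_fderiv_trans (he : e ∈ IsManifold.maximalAtlas (𝓡 2) 2 M)
    (he' : e' ∈ IsManifold.maximalAtlas (𝓡 2) 2 M) {y : Plane} (hy : y ∈ transDom e e') :
    (fderiv ℝ (trans e e') y).det = (jac e e' y).det := by
  rw [ContinuousLinearMap.det,
    ← LinearMap.det_toMatrix (EuclideanSpace.basisFun (Fin 2) ℝ).toBasis]
  congr 1
  ext p i
  rw [LinearMap.toMatrix_apply, jac_apply_eq he he' hy]
  simp [stdVec]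

theorem density_trans (he : e ∈ IsManifold.maximalAtlas (𝓡 2) 2 M)
    (he' : e' ∈ IsManifold.maximalAtlas (𝓡 2) 2 M) {y : Plane} (hy : y ∈ transDom e e') :
    density e g y = |(jac e e' y).det| * density e' g (trans e e' y) := by
  rw [density, gram_eq he he' hy, Matrix.det_mul, Matrix.det_mul, Matrix.det_transpose]
  have : (jac e e' y).det * (gram e' g (trans e e' y)).det * (jac e e' y).det
      = (jac e e' y).det ^ 2 * (gram e' g (trans e e' y)).det := by ring
  rw [this, Real.sqrt_mul (sq_nonneg _), Real.sqrt_sq_eq_abs]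
  rfl

/-- The area measures of two charts agree on the overlap. -/
theorem chartVolume_restrict (hS : IsOpen S) (he : e ∈ IsManifold.maximalAtlas (𝓡 2) 2 M)
    (he' : e' ∈ IsManifold.maximalAtlas (𝓡 2) 2 M) :
    (chartVolume g S e).restrict e'.source = (chartVolume g S e').restrict e.source := by
  ext A hA
  rw [Measure.restrict_apply hA, Measure.restrict_apply hA,
    chartVolume_apply hS (hA.inter e'.open_source.measurableSet),
    chartVolume_apply hS (hA.inter e.open_source.measurableSet)]
  set T := chartDom e S ∩ e.symm ⁻¹' (A ∩ e'.source) with hT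
  have hTsub : T ⊆ transDom e e' := fun y hy => ⟨hy.1.1, hy.2.2⟩
  have hTm : MeasurableSet T := measurableSet_inter_preimage
    (e.continuousOn_symm.mono inter_subset_left) (measurableSet_chartDom hS)
    (hA.inter e'.open_source.measurableSet)
  -- The rest is the change of variables formula for `trans e e'`, which maps the chart image of A
  -- in `e` onto the one in `e'`; √det g changes by the absolute value of the Jacobian determinant.
  have himage : trans e e' '' T = chartDom e' S ∩ e'.symm ⁻¹' (A ∩ e.source) := by
    ext z
    constructor
    · rintro ⟨y, hy, rfl⟩
      have hy' := hTsub hy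
      refine ⟨trans_mem_chartDom hy' hy.1, ?_⟩
      rw [mem_preimage, symm_trans hy']
      exact ⟨hy.2.1, e.map_target hy'.1⟩
    · intro hz
      have hz' : z ∈ transDom e' e := ⟨hz.1.1, hz.2.2⟩
      refine ⟨trans e' e z, ⟨trans_mem_chartDom hz' hz.1, ?_⟩, trans_trans hz'⟩
      rw [mem_preimage, symm_trans hz']
      exact ⟨hz.2.1, e'.map_target hz'.1⟩
  rw [← himage, lintegral_image_eq_lintegral_abs_det_fderiv_mul volume hTm
    (f' := fun y => fderiv ℝ (trans e e') y)]
  · refine setLIntegral_congr_fun hTm fun y hy => ?_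
    rw [density_trans he he' (hTsub hy), ENNReal.ofReal_mul (abs_nonneg _),
      ← det_fderiv_trans he he' (hTsub hy)]
  · intro y hy
    exact (((contDiffAt_trans he he' (hTsub hy)).differentiableAt
      (by norm_num)).hasFDerivAt).hasFDerivWithinAt
  · intro y hy z hz hyz
    rw [← trans_trans (hTsub hy), ← trans_trans (hTsub hz), hyz]

theorem chartVolume_restrict_source (hS : IsOpen S) :
    (chartVolume g S e).restrict e.source = chartVolume g S e := by
  refine Measure.restrict_eq_self_of_ae_mem ?_
  refine (ae_map_iff (p := fun x => x ∈ e.source)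
    ((aemeasurable_symm hS).mono_ac planeVolume_ac) e.open_source.measurableSet).2 ?_
  have : ∀ᵐ y ∂planeVolume g S e, y ∈ chartDom e S :=
    planeVolume_ac.ae_le (ae_restrict_mem (measurableSet_chartDom hS))
  filter_upwards [this] with y hy using e.map_target hy.1

/-- A supremum of measures is bounded by exhibiting an upper bound: here the measure of the chart
`e` plus the part of `areaMeasure` outside `e.source`. Each chart measure splits along `e.source`,
and its inner part agrees with that of `e` on the overlap. Restriction to `e.source` then removes
the second summand. -/
theorem areaMeasure_restrict_le (hS : IsOpen S) (he : e ∈ IsManifold.maximalAtlas (𝓡 2) 2 M) :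
    (areaMeasure g S).restrict e.source ≤ chartVolume g S e := by
  have hms : MeasurableSet e.source := e.open_source.measurableSet
  have h1 : areaMeasure g S ≤
      chartVolume g S e + (areaMeasure g S).restrict e.sourceᶜ := by
    conv_lhs => rw [areaMeasure]
    refine iSup₂_le fun e' he' => ?_
    have hle : chartVolume g S e' ≤ areaMeasure g S := le_iSup₂_of_le e' he' le_rfl
    rw [← Measure.restrict_add_restrict_compl (μ := chartVolume g S e') hms]
    refine add_le_add ?_ (Measure.restrict_mono_measure hle _)
    rw [← chartVolume_restrict hS he (mem_maximalAtlas he')]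
    exact Measure.restrict_le_self
  have h2 := Measure.restrict_mono_measure h1 e.source
  rw [Measure.restrict_add, Measure.restrict_restrict hms, inter_compl_self,
    Measure.restrict_empty, add_zero, chartVolume_restrict_source hS] at h2
  exact h2

theorem areaMeasure_restrict_source_of_mem_atlas (hS : IsOpen S) (he : e ∈ atlas Plane M) :
    (areaMeasure g S).restrict e.source = chartVolume g S e := by
  refine le_antisymm (areaMeasure_restrict_le hS (mem_maximalAtlas he)) ?_
  rw [← chartVolume_restrict_source hS]
  exact Measure.restrict_mono_measure (le_iSup₂_of_le (f := fun e _ => chartVolume g S e) e he le_rfl) _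

variable [CompactSpace M]

variable (M) in
theorem exists_finset_iUnion_source :
    ∃ t : Finset M, ⋃ x : t, (chartAt Plane (x : M)).source = univ := by
  obtain ⟨t, ht⟩ := isCompact_univ.elim_finite_subcover (fun x : M => (chartAt Plane x).source)
    (fun x => (chartAt Plane x).open_source)
    (fun x _ => mem_iUnion.2 ⟨x, mem_chart_source Plane x⟩)
  refine ⟨t, eq_univ_of_univ_subset (ht.trans ?_)⟩
  intro x hx
  simpa using hx

/-- The area measure in a chart of class `C²`. -/
theorem areaMeasure_restrict_source (hS : IsOpen S)
    (he : e ∈ IsManifold.maximalAtlas (𝓡 2) 2 M) :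
    (areaMeasure g S).restrict e.source = chartVolume g S e := by
  obtain ⟨t, ht⟩ := exists_finset_iUnion_source M
  refine (Measure.ext_iff_of_iUnion_eq_univ ht).2 fun x => ?_
  rw [Measure.restrict_comm (chartAt Plane (x : M)).open_source.measurableSet,
    areaMeasure_restrict_source_of_mem_atlas hS (chart_mem_atlas Plane _)]
  exact chartVolume_restrict hS (chartAt_mem_maximalAtlas _) he

/-- Finitely many charts cover M. In each, the bad set is enlarged in the plane to a measurable null
set before it is pulled back by the chart, because `P` is not assumed measurable. -/
theorem ae_areaMeasure_of_charts (hS : IsOpen S) {P : M → Prop}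
    (h : ∀ e ∈ atlas Plane M, ∀ᵐ y ∂(volume : Measure Plane).restrict (chartDom e S),
      P (e.symm y)) : ∀ᵐ x ∂areaMeasure g S, P x := by
  obtain ⟨t, ht⟩ := exists_finset_iUnion_source M
  rw [← Measure.restrict_univ (μ := areaMeasure g S), ← ht, ae_restrict_iUnion_iff]
  intro x
  set e := chartAt Plane (x : M)
  have he : e ∈ atlas Plane M := chart_mem_atlas Plane _
  rw [areaMeasure_restrict_source_of_mem_atlas hS he]
  have h1 : ∀ᵐ y ∂planeVolume g S e, P (e.symm y) ∧ y ∈ chartDom e S :=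
    planeVolume_ac.ae_le ((h e he).and (ae_restrict_mem (measurableSet_chartDom hS)))
  obtain ⟨N, hN, hNm, hN0⟩ := exists_measurable_superset_of_null (ae_iff.1 h1)
  rw [ae_iff]
  have hsub : {x | ¬ P x} ⊆ e.sourceᶜ ∪ (e.source ∩ e ⁻¹' N) := by
    intro z hz
    by_cases hze : z ∈ e.source
    · refine Or.inr ⟨hze, hN ?_⟩
      intro h2
      rw [e.left_inv hze] at h2
      exact hz h2.1
    · exact Or.inl hze
  refine measure_mono_null hsub (measure_union_null ?_ ?_)
  · rw [← chartVolume_restrict_source hS, Measure.restrict_apply e.open_source.measurableSet.compl]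
    simp
  · have hm : MeasurableSet (e.source ∩ e ⁻¹' N) :=
      measurableSet_inter_preimage e.continuousOn e.open_source.measurableSet hNm
    rw [chartVolume_eq, Measure.map_apply_of_aemeasurable
      ((aemeasurable_symm hS).mono_ac planeVolume_ac) hm]
    have h3 : ∀ᵐ y ∂planeVolume g S e, y ∉ N := measure_eq_zero_iff_ae_notMem.1 hN0
    have h4 : ∀ᵐ y ∂planeVolume g S e, y ∉ e.symm ⁻¹' (e.source ∩ e ⁻¹' N) := by
      filter_upwards [h3, h1] with y hy hy1 hy2
      rw [mem_preimage, mem_inter_iff, mem_preimage, e.right_inv hy1.2.1] at hy2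
      exact hy hy2.2
    exact measure_eq_zero_iff_ae_notMem.2 h4

theorem ae_chart_of_ae_areaMeasure (hg : IsRiem S g)
    (he : e ∈ IsManifold.maximalAtlas (𝓡 2) 2 M) {P : M → Prop}
    (h : ∀ᵐ x ∂areaMeasure g S, P x) :
    ∀ᵐ y ∂(volume : Measure Plane).restrict (chartDom e S), P (e.symm y) := by
  refine (ac_planeVolume hg he).ae_le ?_
  have h1 : ∀ᵐ x ∂chartVolume g S e, P x := by
    rw [← areaMeasure_restrict_source hg.isOpen he]
    exact ae_restrict_of_ae h
  exact ae_of_ae_map ((aemeasurable_symm hg.isOpen).mono_ac planeVolume_ac) h1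

theorem ae_mem (hS : IsOpen S) : ∀ᵐ x ∂areaMeasure g S, x ∈ S := by
  refine ae_areaMeasure_of_charts hS fun e _ => ?_
  filter_upwards [ae_restrict_mem (measurableSet_chartDom hS)] with y hy using hy.2

theorem map_chart_chartVolume (hS : IsOpen S) :
    (chartVolume g S e).map e = planeVolume g S e := by
  have h1 : AEMeasurable e (chartVolume g S e) := by
    rw [← chartVolume_restrict_source hS]
    exact e.continuousOn.aemeasurable e.open_source.measurableSet
  rw [chartVolume_eq] at h1 ⊢
  rw [AEMeasurable.map_map_of_aemeasurable h1 ((aemeasurable_symm hS).mono_ac planeVolume_ac)]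
  have h2 : e ∘ e.symm =ᵐ[planeVolume g S e] id := by
    have : ∀ᵐ y ∂planeVolume g S e, y ∈ chartDom e S :=
      planeVolume_ac.ae_le (ae_restrict_mem (measurableSet_chartDom hS))
    filter_upwards [this] with y hy using e.right_inv hy.1
  rw [Measure.map_congr h2, Measure.map_id]

theorem aemeasurable_chartVolume {E : Type*} [MeasurableSpace E] (hS : IsOpen S) {f : M → E}
    (hf : AEMeasurable (fun y => f (e.symm y))
      ((volume : Measure Plane).restrict (chartDom e S))) :
    AEMeasurable f (chartVolume g S e) := by
  have h1 : AEMeasurable e (chartVolume g S e) := by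
    rw [← chartVolume_restrict_source hS]
    exact e.continuousOn.aemeasurable e.open_source.measurableSet
  have h2 : AEMeasurable ((fun y => f (e.symm y)) ∘ e) (chartVolume g S e) := by
    refine AEMeasurable.comp_aemeasurable ?_ h1
    rw [map_chart_chartVolume hS]
    exact hf.mono_ac planeVolume_ac
  refine h2.congr ?_
  rw [← chartVolume_restrict_source hS]
  filter_upwards [ae_restrict_mem e.open_source.measurableSet] with x hx
  simp [e.left_inv hx]

theorem aemeasurable_areaMeasure {E : Type*} [MeasurableSpace E] (hS : IsOpen S) {f : M → E}
    (hf : ∀ e ∈ atlas Plane M, AEMeasurable (fun y => f (e.symm y))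
      ((volume : Measure Plane).restrict (chartDom e S))) :
    AEMeasurable f (areaMeasure g S) := by
  obtain ⟨t, ht⟩ := exists_finset_iUnion_source M
  rw [← Measure.restrict_univ (μ := areaMeasure g S), ← ht, aemeasurable_iUnion_iff]
  intro x
  rw [areaMeasure_restrict_source_of_mem_atlas hS (chart_mem_atlas Plane _)]
  exact aemeasurable_chartVolume hS (hf _ (chart_mem_atlas Plane _))

theorem setLIntegral_source (hg : IsRiem S g)
    (he : e ∈ IsManifold.maximalAtlas (𝓡 2) 2 M) {f : M → ℝ≥0∞}
    (hf : AEMeasurable f (areaMeasure g S)) :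
    ∫⁻ x in e.source, f x ∂areaMeasure g S =
      ∫⁻ y in chartDom e S, ENNReal.ofReal (density e g y) * f (e.symm y) := by
  have hm : AEMeasurable e.symm (planeVolume g S e) :=
    (aemeasurable_symm (e := e) hg.isOpen).mono_ac planeVolume_ac
  have hf' : AEMeasurable f ((planeVolume g S e).map e.symm) := by
    rw [← chartVolume_eq, ← areaMeasure_restrict_source hg.isOpen he]
    exact hf.restrict
  rw [areaMeasure_restrict_source hg.isOpen he, chartVolume_eq, lintegral_map' hf' hm, planeVolume,
    lintegral_withDensity_eq_lintegral_mul₀' (aemeasurable_ofReal_density hg he)]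
  · rfl
  · exact hf'.comp_aemeasurable hm

theorem integral_eq_chart (hg : IsRiem S g)
    (he : e ∈ IsManifold.maximalAtlas (𝓡 2) 2 M) {f : M → ℝ}
    (hf : AEMeasurable f (areaMeasure g S)) (h0 : ∀ x ∈ S, x ∉ e.source → f x = 0) :
    ∫ x, f x ∂areaMeasure g S = ∫ y in chartDom e S, density e g y * f (e.symm y) := by
  have hm : AEMeasurable e.symm (planeVolume g S e) :=
    (aemeasurable_symm (e := e) hg.isOpen).mono_ac planeVolume_ac
  have hf' : AEMeasurable f ((planeVolume g S e).map e.symm) := by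
    rw [← chartVolume_eq, ← areaMeasure_restrict_source hg.isOpen he]
    exact hf.restrict
  have h1 : ∫ x, f x ∂areaMeasure g S = ∫ x in e.source, f x ∂areaMeasure g S := by
    rw [← integral_indicator e.open_source.measurableSet]
    refine integral_congr_ae ?_
    filter_upwards [ae_mem hg.isOpen] with x hx
    by_cases hxe : x ∈ e.source
    · rw [indicator_of_mem hxe]
    · rw [indicator_of_notMem hxe, h0 x hx hxe]
  rw [h1, areaMeasure_restrict_source hg.isOpen he, chartVolume_eq, integral_map hm
    hf'.aestronglyMeasurable, planeVolume,
    integral_withDensity_eq_integral_toReal_smul₀ (aemeasurable_ofReal_density hg he)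
      (Eventually.of_forall fun _ => ENNReal.ofReal_lt_top)]
  refine integral_congr_ae (Eventually.of_forall fun y => ?_)
  simp [ENNReal.toReal_ofReal (density_nonneg y)]

end Area

/-! ### Continuity of the covariant derivatives and of the pointwise pairings. -/

section Continuity

variable {M : Type*} [TopologicalSpace M] [ChartedSpace Plane M] [IsManifold (𝓡 2) 2 M]
variable {e e' : OpenPartialHomeomorph M Plane} {S : Set M} {g : TensorField M 2}

theorem continuousAt_christoffel (hg : IsRiem S g) (he : e ∈ IsManifold.maximalAtlas (𝓡 2) 2 M)
    {y : Plane} (hy : y ∈ chartDom e S) (l i j : Fin 2) :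
    ContinuousAt (fun z => christoffel e g z l i j) y := by
  have h1 : ∀ i j k, ContinuousAt (pderiv i (fun z => gram e g z j k)) y := fun i j k =>
    (contDiffAt_pderiv (m := 0) (contDiffAt_gram hg he hy j k) (by simp) i).continuousAt
  have h2 : ∀ i j, ContinuousAt (fun z => gramInv e g z i j) y := fun i j =>
    (contDiffAt_gramInv hg he hy i j).continuousAt
  simp only [christoffel, Fin.sum_univ_two]
  exact continuousAt_const.mul (((h2 _ _).mul (((h1 _ _ _).add (h1 _ _ _)).sub (h1 _ _ _))).add
    ((h2 _ _).mul (((h1 _ _ _).add (h1 _ _ _)).sub (h1 _ _ _))))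

theorem continuousAt_cov1 (hg : IsRiem S g) (he : e ∈ IsManifold.maximalAtlas (𝓡 2) 2 M)
    {u : TensorField M 1} (hu : IsCr 1 S u) {y : Plane} (hy : y ∈ chartDom e S) (i j : Fin 2) :
    ContinuousAt (fun z => cov1 e g u z i j) y := by
  have h1 : ∀ J, ContDiffAt ℝ 1 (fun z => comp e u z J) y := fun J =>
    contDiffAt_comp le_rfl hg.isOpen hu he hy J
  have h2 : ContinuousAt (pderiv i (fun z => comp e u z ![j])) y :=
    (contDiffAt_pderiv (m := 0) (h1 _) (by simp) i).continuousAt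
  simp only [cov1, Fin.sum_univ_two]
  exact h2.sub (((continuousAt_christoffel hg he hy _ _ _).mul (h1 _).continuousAt).add
    ((continuousAt_christoffel hg he hy _ _ _).mul (h1 _).continuousAt))

theorem continuousAt_cov2 (hg : IsRiem S g) (he : e ∈ IsManifold.maximalAtlas (𝓡 2) 2 M)
    {h : TensorField M 2} (hh : IsCr 1 S h) {y : Plane} (hy : y ∈ chartDom e S) (i j k : Fin 2) :
    ContinuousAt (fun z => cov2 e g h z i j k) y := by
  have h1 : ∀ j k, ContDiffAt ℝ 1 (fun z => gram e h z j k) y := fun j k =>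
    contDiffAt_comp le_rfl hg.isOpen hh he hy _
  have h2 : ContinuousAt (pderiv i (fun z => gram e h z j k)) y :=
    (contDiffAt_pderiv (m := 0) (h1 _ _) (by simp) i).continuousAt
  have h3 : ∀ l i j, ContinuousAt (fun z => christoffel e g z l i j) y :=
    continuousAt_christoffel hg he hy
  simp only [cov2, Fin.sum_univ_two]
  exact (h2.sub (((h3 _ _ _).mul (h1 _ _).continuousAt).add
    ((h3 _ _ _).mul (h1 _ _).continuousAt))).sub (((h3 _ _ _).mul (h1 _ _).continuousAt).add
    ((h3 _ _ _).mul (h1 _ _).continuousAt))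

theorem isCr_zero_of_continuousAt {k : ℕ} (hS : IsOpen S) {u : TensorField M k}
    (h : ∀ e ∈ atlas Plane M, ∀ y ∈ chartDom e S, ∀ I, ∃ F : Plane → ℝ, ContinuousAt F y ∧
      ∀ z ∈ chartDom e S, comp e u z I = F z) : IsCr 0 S u := by
  intro e he I
  rw [contDiffOn_zero]
  intro y hy
  obtain ⟨F, hF, hF2⟩ := h e he y hy I
  refine (hF.congr ?_).continuousWithinAt
  filter_upwards [(isOpen_chartDom hS).mem_nhds hy] with z hz using (hF2 z hz).symm

theorem isCr_zero_symCovDeriv_one (hg : IsRiem S g) {u : TensorField M 1} (hu : IsCr 1 S u) :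
    IsCr 0 S (symCovDeriv g u) := by
  refine isCr_zero_of_continuousAt hg.isOpen fun e he y hy I => ?_
  have he' := mem_maximalAtlas he
  refine ⟨fun z => (1 / 2) * (cov1 e g u z (I 0) (I 1) + cov1 e g u z (I 1) (I 0)), ?_, ?_⟩
  · exact continuousAt_const.mul
      ((continuousAt_cov1 hg he' hu hy _ _).add (continuousAt_cov1 hg he' hu hy _ _))
  · intro z hz
    rw [fin_two_eq I]
    exact gram_symCovDeriv hg he' hz hu (I 0) (I 1)

theorem isCr_zero_symCovDeriv_zero (hg : IsRiem S g) {f : TensorField M 0} (hf : IsCr 1 S f) :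
    IsCr 0 S (symCovDeriv g f) := by
  refine isCr_zero_of_continuousAt hg.isOpen fun e he y hy I => ?_
  have he' := mem_maximalAtlas he
  refine ⟨pderiv (I 0) (fun z => comp e f z ![]), ?_, ?_⟩
  · exact (contDiffAt_pderiv (m := 0) (contDiffAt_comp le_rfl hg.isOpen hf he' hy _)
      (by simp) _).continuousAt
  · intro z hz
    rw [fin_one_eq I, comp_symCovDeriv_zero hg.isOpen he' hz hf]
    rfl

theorem isCr_zero_divergence_one (hg : IsRiem S g) {β : TensorField M 1} (hβ : IsCr 1 S β) :
    IsCr 0 S (divergence g β) := by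
  refine isCr_zero_of_continuousAt hg.isOpen fun e he y hy I => ?_
  have he' := mem_maximalAtlas he
  refine ⟨fun z => -∑ i, ∑ j, gramInv e g z i j * cov1 e g β z i j, ?_, ?_⟩
  · simp only [Fin.sum_univ_two]
    have h2 : ∀ i j, ContinuousAt (fun z => gramInv e g z i j * cov1 e g β z i j) y := fun i j =>
      (contDiffAt_gramInv hg he' hy i j).continuousAt.mul (continuousAt_cov1 hg he' hβ hy i j)
    exact (((h2 _ _).add (h2 _ _)).add ((h2 _ _).add (h2 _ _))).neg
  · intro z hz
    exact ((comp_zero_eq_val _ z I).trans (comp_zero_eq_val _ z ![]).symm).trans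
      (comp_divergence_one hg he' hz hβ)

theorem isCr_zero_divergence_two (hg : IsRiem S g) {h : TensorField M 2} (hh : IsCr 1 S h) :
    IsCr 0 S (divergence g h) := by
  refine isCr_zero_of_continuousAt hg.isOpen fun e he y hy I => ?_
  have he' := mem_maximalAtlas he
  refine ⟨fun z => -∑ i, ∑ j, gramInv e g z i j * cov2 e g h z i j (I 0), ?_, ?_⟩
  · simp only [Fin.sum_univ_two]
    have h2 : ∀ i j, ContinuousAt (fun z => gramInv e g z i j * cov2 e g h z i j (I 0)) y :=
      fun i j => (contDiffAt_gramInv hg he' hy i j).continuousAt.mul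
        (continuousAt_cov2 hg he' hh hy i j _)
    exact (((h2 _ _).add (h2 _ _)).add ((h2 _ _).add (h2 _ _))).neg
  · intro z hz
    rw [fin_one_eq I, comp_divergence_two hg he' hz hh]
    rfl

theorem continuousOn_of_charts {F : M → ℝ}
    (h : ∀ x ∈ S, ContinuousAt (fun z => F ((chartAt Plane x).symm z)) (chartAt Plane x x)) :
    ContinuousOn F S := by
  intro x hx
  refine ContinuousAt.continuousWithinAt ?_
  have h1 : ContinuousAt (fun z => F ((chartAt Plane x).symm (chartAt Plane x z))) x :=
    (h x hx).comp ((chartAt Plane x).continuousAt (mem_chart_source Plane x))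
  refine h1.congr ?_
  filter_upwards [(chartAt Plane x).open_source.mem_nhds (mem_chart_source Plane x)] with z hz
  rw [(chartAt Plane x).left_inv hz]

theorem continuousAt_coordInner {k : ℕ} (hg : IsRiem S g)
    (he : e ∈ IsManifold.maximalAtlas (𝓡 2) 2 M) {u v : TensorField M k} {y : Plane}
    (hy : y ∈ chartDom e S) (hu : IsCr 0 S u) (hv : IsCr 0 S v) :
    ContinuousAt (fun z => coordInner e g u v z) y := by
  refine tendsto_finsetSum _ fun I _ => tendsto_finsetSum _ fun J _ => ?_
  refine Tendsto.mul (Tendsto.mul ?_ ?_) ?_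
  · exact tendsto_finsetProd _ fun a _ => (contDiffAt_gramInv hg he hy _ _).continuousAt
  · exact (contDiffAt_comp (by norm_num) hg.isOpen hu he hy I).continuousAt
  · exact (contDiffAt_comp (by norm_num) hg.isOpen hv he hy J).continuousAt

theorem continuousOn_tensorInner {k : ℕ} (hg : IsRiem S g) {u v : TensorField M k}
    (hu : IsCr 0 S u) (hv : IsCr 0 S v) : ContinuousOn (tensorInner g u v) S := by
  refine continuousOn_of_charts fun x hx => ?_
  have he := chartAt_mem_maximalAtlas x
  have hy := chartAt_mem_chartDom hx
  refine (continuousAt_coordInner hg he hy hu hv).congr ?_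
  filter_upwards [(isOpen_chartDom hg.isOpen).mem_nhds hy] with z hz
  exact (tensorInner_symm_apply he hz.1 g u v).symm

theorem continuousOn_val {w : TensorField M 0} (hS : IsOpen S) (hw : IsCr 0 S w) :
    ContinuousOn (val w) S := by
  refine continuousOn_of_charts fun x hx => ?_
  have h := (contDiffAt_comp (by norm_num) hS hw (chartAt_mem_maximalAtlas x)
    (chartAt_mem_chartDom hx) ![]).continuousAt
  simpa only [comp_zero_eq_val] using h

end Continuity

/-! ### The divergence theorem for fields with compact support in S. -/

section Stokes

variable {M : Type*} [TopologicalSpace M] [ChartedSpace Plane M] [IsManifold (𝓡 2) 2 M]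
variable [MeasurableSpace M] [BorelSpace M] [CompactSpace M] [T2Space M]
variable {e e' : OpenPartialHomeomorph M Plane} {S : Set M} {g : TensorField M 2}

theorem areaMeasure_lt_top_of_isCompact (hg : IsRiem S g) {K : Set M} (hK : IsCompact K)
    (hKS : K ⊆ S) : areaMeasure g S K < ⊤ := by
  refine hK.measure_lt_top_of_nhdsWithin fun x hx => ?_
  set e := chartAt Plane x
  have he : e ∈ IsManifold.maximalAtlas (𝓡 2) 2 M := chartAt_mem_maximalAtlas x
  have hy : e x ∈ chartDom e S := chartAt_mem_chartDom (hKS hx)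
  obtain ⟨ε, hε, hball⟩ := Metric.nhds_basis_closedBall.mem_iff.1
    ((isOpen_chartDom hg.isOpen).mem_nhds hy)
  set N : Set M := e.source ∩ e ⁻¹' Metric.ball (e x) ε
  have hNo : IsOpen N := e.isOpen_inter_preimage Metric.isOpen_ball
  refine ⟨N, mem_nhdsWithin_of_mem_nhds (hNo.mem_nhds
    ⟨mem_chart_source Plane x, Metric.mem_ball_self hε⟩), ?_⟩
  have h1 : areaMeasure g S N = chartVolume g S e N := by
    rw [← areaMeasure_restrict_source hg.isOpen he, Measure.restrict_apply hNo.measurableSet,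
      inter_eq_left.2 inter_subset_left]
  rw [h1, chartVolume_apply hg.isOpen hNo.measurableSet]
  obtain ⟨C, hC⟩ := (isCompact_closedBall (e x) ε).exists_bound_of_continuousOn
    ((continuousOn_density hg he).mono hball)
  have hsub : chartDom e S ∩ e.symm ⁻¹' N ⊆ Metric.closedBall (e x) ε := by
    rintro z ⟨hz, hz2⟩
    have h3 : e (e.symm z) ∈ Metric.ball (e x) ε := hz2.2
    rw [e.right_inv hz.1] at h3
    exact Metric.ball_subset_closedBall h3
  calc _ ≤ ∫⁻ y in Metric.closedBall (e x) ε, ENNReal.ofReal (density e g y) :=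
        lintegral_mono_set hsub
    _ ≤ ∫⁻ y in Metric.closedBall (e x) ε, ENNReal.ofReal C := by
        refine setLIntegral_mono measurable_const fun y hy => ?_
        exact ENNReal.ofReal_le_ofReal ((le_abs_self _).trans (hC y hy))
    _ < ⊤ := by
        rw [setLIntegral_const]
        exact ENNReal.mul_lt_top ENNReal.ofReal_lt_top measure_closedBall_lt_top

theorem aemeasurable_of_continuousOn (hS : IsOpen S) {F : M → ℝ} (hF : ContinuousOn F S) :
    AEMeasurable F (areaMeasure g S) :=
  aemeasurable_areaMeasure hS fun _ _ =>
    (hF.comp (OpenPartialHomeomorph.continuousOn_symm _ |>.mono inter_subset_left)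
      (fun _ hy => hy.2)).aemeasurable (measurableSet_chartDom hS)

theorem integrable_of_compact (hg : IsRiem S g) {F : M → ℝ} (hF : ContinuousOn F S) {K : Set M}
    (hK : IsCompact K) (hKS : K ⊆ S) (h0 : ∀ x ∈ S, x ∉ K → F x = 0) :
    Integrable F (areaMeasure g S) := by
  obtain ⟨C, hC⟩ := hK.exists_bound_of_continuousOn (hF.mono hKS)
  have h1 : IntegrableOn F K (areaMeasure g S) :=
    Measure.integrableOn_of_bounded (areaMeasure_lt_top_of_isCompact hg hK hKS).ne
      (aemeasurable_of_continuousOn hg.isOpen hF).aestronglyMeasurable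
      (M := C) (by filter_upwards [ae_restrict_mem hK.measurableSet] with x hx using hC x hx)
  rw [← integrable_indicator_iff hK.measurableSet] at h1
  refine h1.congr ?_
  filter_upwards [ae_mem hg.isOpen] with x hx
  by_cases hxK : x ∈ K
  · rw [indicator_of_mem hxK]
  · rw [indicator_of_notMem hxK, h0 x hx hxK]

theorem integral_pderiv_eq_zero {V : Plane → ℝ} (hV : ContDiff ℝ 1 V) (hc : HasCompactSupport V)
    (i : Fin 2) : ∫ y, pderiv i V y = 0 := by
  have hd : Continuous (fun y => fderiv ℝ V y (stdVec i)) :=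
    (hV.continuous_fderiv (by norm_num)).clm_apply continuous_const
  have hc' : HasCompactSupport (fun y => fderiv ℝ V y (stdVec i)) :=
    hc.fderiv_apply (𝕜 := ℝ) (stdVec i)
  have h := integral_mul_fderiv_eq_neg_fderiv_mul_of_integrable (μ := (volume : Measure Plane))
    (f := fun _ => (1 : ℝ)) (g := V) (v := stdVec i) (by simp)
    (by simpa using hd.integrable_of_hasCompactSupport hc')
    (by simpa using hV.continuous.integrable_of_hasCompactSupport hc)
    (fun _ _ => differentiableAt_const _)
    (fun x _ => hV.differentiable (by norm_num) x)
  simpa [pderiv] using h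

/-- `V` is C¹ only on the open set `D`, but its support there is contained in the compact set `K`.
Extended by zero it is C¹ with compact support on the whole plane. -/
theorem integral_pderiv_chart {D K : Set Plane} (hD : IsOpen D) (hK : IsCompact K) (hKD : K ⊆ D)
    {V : Plane → ℝ} (hV : ∀ y ∈ D, ContDiffAt ℝ 1 V y) (h0 : ∀ y ∈ D, y ∉ K → V y = 0)
    (i : Fin 2) : IntegrableOn (pderiv i V) D ∧ ∫ y in D, pderiv i V y = 0 := by
  set W := D.indicator V with hW
  have hWD : ∀ y ∈ D, W =ᶠ[𝓝 y] V := fun y hy => by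
    filter_upwards [hD.mem_nhds hy] with z hz using indicator_of_mem hz V
  have hWK : ∀ y ∉ K, W y = 0 := by
    intro y hy
    by_cases hyD : y ∈ D
    · rw [hW, indicator_of_mem hyD, h0 y hyD hy]
    · exact indicator_of_notMem hyD V
  have hW0 : ∀ y ∉ D, W =ᶠ[𝓝 y] 0 := fun y hy => by
    filter_upwards [hK.isClosed.isOpen_compl.mem_nhds (fun h => hy (hKD h))] with z hz
      using hWK z hz
  have hWc : ContDiff ℝ 1 W := by
    rw [contDiff_iff_contDiffAt]
    intro y
    by_cases hy : y ∈ D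
    · exact (hV y hy).congr_of_eventuallyEq (hWD y hy)
    · exact (contDiffAt_const (c := (0 : ℝ))).congr_of_eventuallyEq (hW0 y hy)
  have hWs : HasCompactSupport W := HasCompactSupport.intro hK hWK
  have h1 := integral_pderiv_eq_zero hWc hWs i
  have h2 : ∀ y, y ∉ D → pderiv i W y = 0 := by
    intro y hy
    rw [pderiv_congr (hW0 y hy)]
    simp [pderiv]
  have h3 : ∀ y ∈ D, pderiv i W y = pderiv i V y := fun y hy => pderiv_congr (hWD y hy) i
  have hd : Continuous (pderiv i W) :=
    (hWc.continuous_fderiv (by norm_num)).clm_apply continuous_const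
  have hc' : HasCompactSupport (pderiv i W) := hWs.fderiv_apply (𝕜 := ℝ) (stdVec i)
  constructor
  · exact (hd.integrable_of_hasCompactSupport hc').integrableOn.congr_fun h3 hD.measurableSet
  · rw [← setIntegral_congr_fun hD.measurableSet h3,
      setIntegral_eq_integral_of_forall_compl_eq_zero h2, h1]

theorem eventually_comp_eq_zero {k : ℕ} (hS : IsOpen S) {K : Set M} (hK : IsCompact K)
    {u : TensorField M k} (h0 : ∀ x ∈ S, x ∉ K → u x = 0) {y : Plane} (hy : y ∈ chartDom e S)
    (hyK : e.symm y ∉ K) : ∀ᶠ z in 𝓝 y, z ∈ chartDom e S ∧ ∀ I, comp e u z I = 0 := by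
  have h1 : e.target ∩ e.symm ⁻¹' (S ∩ Kᶜ) ∈ 𝓝 y :=
    (e.isOpen_inter_preimage_symm (hS.inter hK.isClosed.isOpen_compl)).mem_nhds
      ⟨hy.1, hy.2, hyK⟩
  filter_upwards [h1] with z hz
  refine ⟨⟨hz.1, hz.2.1⟩, fun I => ?_⟩
  simp only [comp, h0 _ hz.2.1 hz.2.2]
  rfl

theorem cov1_eq_zero (hS : IsOpen S) {K : Set M} (hK : IsCompact K)
    {u : TensorField M 1} (h0 : ∀ x ∈ S, x ∉ K → u x = 0) {y : Plane} (hy : y ∈ chartDom e S)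
    (hyK : e.symm y ∉ K) (i j : Fin 2) : cov1 e g u y i j = 0 := by
  have h1 := eventually_comp_eq_zero hS hK h0 hy hyK
  have h2 : (fun z => comp e u z ![j]) =ᶠ[𝓝 y] fun _ => 0 := by
    filter_upwards [h1] with z hz using hz.2 _
  rw [cov1, pderiv_congr h2]
  simp [h1.self_of_nhds.2, pderiv]

theorem val_divergence_eq_zero (hg : IsRiem S g) {K : Set M} (hK : IsCompact K)
    {γ : TensorField M 1} (hγ : IsCr 1 S γ) (h0 : ∀ x ∈ S, x ∉ K → γ x = 0) {x : M} (hx : x ∈ S)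
    (hxK : x ∉ K) : val (divergence g γ) x = 0 := by
  have h := val_divergence hg (chartAt_mem_maximalAtlas x) hγ (chartAt_mem_chartDom hx)
  rw [chartAt_symm_apply] at h
  rw [h]
  simp [cov1_eq_zero hg.isOpen hK h0 (chartAt_mem_chartDom hx)
    (by rwa [chartAt_symm_apply])]

theorem integral_divergence_chart (hg : IsRiem S g) (he : e ∈ IsManifold.maximalAtlas (𝓡 2) 2 M)
    {γ : TensorField M 1} (hγ : IsCr 1 S γ) {K : Set M} (hK : IsCompact K) (hKS : K ⊆ S)
    (hKe : K ⊆ e.source) (h0 : ∀ x ∈ S, x ∉ K → γ x = 0) :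
    ∫ x, val (divergence g γ) x ∂areaMeasure g S = 0 := by
  have hc := continuousOn_val hg.isOpen (isCr_zero_divergence_one hg hγ)
  rw [integral_eq_chart hg he (aemeasurable_of_continuousOn hg.isOpen hc)
    (fun x hx hxe => val_divergence_eq_zero hg hK hγ h0 hx (fun h => hxe (hKe h)))]
  have hK' : IsCompact (e '' K) := hK.image_of_continuousOn (e.continuousOn.mono hKe)
  have hKD : e '' K ⊆ chartDom e S := by
    rintro _ ⟨x, hx, rfl⟩
    exact mem_chartDom_of_mem (hKS hx) (hKe hx)
  have h1 : ∀ i, ∀ y ∈ chartDom e S,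
      ContDiffAt ℝ 1 (fun z => Real.sqrt (gram e g z).det * up e g γ z i) y := fun i y hy =>
    ((contDiffAt_det_gram hg he hy).sqrt (det_gram_pos hg he hy).ne').mul
      (contDiffAt_up hg he hγ hy i)
  have h2 : ∀ i, ∀ y ∈ chartDom e S, y ∉ e '' K →
      Real.sqrt (gram e g y).det * up e g γ y i = 0 := by
    intro i y hy hyK
    have : e.symm y ∉ K := fun h => hyK ⟨_, h, e.right_inv hy.1⟩
    have h3 := (eventually_comp_eq_zero hg.isOpen hK h0 hy this).self_of_nhds.2
    simp [up, h3]
  have h3 := fun i => integral_pderiv_chart (isOpen_chartDom hg.isOpen) hK' hKD (h1 i) (h2 i) i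
  have h4 : ∀ y ∈ chartDom e S, density e g y * val (divergence g γ) (e.symm y) =
      -∑ i, pderiv i (fun z => Real.sqrt (gram e g z).det * up e g γ z i) y := fun y hy =>
    val_divergence_mul_sqrt hg he hγ hy
  rw [setIntegral_congr_fun (measurableSet_chartDom hg.isOpen) h4, integral_neg,
    integral_finsetSum _ fun i _ => (h3 i).1]
  simp [(h3 _).2]

variable [IsManifold (𝓡 2) ∞ M]

/-- The divergence theorem. -/
theorem integral_divergence (hg : IsRiem S g)
    {γ : TensorField M 1} (hγ : IsCr 1 S γ) {K : Set M} (hK : IsCompact K) (hKS : K ⊆ S)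
    (h0 : ∀ x ∈ S, x ∉ K → γ x = 0) :
    ∫ x, val (divergence g γ) x ∂areaMeasure g S = 0 := by
  obtain ⟨t, ht⟩ := exists_finset_iUnion_source M
  -- A partition of unity on K reduces the statement to fields supported in one chart.
  obtain ⟨f, hf⟩ := SmoothPartitionOfUnity.exists_isSubordinate (𝓡 2) hK.isClosed
    (fun x : t => (chartAt Plane (x : M)).source) (fun x => (chartAt Plane (x : M)).open_source)
    (by rw [ht]; exact subset_univ _)
  have hfC : ∀ a, IsCr 1 S (ofFun (f a)) := by
    intro a e he I
    have h1 : ContMDiffOn (𝓡 2) 𝓘(ℝ) 1 (f a ∘ e.symm) e.target :=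
      (((f a).contMDiff.of_le (by simp)).contMDiffOn (s := univ)).comp
        ((contMDiffOn_symm_of_mem_maximalAtlas (mem_maximalAtlas he)).of_le (by norm_num))
        (fun _ _ => mem_univ _)
    exact (contMDiffOn_iff_contDiffOn.1 h1).mono inter_subset_left
  have hγa : ∀ a, IsCr 1 S (fun x => f a x • γ x) := fun a => isCr_smul (hfC a) hγ
  have hKa : ∀ a, IsCompact (K ∩ tsupport (f a)) := fun a =>
    hK.inter_right (isClosed_tsupport _)
  have h0a : ∀ a, ∀ x ∈ S, x ∉ K ∩ tsupport (f a) → f a x • γ x = 0 := by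
    intro a x hx hxK
    by_cases hx2 : x ∈ K
    · rw [image_eq_zero_of_notMem_tsupport (fun h => hxK ⟨hx2, h⟩), zero_smul]
    · rw [h0 x hx hx2, smul_zero]
  -- On K the functions sum to 1, and off K the field vanishes, so the decomposition holds on all of
  -- S and may be differentiated at every point.
  have hsum : ∀ x ∈ S, γ x = ∑ a, f a x • γ x := by
    intro x hx
    by_cases hxK : x ∈ K
    · rw [← Finset.sum_smul, ← finsum_eq_sum_of_fintype, f.sum_eq_one hxK, one_smul]
    · simp [h0 x hx hxK]
  have hval : ∀ x ∈ S, val (divergence g γ) x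
      = ∑ a, val (divergence g (fun x => f a x • γ x)) x := by
    intro x hx
    have he := chartAt_mem_maximalAtlas x
    have hy := chartAt_mem_chartDom hx
    set e := chartAt Plane x
    have hv := fun (β : TensorField M 1) (hβ : IsCr 1 S β) => val_divergence hg he hβ hy
    rw [chartAt_symm_apply] at hv
    rw [hv γ hγ]
    simp only [fun a => hv _ (hγa a)]
    have hcomp : ∀ j, ∀ z ∈ chartDom e S,
        comp e γ z ![j] = ∑ a, comp e (fun x => f a x • γ x) z ![j] := by
      intro j z hz
      simp only [comp_smul, Pi.smul_apply, ← Finset.sum_smul]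
      have h5 : comp e γ z ![j] = (∑ a, f a (e.symm z) • γ (e.symm z))
          (fun b => mfderiv (𝓡 2) (𝓡 2) e.symm z (stdVec (![j] b))) := by
        rw [← hsum _ hz.2]; rfl
      refine h5.trans ?_
      rw [← Finset.sum_smul]
      rfl
    have hcov : ∀ i j, cov1 e g γ (e x) i j
        = ∑ a, cov1 e g (fun x => f a x • γ x) (e x) i j := by
      intro i j
      have h6 : (fun z => comp e γ z ![j]) =ᶠ[𝓝 (e x)]
          fun z => ∑ a, comp e (fun x => f a x • γ x) z ![j] := by
        filter_upwards [(isOpen_chartDom hg.isOpen).mem_nhds hy] with z hz using hcomp j z hz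
      simp only [cov1]
      rw [pderiv_congr h6, pderiv_sum _ fun a _ => differentiableAt_comp hg.isOpen (hγa a) he hy _]
      simp only [hcomp _ _ hy, Finset.sum_sub_distrib, Finset.mul_sum]
      congr 1
      exact Finset.sum_comm
    simp only [hcov, Finset.mul_sum, ← Finset.sum_neg_distrib]
    simp only [Fin.sum_univ_two, Finset.sum_add_distrib]
  have hint : ∀ a, Integrable (fun x => val (divergence g (fun x => f a x • γ x)) x)
      (areaMeasure g S) := fun a =>
    integrable_of_compact hg (continuousOn_val hg.isOpen (isCr_zero_divergence_one hg (hγa a)))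
      (hKa a) (inter_subset_left.trans hKS)
      (fun x hx hxK => val_divergence_eq_zero hg (hKa a) (hγa a) (h0a a) hx hxK)
  have h7 : ∫ x, val (divergence g γ) x ∂areaMeasure g S
      = ∫ x, ∑ a, val (divergence g (fun x => f a x • γ x)) x ∂areaMeasure g S := by
    refine integral_congr_ae ?_
    filter_upwards [ae_mem hg.isOpen] with x hx using hval x hx
  rw [h7, integral_finsetSum _ fun a _ => hint a]
  refine Finset.sum_eq_zero fun a _ => ?_
  exact integral_divergence_chart hg (chartAt_mem_maximalAtlas (a : M)) (hγa a) (hKa a)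
    (inter_subset_left.trans hKS) (inter_subset_right.trans (hf a)) (h0a a)

end Stokes

/-! ### The L² scalar product, and integration by parts with compact support. -/

section SquareIntegrable

variable {M : Type*} [TopologicalSpace M] [ChartedSpace Plane M] [IsManifold (𝓡 2) 2 M]
variable [MeasurableSpace M] [BorelSpace M] [CompactSpace M] [T2Space M]
variable {e e' : OpenPartialHomeomorph M Plane} {S : Set M} {g : TensorField M 2}

/-- The components of the tensor field `u` in the charts of the atlas are measurable on `S`. -/
def IsMeas {k : ℕ} (S : Set M) (u : TensorField M k) : Prop :=
  ∀ e ∈ atlas Plane M, ∀ I : Fin k → Fin 2,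
    AEMeasurable (fun y => comp e u y I) ((volume : Measure Plane).restrict (chartDom e S))

theorem IsL2Symm.isMeas {k : ℕ} {u : TensorField M k} (h : IsL2Symm g S u) : IsMeas S u := h.1

theorem isMeas_of_isCr {k : ℕ} (hS : IsOpen S) {u : TensorField M k} (h : IsCr 0 S u) :
    IsMeas S u := fun e he I =>
  (h e he I).continuousOn.aemeasurable (measurableSet_chartDom hS)

theorem IsMeas.sub {k : ℕ} {u v : TensorField M k} (hu : IsMeas S u) (hv : IsMeas S v) :
    IsMeas S (u - v) := fun e he I => (hu e he I).sub (hv e he I)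

theorem aemeasurable_coordInner {k : ℕ} (hg : IsRiem S g) (he : e ∈ atlas Plane M)
    {u v : TensorField M k} (hu : IsMeas S u) (hv : IsMeas S v) :
    AEMeasurable (fun y => coordInner e g u v y)
      ((volume : Measure Plane).restrict (chartDom e S)) := by
  have hG : ∀ i j, AEMeasurable (fun y => gramInv e g y i j)
      ((volume : Measure Plane).restrict (chartDom e S)) := fun i j =>
    ContinuousOn.aemeasurable (fun y hy => (contDiffAt_gramInv hg (mem_maximalAtlas he) hy i j)
      |>.continuousAt.continuousWithinAt) (measurableSet_chartDom hg.isOpen)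
  refine Finset.aemeasurable_fun_sum _ fun I _ => Finset.aemeasurable_fun_sum _ fun J _ => ?_
  exact ((Finset.aemeasurable_fun_prod _ fun a _ => hG _ _).mul (hu e he I)).mul (hv e he J)

theorem aemeasurable_tensorInner {k : ℕ} (hg : IsRiem S g) {u v : TensorField M k}
    (hu : IsMeas S u) (hv : IsMeas S v) :
    AEMeasurable (tensorInner g u v) (areaMeasure g S) := by
  refine aemeasurable_areaMeasure hg.isOpen fun e he => ?_
  refine (aemeasurable_coordInner hg he hu hv).congr ?_
  filter_upwards [ae_restrict_mem (measurableSet_chartDom hg.isOpen)] with y hy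
  exact (tensorInner_symm_apply (mem_maximalAtlas he) hy.1 g u v).symm

/-- The Cauchy–Schwarz inequality for the `L²` scalar product. -/
theorem lintegral_enorm_tensorInner_le {k : ℕ} (hg : IsRiem S g) {u v : TensorField M k}
    (hu : IsMeas S u) (hv : IsMeas S v) :
    ∫⁻ x, ‖tensorInner g u v x‖ₑ ∂areaMeasure g S
      ≤ normSq g S u ^ (1 / 2 : ℝ) * normSq g S v ^ (1 / 2 : ℝ) := by
  have hm : ∀ {w : TensorField M k}, IsMeas S w →
      AEMeasurable (fun x => ENNReal.ofReal (Real.sqrt (tensorInner g w w x)))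
        (areaMeasure g S) := fun hw =>
    ((aemeasurable_tensorInner hg hw hw).sqrt).ennreal_ofReal
  have hs : ∀ w : TensorField M k, ∫⁻ x, ENNReal.ofReal (Real.sqrt (tensorInner g w w x)) ^ (2 : ℝ)
      ∂areaMeasure g S = normSq g S w := by
    intro w
    refine lintegral_congr_ae ?_
    filter_upwards [ae_mem hg.isOpen] with x hx
    rw [ENNReal.ofReal_rpow_of_nonneg (Real.sqrt_nonneg _) (by norm_num), Real.rpow_two,
      Real.sq_sqrt (tensorInner_self_nonneg hg hx w)]
  have h := ENNReal.lintegral_mul_le_Lp_mul_Lq (areaMeasure g S) Real.HolderConjugate.two_two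
    (hm hu) (hm hv)
  rw [hs, hs] at h
  refine le_trans (lintegral_mono_ae ?_) h
  filter_upwards [ae_mem hg.isOpen] with x hx
  rw [Pi.mul_apply, ← ENNReal.ofReal_mul (Real.sqrt_nonneg _), Real.enorm_eq_ofReal_abs]
  exact ENNReal.ofReal_le_ofReal (abs_tensorInner_le hg hx u v)

theorem integrable_tensorInner {k : ℕ} (hg : IsRiem S g) {u v : TensorField M k}
    (hu : IsMeas S u) (hv : IsMeas S v) (hu2 : normSq g S u < ⊤) (hv2 : normSq g S v < ⊤) :
    Integrable (tensorInner g u v) (areaMeasure g S) := by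
  refine ⟨(aemeasurable_tensorInner hg hu hv).aestronglyMeasurable, ?_⟩
  exact (lintegral_enorm_tensorInner_le hg hu hv).trans_lt
    (ENNReal.mul_lt_top (ENNReal.rpow_lt_top_of_nonneg (by norm_num) hu2.ne)
      (ENNReal.rpow_lt_top_of_nonneg (by norm_num) hv2.ne))

theorem normSq_congr {k : ℕ} {u v : TensorField M k}
    (h : ∀ᵐ x ∂areaMeasure g S, u x = v x) : normSq g S u = normSq g S v := by
  refine lintegral_congr_ae ?_
  filter_upwards [h] with x hx
  rw [tensorInner_congr g hx hx]

/-- Continuity of the `L²` scalar product. -/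
theorem tendsto_l2Inner {k : ℕ} (hg : IsRiem S g) {H : ℕ → TensorField M k} {h u : TensorField M k}
    (hH : ∀ m, IsMeas S (H m)) (hh : IsMeas S h) (hu : IsMeas S u)
    (hHu : ∀ m, Integrable (tensorInner g (H m) u) (areaMeasure g S))
    (hh2 : normSq g S h < ⊤) (hu2 : normSq g S u < ⊤)
    (hlim : Tendsto (fun m => normSq g S (H m - h)) atTop (𝓝 0)) :
    Tendsto (fun m => l2Inner g S (H m) u) atTop (𝓝 (l2Inner g S h u)) := by
  have h1 := integrable_tensorInner hg hh hu hh2 hu2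
  refine tendsto_integral_of_L1 _ h1.1 (Eventually.of_forall hHu) ?_
  have h2 : ∀ m, ∫⁻ x, ‖tensorInner g (H m) u x - tensorInner g h u x‖ₑ ∂areaMeasure g S ≤
      normSq g S (H m - h) ^ (1 / 2 : ℝ) * normSq g S u ^ (1 / 2 : ℝ) := by
    intro m
    refine le_trans (le_of_eq ?_) (lintegral_enorm_tensorInner_le hg ((hH m).sub hh) hu)
    simp only [tensorInner_sub_left]
  have h3 : Tendsto (fun m => normSq g S (H m - h) ^ (1 / 2 : ℝ) * normSq g S u ^ (1 / 2 : ℝ))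
      atTop (𝓝 0) := by
    have h4 : Tendsto (fun m => normSq g S (H m - h) ^ (1 / 2 : ℝ)) atTop (𝓝 0) := by
      have := hlim.ennrpow_const (1 / 2 : ℝ)
      simpa using this
    have := ENNReal.Tendsto.mul_const (b := normSq g S u ^ (1 / 2 : ℝ)) h4
      (Or.inr (ENNReal.rpow_lt_top_of_nonneg (by norm_num) hu2.ne).ne)
    simpa using this
  exact tendsto_of_tendsto_of_tendsto_of_le_of_le tendsto_const_nhds h3
    (fun _ => zero_le) h2

/-! ### Integration by parts with compact support -/

theorem tensorInner_zero_left {k : ℕ} {u v : TensorField M k} {x : M} (h : u x = 0) :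
    tensorInner g u v x = 0 := by
  have h1 := tensorInner_congr g (u := u) (u' := 0) (v := v) (v' := v) (x := x) h rfl
  rw [h1]
  have h2 := tensorInner_sub_left g (0 : TensorField M k) 0 v x
  simpa using h2

theorem tensorInner_zero_right {k : ℕ} {u v : TensorField M k} {x : M} (h : v x = 0) :
    tensorInner g u v x = 0 := by
  have h1 := tensorInner_congr g (u := u) (u' := u) (v := v) (v' := 0) (x := x) rfl h
  rw [h1]
  have h2 := tensorInner_sub_right g (0 : TensorField M k) 0 u x
  simpa using h2

theorem eq_zero_of_comp {k : ℕ} {u : TensorField M k} {x : M}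
    (h : ∀ I, comp (chartAt Plane x) u (chartAt Plane x x) I = 0) : u x = 0 :=
  eq_of_comp_eq (v := 0) (chartAt_mem_maximalAtlas x) (mem_chart_source Plane x)
    (funext fun I => h I)

theorem eventually_zero {k : ℕ} (hS : IsOpen S) {K : Set M} (hK : IsCompact K)
    {u : TensorField M k} (h0 : ∀ x ∈ S, x ∉ K → u x = 0) {x : M} (hx : x ∈ S) (hxK : x ∉ K)
    (I : Fin k → Fin 2) :
    (fun z => comp (chartAt Plane x) u z I) =ᶠ[𝓝 (chartAt Plane x x)] fun _ => 0 := by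
  filter_upwards [eventually_comp_eq_zero hS hK h0 (chartAt_mem_chartDom hx)
    (by rwa [chartAt_symm_apply])] with z hz using hz.2 I

theorem divergence_one_eq_zero (hg : IsRiem S g) {K : Set M} (hK : IsCompact K)
    {β : TensorField M 1} (hβ : IsCr 1 S β) (h0 : ∀ x ∈ S, x ∉ K → β x = 0)
    {x : M} (hx : x ∈ S) (hxK : x ∉ K) : divergence g β x = 0 := by
  refine eq_zero_of_comp fun I => ?_
  rw [comp_zero_eq_val, chartAt_symm_apply, val_divergence_eq_zero hg hK hβ h0 hx hxK]

theorem divergence_two_eq_zero (hg : IsRiem S g) {K : Set M} (hK : IsCompact K)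
    {h : TensorField M 2} (hh : IsCr 1 S h) (h0 : ∀ x ∈ S, x ∉ K → h x = 0)
    {x : M} (hx : x ∈ S) (hxK : x ∉ K) : divergence g h x = 0 := by
  refine eq_zero_of_comp fun I => ?_
  have h1 := eventually_zero hg.isOpen hK h0 hx hxK
  have h2 : ∀ i j k, cov2 (chartAt Plane x) g h (chartAt Plane x x) i j k = 0 := by
    intro i j k
    have h3 : ∀ a b, gram (chartAt Plane x) h (chartAt Plane x x) a b = 0 := fun a b =>
      (h1 ![a, b]).self_of_nhds
    have h4 : pderiv i (fun z => gram (chartAt Plane x) h z j k) (chartAt Plane x x) = 0 := by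
      refine (pderiv_congr (h1 ![j, k]) i).trans ?_
      simp [pderiv]
    simp [cov2, h3, h4]
  rw [fin_one_eq I, comp_divergence_two hg (chartAt_mem_maximalAtlas x)
    (chartAt_mem_chartDom hx) hh]
  simp [h2]

theorem symCovDeriv_one_eq_zero (hg : IsRiem S g) {K : Set M} (hK : IsCompact K)
    {u : TensorField M 1} (hu : IsCr 1 S u) (h0 : ∀ x ∈ S, x ∉ K → u x = 0)
    {x : M} (hx : x ∈ S) (hxK : x ∉ K) : symCovDeriv g u x = 0 := by
  refine eq_zero_of_comp fun I => ?_
  rw [fin_two_eq I]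
  refine (gram_symCovDeriv hg (chartAt_mem_maximalAtlas x)
    (chartAt_mem_chartDom hx) hu (I 0) (I 1)).trans ?_
  rw [cov1_eq_zero hg.isOpen hK h0 (chartAt_mem_chartDom hx) (by rwa [chartAt_symm_apply]),
    cov1_eq_zero hg.isOpen hK h0 (chartAt_mem_chartDom hx) (by rwa [chartAt_symm_apply])]
  simp

theorem contract_eq_zero {h : TensorField M 2} {u : TensorField M 1} {x : M}
    (h0 : h x = 0 ∨ u x = 0) : contract g h u x = 0 := by
  refine eq_zero_of_comp fun I => ?_
  rw [fin_one_eq I, comp_contract (chartAt_mem_maximalAtlas x) (mem_chart_target Plane x)]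
  rcases h0 with h0 | h0
  · have h1 : ∀ a b, gram (chartAt Plane x) h (chartAt Plane x x) a b = 0 := by
      intro a b
      have := congrFun (comp_congr_point (e := chartAt Plane x) (y := chartAt Plane x x) (u := h)
        (v := 0) (by rw [chartAt_symm_apply]; exact h0)) ![a, b]
      exact this
    simp [h1]
  · have h1 : ∀ a, comp (chartAt Plane x) u (chartAt Plane x x) ![a] = 0 := by
      intro a
      have := congrFun (comp_congr_point (e := chartAt Plane x) (y := chartAt Plane x x) (u := u)
        (v := 0) (by rw [chartAt_symm_apply]; exact h0)) ![a]
      exact this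
    simp [up, h1]

variable [IsManifold (𝓡 2) ∞ M]

/-- Green's formula for symmetric `2`-tensors and `1`-forms, one of which has compact support. -/
theorem l2Inner_divergence_two (hg : IsRiem S g) {h : TensorField M 2} {u : TensorField M 1}
    (hh : IsC1Symm S h) (hu : IsCr 1 S u) {K : Set M} (hK : IsCompact K) (hKS : K ⊆ S)
    (h0 : (∀ x ∈ S, x ∉ K → h x = 0) ∨ (∀ x ∈ S, x ∉ K → u x = 0)) :
    l2Inner g S (divergence g h) u = l2Inner g S h (symCovDeriv g u) := by
  have hu0 : IsCr 0 S u := hu.of_le (by norm_num)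
  have hh0 : IsCr 0 S h := hh.1.of_le (by norm_num)
  have h1 := integral_divergence hg (isCr_contract hg hh.1 hu) hK hKS (by
    intro x hx hxK
    exact contract_eq_zero (h0.imp (fun h => h x hx hxK) (fun h => h x hx hxK)))
  have i1 : Integrable (tensorInner g (divergence g h) u) (areaMeasure g S) := by
    refine integrable_of_compact hg (continuousOn_tensorInner hg
      (isCr_zero_divergence_two hg hh.1) hu0) hK hKS fun x hx hxK => ?_
    rcases h0 with h0 | h0
    · exact tensorInner_zero_left (divergence_two_eq_zero hg hK hh.1 h0 hx hxK)
    · exact tensorInner_zero_right (h0 x hx hxK)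
  have i2 : Integrable (tensorInner g h (symCovDeriv g u)) (areaMeasure g S) := by
    refine integrable_of_compact hg (continuousOn_tensorInner hg hh0
      (isCr_zero_symCovDeriv_one hg hu)) hK hKS fun x hx hxK => ?_
    rcases h0 with h0 | h0
    · exact tensorInner_zero_left (h0 x hx hxK)
    · exact tensorInner_zero_right (symCovDeriv_one_eq_zero hg hK hu h0 hx hxK)
  have h2 : ∫ x, val (divergence g (contract g h u)) x ∂areaMeasure g S
      = ∫ x, (tensorInner g (divergence g h) u x - tensorInner g h (symCovDeriv g u) x)
        ∂areaMeasure g S := by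
    refine integral_congr_ae ?_
    filter_upwards [ae_mem hg.isOpen] with x hx using val_divergence_contract hg hh hu hx
  rw [h1, integral_sub i1 i2] at h2
  exact (sub_eq_zero.1 h2.symm)

/-- Green's formula for `1`-forms and functions, one of which has compact support. -/
theorem l2Inner_divergence_one (hg : IsRiem S g) {β : TensorField M 1} {f : M → ℝ}
    (hβ : IsCr 1 S β) (hf : IsCr 1 S (ofFun f)) {K : Set M} (hK : IsCompact K) (hKS : K ⊆ S)
    (h0 : ∀ x ∈ S, x ∉ K → β x = 0) :
    l2Inner g S (divergence g β) (ofFun f) = l2Inner g S β (symCovDeriv g (ofFun f)) := by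
  have hf0 : IsCr 0 S (ofFun f) := hf.of_le (by norm_num)
  have hβ0 : IsCr 0 S β := hβ.of_le (by norm_num)
  have h1 := integral_divergence hg (isCr_smul hf hβ) hK hKS (by
    intro x hx hxK
    rw [h0 x hx hxK, smul_zero])
  have i1 : Integrable (tensorInner g (divergence g β) (ofFun f)) (areaMeasure g S) := by
    refine integrable_of_compact hg (continuousOn_tensorInner hg
      (isCr_zero_divergence_one hg hβ) hf0) hK hKS fun x hx hxK => ?_
    exact tensorInner_zero_left (divergence_one_eq_zero hg hK hβ h0 hx hxK)
  have i2 : Integrable (tensorInner g β (symCovDeriv g (ofFun f))) (areaMeasure g S) := by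
    refine integrable_of_compact hg (continuousOn_tensorInner hg hβ0
      (isCr_zero_symCovDeriv_zero hg hf)) hK hKS fun x hx hxK => ?_
    exact tensorInner_zero_left (h0 x hx hxK)
  have h2 : ∫ x, val (divergence g (fun x => f x • β x)) x ∂areaMeasure g S
      = ∫ x, (tensorInner g (divergence g β) (ofFun f) x
        - tensorInner g β (symCovDeriv g (ofFun f)) x) ∂areaMeasure g S := by
    refine integral_congr_ae ?_
    filter_upwards [ae_mem hg.isOpen] with x hx
    rw [val_divergence_smul hg hf hβ hx, tensorInner_val, val_ofFun, tensorInner_comm hg hx β,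
      mul_comm]
  rw [h1, integral_sub i1 i2] at h2
  exact (sub_eq_zero.1 h2.symm)

end SquareIntegrable

/-! ### Compactly supported test tensors and the fundamental lemma. -/

section TestTensors

variable {M : Type*} [TopologicalSpace M] [ChartedSpace Plane M] [IsManifold (𝓡 2) 2 M]
variable {e e' : OpenPartialHomeomorph M Plane} {S : Set M} {g : TensorField M 2}

/-- The family of components is symmetric. -/
def IsSymmComp {k : ℕ} (c : (Fin k → Fin 2) → ℝ) : Prop :=
  ∀ (σ : Equiv.Perm (Fin k)) I, c (fun a => I (σ a)) = c I

/-- The tensor field with components `φ c` in the chart `e`. -/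
def testTensor {k : ℕ} (e : OpenPartialHomeomorph M Plane) (φ : Plane → ℝ)
    (c : (Fin k → Fin 2) → ℝ) : TensorField M k := fun x =>
  e.source.indicator (fun x => φ (e x)) x • ofCompIn e x c

theorem comp_testTensor {k : ℕ} (he : e ∈ IsManifold.maximalAtlas (𝓡 2) 2 M) (φ : Plane → ℝ)
    (c : (Fin k → Fin 2) → ℝ) {y : Plane} (hy : y ∈ e.target) :
    comp e (testTensor e φ c) y = φ y • c := by
  have h1 : comp e (testTensor e φ c) y
      = e.source.indicator (fun x => φ (e x)) (e.symm y) • comp e (fun x => ofCompIn e x c) y := rfl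
  rw [h1, comp_ofCompIn he hy (fun _ => c), indicator_of_mem (e.map_target hy), e.right_inv hy]

theorem ofCompIn_perm {k : ℕ} {c : (Fin k → Fin 2) → ℝ} (hc : IsSymmComp c) (x : M)
    (σ : Equiv.Perm (Fin k)) (X : Fin k → TangentSpace (𝓡 2) x) :
    ofCompIn e x c (fun a => X (σ a)) = ofCompIn e x c X := by
  rw [ofCompIn_apply, ofCompIn_apply, ← (Equiv.arrowCongr σ.symm (Equiv.refl (Fin 2))).sum_comp]
  refine Finset.sum_congr rfl fun I _ => ?_
  have h2 : ((σ.symm.arrowCongr (Equiv.refl (Fin 2))) I) = fun a => I (σ a) := by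
    funext a; simp [Equiv.arrowCongr]
  rw [h2, hc σ I]
  congr 1
  exact Equiv.prod_comp σ (fun a => (EuclideanSpace.proj (I a) : Plane →L[ℝ] ℝ)
    (mfderiv (𝓡 2) (𝓡 2) e x (X a)))

theorem isSymmAt_testTensor {k : ℕ} (φ : Plane → ℝ) {c : (Fin k → Fin 2) → ℝ}
    (hc : IsSymmComp c) (x : M) : IsSymmAt (testTensor e φ c) x := by
  intro σ X
  have h1 : ∀ X, testTensor e φ c x X
      = e.source.indicator (fun x => φ (e x)) x • ofCompIn e x c X := fun X => rfl
  rw [h1, h1, ofCompIn_perm hc]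

theorem testTensor_eq_zero {k : ℕ} {φ : Plane → ℝ} {c : (Fin k → Fin 2) → ℝ} {x : M}
    (hx : x ∉ e.symm '' tsupport φ) : testTensor e φ c x = 0 := by
  have h : e.source.indicator (fun x => φ (e x)) x = 0 := by
    by_cases hxe : x ∈ e.source
    · rw [indicator_of_mem hxe]
      exact image_eq_zero_of_notMem_tsupport fun h => hx ⟨_, h, e.left_inv hxe⟩
    · exact indicator_of_notMem hxe _
  simp only [testTensor, h, zero_smul]

variable [MeasurableSpace M] [BorelSpace M] [CompactSpace M] [T2Space M]

/-- In another chart the components are φ times Jacobian entries where the charts overlap, and they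
vanish near every point outside the support. Since the Jacobian is C¹, so is the tensor. -/
theorem isC1SymmCompact_testTensor {k : ℕ} (hS : IsOpen S)
    (he : e ∈ IsManifold.maximalAtlas (𝓡 2) 2 M) {φ : Plane → ℝ} (hφ : ContDiff ℝ ∞ φ)
    (hφc : HasCompactSupport φ) (hφs : tsupport φ ⊆ chartDom e S) {c : (Fin k → Fin 2) → ℝ}
    (hc : IsSymmComp c) : IsC1SymmCompact S (testTensor e φ c) := by
  have hK : IsCompact (e.symm '' tsupport φ) :=
    hφc.isCompact.image_of_continuousOn
      (e.continuousOn_symm.mono (hφs.trans inter_subset_left))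
  refine ⟨⟨?_, fun x _ => isSymmAt_testTensor φ hc x⟩, e.symm '' tsupport φ, hK, ?_,
    fun x _ hx => testTensor_eq_zero hx⟩
  · intro e' he' I y hy
    have he'2 := mem_maximalAtlas he'
    refine ContDiffAt.contDiffWithinAt ?_
    by_cases hyK : e'.symm y ∈ e.symm '' tsupport φ
    · have hys : e'.symm y ∈ e.source := by
        obtain ⟨z, hz, hz2⟩ := hyK
        rw [← hz2]
        exact e.map_target (hφs hz).1
      have hy' : y ∈ transDom e' e := ⟨hy.1, hys⟩
      have h1 : (fun z => comp e' (testTensor e φ c) z I) =ᶠ[𝓝 y] fun z =>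
          ∑ J : Fin k → Fin 2, (∏ a, jac e' e z (J a) (I a)) * (φ (trans e' e z) * c J) := by
        filter_upwards [isOpen_transDom.mem_nhds hy'] with z hz
        rw [comp_eq_tact he'2 he hz, comp_testTensor he φ c (trans_mem hz).1]
        rfl
      refine ContDiffAt.congr_of_eventuallyEq ?_ h1
      refine ContDiffAt.sum fun J _ => ContDiffAt.mul ?_ (ContDiffAt.mul ?_ contDiffAt_const)
      · exact contDiffAt_prod fun a _ => contDiffAt_jac he'2 he hy' _ _
      · exact ContDiffAt.comp y (hφ.contDiffAt.of_le (by simp))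
          ((contDiffAt_trans he'2 he hy').of_le (by norm_num))
    · have h1 := eventually_comp_eq_zero hS hK (u := testTensor e φ c)
        (fun x _ hx => testTensor_eq_zero hx) hy hyK
      refine (contDiffAt_const (c := (0 : ℝ))).congr_of_eventuallyEq ?_
      filter_upwards [h1] with z hz using hz.2 I
  · rintro _ ⟨z, hz, rfl⟩
    exact (hφs hz).2

/-- The symmetrization of a basis tensor. -/
def symmBasis {k : ℕ} (J : Fin k → Fin 2) (I : Fin k → Fin 2) : ℝ :=
  ∑ σ : Equiv.Perm (Fin k), if (fun a => I (σ a)) = J then 1 else 0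

theorem isSymmComp_symmBasis {k : ℕ} (J : Fin k → Fin 2) : IsSymmComp (symmBasis J) := by
  intro τ I
  simp only [symmBasis]
  exact Fintype.sum_equiv (Equiv.mulLeft τ) _ _ fun σ => rfl

theorem symmBasis_dotProduct {k : ℕ} (J : Fin k → Fin 2) {X : (Fin k → Fin 2) → ℝ}
    (hX : IsSymmComp X) : symmBasis J ⬝ᵥ X = (Nat.factorial k : ℝ) * X J := by
  simp only [dotProduct, symmBasis, Finset.sum_mul]
  rw [Finset.sum_comm]
  have h : ∀ σ : Equiv.Perm (Fin k), ∑ I : Fin k → Fin 2,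
      (if (fun a => I (σ a)) = J then (1 : ℝ) else 0) * X I = X J := by
    intro σ
    rw [Finset.sum_eq_single (fun a => J (σ.symm a))]
    · simp only [Equiv.symm_apply_apply, if_true, one_mul]
      exact hX σ.symm J
    · intro I _ hI
      rw [if_neg, zero_mul]
      intro h
      apply hI
      funext a
      rw [← h]
      simp
    · simp
  simp only [h, Finset.sum_const, Finset.card_univ, Fintype.card_perm, Fintype.card_fin,
    nsmul_eq_mul]

/-- The fundamental lemma of the calculus of variations for symmetric tensors. -/
theorem ae_eq_zero_of_forall_l2Inner {k : ℕ} (hg : IsRiem S g) {w : TensorField M k}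
    (hw : IsMeas S w) (hws : ∀ᵐ x ∂areaMeasure g S, IsSymmAt w x)
    (hloc : ∀ e ∈ atlas Plane M, ∀ c : (Fin k → Fin 2) → ℝ, LocallyIntegrableOn
      (fun y => density e g y * (c ⬝ᵥ tact (gramInv e g y) (comp e w y))) (chartDom e S)
      ((volume : Measure Plane).restrict (chartDom e S)))
    (h : ∀ t : TensorField M k, IsC1SymmCompact S t → l2Inner g S t w = 0) :
    ∀ᵐ x ∂areaMeasure g S, w x = 0 := by
  have key : ∀ e ∈ atlas Plane M, ∀ c : (Fin k → Fin 2) → ℝ, IsSymmComp c →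
      ∀ᵐ y ∂(volume : Measure Plane).restrict (chartDom e S),
        c ⬝ᵥ tact (gramInv e g y) (comp e w y) = 0 := by
    intro e he c hc
    have he' := mem_maximalAtlas he
    have h1 := (isOpen_chartDom hg.isOpen).ae_eq_zero_of_integral_contDiff_smul_eq_zero
      (hloc e he c) (by
        intro φ hφ hφc hφs
        have ht := isC1SymmCompact_testTensor hg.isOpen he' hφ hφc hφs hc
        have h2 := h _ ht
        have hm : AEMeasurable (tensorInner g (testTensor e φ c) w) (areaMeasure g S) :=
          aemeasurable_tensorInner hg
            (isMeas_of_isCr hg.isOpen (ht.1.1.of_le (by norm_num))) hw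
        rw [l2Inner, integral_eq_chart hg he' hm (fun x _ hxe => tensorInner_zero_left
          (testTensor_eq_zero (by
            rintro ⟨z, hz, rfl⟩
            exact hxe (e.map_target (hφs hz).1))))] at h2
        rw [← h2]
        refine setIntegral_congr_fun (measurableSet_chartDom hg.isOpen) fun y hy => ?_
        rw [tensorInner_symm_apply he' hy.1, coordInner_eq, comp_testTensor he' φ c hy.1,
          smul_dotProduct]
        simp only [smul_eq_mul]
        ring)
    filter_upwards [h1, ae_restrict_mem (measurableSet_chartDom hg.isOpen)] with y hy hyS
    exact (mul_eq_zero.1 (hy hyS)).resolve_left (density_pos hg he' hyS).ne'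
  refine ae_areaMeasure_of_charts hg.isOpen fun e he => ?_
  have he' := mem_maximalAtlas he
  have h1 : ∀ᵐ y ∂(volume : Measure Plane).restrict (chartDom e S), ∀ J : Fin k → Fin 2,
      symmBasis J ⬝ᵥ tact (gramInv e g y) (comp e w y) = 0 :=
    ae_all_iff.2 fun J => key e he _ (isSymmComp_symmBasis J)
  filter_upwards [h1, ae_restrict_mem (measurableSet_chartDom hg.isOpen),
    ae_chart_of_ae_areaMeasure hg he' hws] with y hy hyS hys
  -- Test tensors must be symmetric, so a basis tensor can only be used after symmetrization. This
  -- loses nothing: the raised components of w are symmetric, and pairing them with the symmetrized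
  -- basis tensor gives k! times the chosen component.
  have h2 : tact (gramInv e g y) (comp e w y) = 0 := by
    funext J
    have h3 := hy J
    rw [symmBasis_dotProduct J (tact_perm _ _ (comp_perm hys))] at h3
    exact (mul_eq_zero.1 h3).resolve_left (by positivity)
  have h4 : comp e w y = 0 := by
    rw [← tact_one (comp e w y), ← gram_mul_gramInv hg he' hyS, tact_mul, h2, tact_zero]
  have h5 := eq_of_comp_eq (u := w) (v := 0) he' (e.map_target hyS.1)
    (by rw [e.right_inv hyS.1, h4]; rfl)
  exact h5

theorem locallyIntegrableOn_of_isCr {k : ℕ} (hg : IsRiem S g) {z : TensorField M k}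
    (hz : IsCr 0 S z) (he : e ∈ atlas Plane M) (c : (Fin k → Fin 2) → ℝ) : LocallyIntegrableOn
      (fun y => density e g y * (c ⬝ᵥ tact (gramInv e g y) (comp e z y))) (chartDom e S)
      ((volume : Measure Plane).restrict (chartDom e S)) := by
  have he' := mem_maximalAtlas he
  refine ContinuousOn.locallyIntegrableOn ?_ (measurableSet_chartDom hg.isOpen)
  refine (continuousOn_density hg he').mul fun y hy => ContinuousAt.continuousWithinAt ?_
  refine tendsto_finsetSum _ fun I _ => Tendsto.mul tendsto_const_nhds ?_
  refine tendsto_finsetSum _ fun J _ => Tendsto.mul ?_ ?_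
  · exact tendsto_finsetProd _ fun a _ => (contDiffAt_gramInv hg he' hy _ _).continuousAt
  · exact (contDiffAt_comp (by norm_num) hg.isOpen hz he' hy J).continuousAt

/-- Pointwise |(c, v)| ≤ |c|² + |v|². With c constant in the chart, the first term is continuous;
the second is integrable. -/
theorem locallyIntegrableOn_of_normSq {k : ℕ} (hg : IsRiem S g) {v : TensorField M k}
    (hv : IsMeas S v) (hv2 : normSq g S v < ⊤) (he : e ∈ atlas Plane M)
    (c : (Fin k → Fin 2) → ℝ) : LocallyIntegrableOn
      (fun y => density e g y * (c ⬝ᵥ tact (gramInv e g y) (comp e v y))) (chartDom e S)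
      ((volume : Measure Plane).restrict (chartDom e S)) := by
  have he' := mem_maximalAtlas he
  have hD := measurableSet_chartDom (e := e) hg.isOpen
  have hdm := (continuousOn_density hg he').aemeasurable hD (μ := volume)
  have hGm : ∀ i j, AEMeasurable (fun y => gramInv e g y i j)
      ((volume : Measure Plane).restrict (chartDom e S)) := fun i j =>
    ContinuousOn.aemeasurable (fun y hy => (contDiffAt_gramInv hg he' hy i j)
      |>.continuousAt.continuousWithinAt) hD
  have h1 : Integrable (fun y => density e g y * coordInner e g v v y)
      ((volume : Measure Plane).restrict (chartDom e S)) := by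
    refine ⟨(hdm.mul (aemeasurable_coordInner hg he hv hv)).aestronglyMeasurable, ?_⟩
    have h2 : ∫⁻ x in e.source, ENNReal.ofReal (tensorInner g v v x) ∂areaMeasure g S < ⊤ :=
      (setLIntegral_le_lintegral _ _).trans_lt hv2
    rw [setLIntegral_source hg he' (aemeasurable_tensorInner hg hv hv).ennreal_ofReal] at h2
    refine lt_of_le_of_lt (le_of_eq ?_) h2
    refine setLIntegral_congr_fun hD fun y hy => ?_
    rw [← ENNReal.ofReal_mul (density_nonneg y), tensorInner_symm_apply he' hy.1,
      Real.enorm_eq_ofReal]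
    have := tensorInner_self_nonneg hg hy.2 v
    rw [tensorInner_symm_apply he' hy.1] at this
    exact mul_nonneg (density_nonneg y) this
  have h2 : LocallyIntegrableOn
      (fun y => density e g y * (c ⬝ᵥ tact (gramInv e g y) c)) (chartDom e S)
      ((volume : Measure Plane).restrict (chartDom e S)) := by
    refine ContinuousOn.locallyIntegrableOn ?_ hD
    refine (continuousOn_density hg he').mul fun y hy => ContinuousAt.continuousWithinAt ?_
    refine tendsto_finsetSum _ fun I _ => Tendsto.mul tendsto_const_nhds ?_
    refine tendsto_finsetSum _ fun J _ => Tendsto.mul ?_ tendsto_const_nhds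
    exact tendsto_finsetProd _ fun a _ => (contDiffAt_gramInv hg he' hy _ _).continuousAt
  have h3 := h2.add (h1.locallyIntegrable.locallyIntegrableOn (chartDom e S))
  refine h3.mono ?_ ?_
  · refine (hdm.mul ?_).aestronglyMeasurable
    refine Finset.aemeasurable_fun_sum _ fun I _ => AEMeasurable.const_mul ?_ _
    refine Finset.aemeasurable_fun_sum _ fun J _ => AEMeasurable.mul ?_ (hv e he J)
    exact Finset.aemeasurable_fun_prod _ fun a _ => hGm _ _
  · filter_upwards [ae_restrict_mem hD] with y hy
    obtain ⟨P, -, hP, -⟩ := exists_orthonormal hg he' hy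
    simp only [Pi.add_apply, coordInner_eq]
    rw [hP]
    simp only [tact_mul, dotProduct_tact P]
    set a := tact P.transpose c
    set b := tact P.transpose (comp e v y)
    have hd := density_nonneg (e := e) (g := g) y
    have ha : 0 ≤ a ⬝ᵥ a := Finset.sum_nonneg fun i _ => mul_self_nonneg (a i)
    have hb : 0 ≤ b ⬝ᵥ b := Finset.sum_nonneg fun i _ => mul_self_nonneg (b i)
    have hab : |a ⬝ᵥ b| ≤ a ⬝ᵥ a + b ⬝ᵥ b := by
      have h4 := abs_dotProduct_le a b
      nlinarith [Real.sq_sqrt ha, Real.sq_sqrt hb, sq_nonneg (Real.sqrt (a ⬝ᵥ a)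
        - Real.sqrt (b ⬝ᵥ b))]
    calc ‖density e g y * (a ⬝ᵥ b)‖ = density e g y * |a ⬝ᵥ b| := by
          rw [Real.norm_eq_abs, abs_mul, abs_of_nonneg hd]
      _ ≤ density e g y * (a ⬝ᵥ a + b ⬝ᵥ b) := mul_le_mul_of_nonneg_left hab hd
      _ ≤ _ := by rw [mul_add]; exact Real.le_norm_self _

/-- A square integrable tensor and a continuous one that have the same scalar products with all
test tensors coincide. -/
theorem ae_eq_of_forall_l2Inner {k : ℕ} (hg : IsRiem S g) {v z : TensorField M k}
    (hv : IsL2Symm g S v) (hz : IsCr 0 S z) (hzs : ∀ x ∈ S, IsSymmAt z x)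
    (h : ∀ t : TensorField M k, IsC1SymmCompact S t → l2Inner g S t v = l2Inner g S t z) :
    ∀ᵐ x ∂areaMeasure g S, v x = z x := by
  have hzm := isMeas_of_isCr hg.isOpen hz
  -- The difference of v and z need not be square integrable, since z is merely continuous. The
  -- fundamental lemma therefore asks only for local integrability in charts.
  have h1 := ae_eq_zero_of_forall_l2Inner hg (hv.isMeas.sub hzm) (by
      filter_upwards [hv.2.1, ae_mem hg.isOpen] with x hx hxS σ X
      have h2 : ∀ X, (v - z) x X = v x X - z x X := fun X => rfl
      rw [h2, h2, hx σ X, hzs x hxS σ X])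
    (by
      intro e he c
      have h2 := (locallyIntegrableOn_of_normSq hg hv.isMeas hv.2.2 he c).sub
        (locallyIntegrableOn_of_isCr hg hz he c)
      have h3 : (fun y => density e g y * (c ⬝ᵥ tact (gramInv e g y) (comp e (v - z) y)))
          = (fun y => density e g y * (c ⬝ᵥ tact (gramInv e g y) (comp e v y)))
            - fun y => density e g y * (c ⬝ᵥ tact (gramInv e g y) (comp e z y)) := by
        funext y
        simp only [comp_sub, tact_sub, dotProduct_sub, Pi.sub_apply]
        ring
      rw [h3]
      exact h2)
    (by
      intro t ht
      obtain ⟨K, hK, hKS, hK0⟩ := ht.2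
      have ht0 : IsCr 0 S t := ht.1.1.of_le (by norm_num)
      have htm := isMeas_of_isCr hg.isOpen ht0
      have i0 : Integrable (tensorInner g t t) (areaMeasure g S) :=
        integrable_of_compact hg (continuousOn_tensorInner hg ht0 ht0) hK hKS
          fun x hx hxK => tensorInner_zero_left (hK0 x hx hxK)
      have ht2 : normSq g S t < ⊤ := by
        refine lt_of_le_of_lt (lintegral_mono fun x => ?_) i0.2
        rw [Real.enorm_eq_ofReal_abs]
        exact ENNReal.ofReal_le_ofReal (le_abs_self _)
      have i1 := integrable_tensorInner hg htm hv.isMeas ht2 hv.2.2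
      have i2 : Integrable (tensorInner g t z) (areaMeasure g S) :=
        integrable_of_compact hg (continuousOn_tensorInner hg ht0 hz) hK hKS
          fun x hx hxK => tensorInner_zero_left (hK0 x hx hxK)
      have h4 : l2Inner g S t (v - z) = l2Inner g S t v - l2Inner g S t z := by
        simp only [l2Inner]
        rw [← integral_sub i1 i2]
        simp only [tensorInner_sub_right]
      rw [h4, h t ht, sub_self])
  filter_upwards [h1] with x hx
  exact sub_eq_zero.1 hx

end TestTensors

/-! ### Weak derivatives of C¹ sections are the classical ones. -/

section Classical

variable {M : Type*} [TopologicalSpace M] [ChartedSpace Plane M] [IsManifold (𝓡 2) 2 M]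
variable {e e' : OpenPartialHomeomorph M Plane} {S : Set M} {g : TensorField M 2}

theorem isSymmComp_symmetrization {k : ℕ} (r : ℝ) (F : Fin 2 → (Fin k → Fin 2) → ℝ) :
    IsSymmComp fun I : Fin (k + 1) → Fin 2 =>
      r * ∑ σ : Equiv.Perm (Fin (k + 1)), F (I (σ 0)) (fun a => I (σ a.succ)) := by
  intro τ I
  beta_reduce
  congr 1
  exact Fintype.sum_equiv (Equiv.mulLeft τ) _ _ fun σ => rfl

theorem isSymmAt_symCovDeriv {k : ℕ} (u : TensorField M k) (x : M) :
    IsSymmAt (symCovDeriv g u) x := by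
  intro σ X
  exact ofCompIn_perm (isSymmComp_symmetrization _
    (covDeriv (chartAt Plane x) g u (chartAt Plane x x))) x σ X

theorem isSymmAt_zero (u : TensorField M 0) (x : M) : IsSymmAt u x := by
  intro σ X
  congr 1
  exact Subsingleton.elim _ _

theorem isSymmAt_one (u : TensorField M 1) (x : M) : IsSymmAt u x := by
  intro σ X
  congr 1
  funext a
  rw [Subsingleton.elim σ 1]
  rfl

theorem tensorInner_metric (hg : IsRiem S g) {x : M} (hx : x ∈ S) (h : TensorField M 2) :
    tensorInner g g h x = ∑ i, ∑ j, gramInv (chartAt Plane x) g (chartAt Plane x x) i j *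
      gram (chartAt Plane x) h (chartAt Plane x x) i j := by
  have hy := chartAt_mem_chartDom hx
  have h1 := tensorInner_two (g := g) (chartAt_mem_maximalAtlas x) hy.1 g h
  rw [chartAt_symm_apply] at h1
  have h2 := sum_gramInv_mul_gram hg (chartAt_mem_maximalAtlas x) hy
  have hc := gramInv_comm hg hy
  rw [h1]
  simp only [Fin.sum_univ_two]
  generalize gramInv (chartAt Plane x) g (chartAt Plane x x) = W at *
  generalize gram (chartAt Plane x) g (chartAt Plane x x) = G at *
  generalize gram (chartAt Plane x) h (chartAt Plane x x) = H at *
  have h00 := h2 0 0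
  have h01 := h2 0 1
  have h10 := h2 1 0
  have h11 := h2 1 1
  simp only [Matrix.one_apply_eq, Matrix.one_apply_ne (show (0 : Fin 2) ≠ 1 by decide),
    Matrix.one_apply_ne (show (1 : Fin 2) ≠ 0 by decide)] at h00 h01 h10 h11
  rw [hc] at h10 h11 ⊢
  linear_combination (W 0 0 * H 0 0 + W 0 1 * H 0 1) * h00
    + (W 0 1 * H 0 0 + W 1 1 * H 0 1) * h01 + (W 0 0 * H 1 0 + W 0 1 * H 1 1) * h10
    + (W 0 1 * H 1 0 + W 1 1 * H 1 1) * h11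

theorem tensorInner_metric_self (hg : IsRiem S g) {x : M} (hx : x ∈ S) :
    tensorInner g g g x = 2 := by
  have hy := chartAt_mem_chartDom hx
  have h2 := sum_gramInv_mul_gram hg (chartAt_mem_maximalAtlas x) hy
  have hs := gram_apply_comm (e := chartAt Plane x) (h := g) (y := chartAt Plane x x)
    (by rw [chartAt_symm_apply]; exact hg.symm x hx) 1 0
  rw [tensorInner_metric hg hx]
  have h00 := h2 0 0
  have h11 := h2 1 1
  simp only [Matrix.one_apply_eq] at h00 h11
  simp only [Fin.sum_univ_two]
  rw [hs] at *
  linear_combination h00 + h11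

theorem val_divergence_eq (hg : IsRiem S g) {β : TensorField M 1} (hβ : IsCr 1 S β) {x : M}
    (hx : x ∈ S) : val (divergence g β) x = -tensorInner g g (symCovDeriv g β) x := by
  have hy := chartAt_mem_chartDom hx
  have he := chartAt_mem_maximalAtlas x
  have h1 := val_divergence hg he hβ hy
  rw [chartAt_symm_apply] at h1
  rw [h1, tensorInner_metric hg hx]
  simp only [gram_symCovDeriv hg he hy hβ, Fin.sum_univ_two]
  rw [gramInv_comm hg hy]
  ring

/-- The divergence is minus the scalar product of Sym∇β with the metric, and |g|² = 2 in dimension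
two; the rest is Cauchy–Schwarz. A 1-form with square integrable Sym∇β thus automatically has square
integrable divergence. -/
theorem tensorInner_divergence_le (hg : IsRiem S g) {β : TensorField M 1} (hβ : IsCr 1 S β) {x : M}
    (hx : x ∈ S) : tensorInner g (divergence g β) (divergence g β) x
      ≤ 2 * tensorInner g (symCovDeriv g β) (symCovDeriv g β) x := by
  rw [tensorInner_val, val_divergence_eq hg hβ hx]
  have h := abs_tensorInner_le hg hx g (symCovDeriv g β)
  rw [tensorInner_metric_self hg hx] at h
  have h0 := tensorInner_self_nonneg hg hx (symCovDeriv g β)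
  have h1 := mul_self_le_mul_self (abs_nonneg _) h
  rw [abs_mul_abs_self] at h1
  nlinarith [Real.mul_self_sqrt h0, Real.mul_self_sqrt (show (0 : ℝ) ≤ 2 by norm_num)]

variable [MeasurableSpace M] [BorelSpace M] [CompactSpace M] [T2Space M]

theorem normSq_lt_top_of_compact {k : ℕ} (hg : IsRiem S g) {t : TensorField M k}
    (ht : IsCr 0 S t) {K : Set M} (hK : IsCompact K) (hKS : K ⊆ S)
    (h0 : ∀ x ∈ S, x ∉ K → t x = 0) : normSq g S t < ⊤ := by
  have i0 : Integrable (tensorInner g t t) (areaMeasure g S) :=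
    integrable_of_compact hg (continuousOn_tensorInner hg ht ht) hK hKS
      fun x hx hxK => tensorInner_zero_left (h0 x hx hxK)
  refine lt_of_le_of_lt (lintegral_mono fun x => ?_) i0.2
  rw [Real.enorm_eq_ofReal_abs]
  exact ENNReal.ofReal_le_ofReal (le_abs_self _)

theorem normSq_divergence_le (hg : IsRiem S g) {β : TensorField M 1} (hβ : IsCr 1 S β) :
    normSq g S (divergence g β) ≤ 2 * normSq g S (symCovDeriv g β) := by
  rw [normSq, normSq, ← lintegral_const_mul' _ _ (by simp)]
  refine lintegral_mono_ae ?_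
  filter_upwards [ae_mem (g := g) hg.isOpen] with x hx
  calc _ ≤ ENNReal.ofReal (2 * tensorInner g (symCovDeriv g β) (symCovDeriv g β) x) :=
        ENNReal.ofReal_le_ofReal (tensorInner_divergence_le hg hβ hx)
    _ = _ := by rw [ENNReal.ofReal_mul (by norm_num)]; simp

theorem l2Inner_comm {k : ℕ} (hg : IsRiem S g) (u v : TensorField M k) :
    l2Inner g S u v = l2Inner g S v u := by
  refine integral_congr_ae ?_
  filter_upwards [ae_mem (g := g) hg.isOpen] with x hx using tensorInner_comm hg hx u v

variable [IsManifold (𝓡 2) ∞ M]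

/-- Against a compactly supported test tensor, the weak and the classical form of Sym∇u have the
same scalar product, by the definition of the adjoint and by Green's formula respectively. -/
theorem HasDeltaStar.eq_symCovDeriv_one (hg : IsRiem S g) {u : TensorField M 1}
    {v : TensorField M 2} (hu : IsCr 1 S u) (h : HasDeltaStar g S u v) :
    ∀ᵐ x ∂areaMeasure g S, v x = symCovDeriv g u x := by
  refine ae_eq_of_forall_l2Inner hg h.2.1 (isCr_zero_symCovDeriv_one hg hu)
    (fun x _ => isSymmAt_symCovDeriv u x) fun t ht => ?_
  obtain ⟨K, hK, hKS, h0⟩ := ht.2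
  rw [← h.2.2 t ht, l2Inner_divergence_two hg ht.1 hu hK hKS (Or.inl h0)]

theorem HasDeltaStar.eq_symCovDeriv_zero (hg : IsRiem S g) {f : M → ℝ}
    {w : TensorField M 1} (hf : IsCr 1 S (ofFun f)) (h : HasDeltaStar g S (ofFun f) w) :
    ∀ᵐ x ∂areaMeasure g S, w x = symCovDeriv g (ofFun f) x := by
  refine ae_eq_of_forall_l2Inner hg h.2.1 (isCr_zero_symCovDeriv_zero hg hf)
    (fun x _ => isSymmAt_symCovDeriv _ x) fun t ht => ?_
  obtain ⟨K, hK, hKS, h0⟩ := ht.2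
  rw [← h.2.2 t ht, l2Inner_divergence_one hg ht.1.1 hf hK hKS h0]

/-- Green's formula for the approximating tensors and a fixed compactly supported 1-form t passes to
the limit, giving ⟨w, t⟩ = ⟨h, Sym∇t⟩. The same formula for h itself replaces the right side by ⟨div
h, t⟩; both applications use the compact support of t only. -/
theorem HasDelta.eq_divergence (hg : IsRiem S g) {h : TensorField M 2} {w : TensorField M 1}
    (hh : IsC1Symm S h) (hd : HasDelta g S h w) :
    ∀ᵐ x ∂areaMeasure g S, w x = divergence g h x := by
  obtain ⟨hh2, hw2, H, hH, hHh, hHw⟩ := hd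
  refine ae_eq_of_forall_l2Inner hg hw2 (isCr_zero_divergence_two hg hh.1)
    (fun x _ => isSymmAt_one _ x) fun t ht => ?_
  obtain ⟨K, hK, hKS, h0⟩ := ht.2
  have ht0 : IsCr 0 S t := ht.1.1.of_le (by norm_num)
  have hst0 := isCr_zero_symCovDeriv_one hg ht.1.1
  have hst : ∀ x ∈ S, x ∉ K → symCovDeriv g t x = 0 := fun x hx hxK =>
    symCovDeriv_one_eq_zero hg hK ht.1.1 h0 hx hxK
  have hHm : ∀ m, IsCr 0 S (H m) := fun m => (hH m).1.1.of_le (by norm_num)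
  have hdHm : ∀ m, IsCr 0 S (divergence g (H m)) := fun m =>
    isCr_zero_divergence_two hg (hH m).1.1
  have l1 := tendsto_l2Inner hg (fun m => isMeas_of_isCr hg.isOpen (hdHm m)) hw2.isMeas
    (isMeas_of_isCr hg.isOpen ht0) (fun m => integrable_of_compact hg
      (continuousOn_tensorInner hg (hdHm m) ht0) hK hKS
      fun x hx hxK => tensorInner_zero_right (h0 x hx hxK)) hw2.2.2
    (normSq_lt_top_of_compact hg ht0 hK hKS h0) hHw
  have l2 := tendsto_l2Inner hg (fun m => isMeas_of_isCr hg.isOpen (hHm m)) hh2.isMeas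
    (isMeas_of_isCr hg.isOpen hst0) (fun m => integrable_of_compact hg
      (continuousOn_tensorInner hg (hHm m) hst0) hK hKS
      fun x hx hxK => tensorInner_zero_right (hst x hx hxK)) hh2.2.2
    (normSq_lt_top_of_compact hg hst0 hK hKS hst) hHh
  have l3 : ∀ m, l2Inner g S (divergence g (H m)) t = l2Inner g S (H m) (symCovDeriv g t) :=
    fun m => l2Inner_divergence_two hg (hH m).1 ht.1.1 hK hKS (Or.inr h0)
  simp only [l3] at l1
  have l4 := tendsto_nhds_unique l1 l2
  rw [l2Inner_comm hg t w, l4, ← l2Inner_divergence_two hg hh ht.1.1 hK hKS (Or.inr h0),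
    l2Inner_comm hg]

end Classical

/-! ### Cylindrical coordinates as charts of the C² atlas. -/

section CylinderCharts

variable {M : Type*} [TopologicalSpace M] [ChartedSpace Plane M] [IsManifold (𝓡 2) 2 M]
variable {e e' : OpenPartialHomeomorph M Plane} {S : Set M} {g : TensorField M 2}

/-- The coordinates of a point of the plane, as a pair. -/
def coordPair : Plane →L[ℝ] ℝ × ℝ :=
  (EuclideanSpace.proj 0 : Plane →L[ℝ] ℝ).prod (EuclideanSpace.proj 1 : Plane →L[ℝ] ℝ)

theorem coordPair_apply (y : Plane) : coordPair y = (y 0, y 1) := rfl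

theorem coordPair_stdVec_zero : coordPair (stdVec 0) = (1, 0) := by
  simp [coordPair_apply, stdVec]

theorem coordPair_stdVec_one : coordPair (stdVec 1) = (0, 1) := by
  simp [coordPair_apply, stdVec]

theorem bilinear_right {E : Type*} [AddCommGroup E] [Module ℝ E] [TopologicalSpace E]
    (u : ContinuousMultilinearMap ℝ (fun _ : Fin 2 => E) ℝ) (A B : E) (a b : ℝ) :
    u ![A, a • A + b • B] = a * u ![A, A] + b * u ![A, B] := by
  have h : ∀ X : E, ![A, X] = Function.update ![A, 0] 1 X := fun X => by
    funext i; fin_cases i <;> simp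
  rw [h (a • A + b • B), h A, h B, u.map_update_add, u.map_update_smul, u.map_update_smul]
  rfl

theorem bilinear_left {E : Type*} [AddCommGroup E] [Module ℝ E] [TopologicalSpace E]
    (u : ContinuousMultilinearMap ℝ (fun _ : Fin 2 => E) ℝ) (A B : E) (a b : ℝ) :
    u ![a • A + b • B, B] = a * u ![A, B] + b * u ![B, B] := by
  have h : ∀ X : E, ![X, B] = Function.update ![0, B] 0 X := fun X => by
    funext i; fin_cases i <;> simp
  rw [h (a • A + b • B), h A, h B, u.map_update_add, u.map_update_smul, u.map_update_smul]
  rfl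

variable {q : M} {α r : ℝ} {Φ : ℝ × ℝ → M}

namespace IsCylindrical

theorem contMDiffAt (h : IsCylindrical g S q α r Φ) {z : ℝ × ℝ} (hz : z.1 ∈ Ioo 0 r) :
    ContMDiffAt 𝓘(ℝ, ℝ × ℝ) (𝓡 2) 2 Φ z :=
  h.contMDiffOn.contMDiffAt ((isOpen_Ioo.prod isOpen_univ).mem_nhds ⟨hz, mem_univ _⟩)

/-- In the frame (∂_ρ, ∂_θ) the metric is diag(1, sinh²ρ). If w is mapped to zero, pairing its image
with ∂_ρ and with ∂_θ forces both coordinates of w to vanish. -/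
theorem mfderiv_injective (h : IsCylindrical g S q α r Φ) {z : ℝ × ℝ} (hz : z.1 ∈ Ioo 0 r)
    {w : ℝ × ℝ} (hw : mfderiv 𝓘(ℝ, ℝ × ℝ) (𝓡 2) Φ z w = 0) : w = 0 := by
  have hz' : z ∈ Ioo 0 r ×ˢ (univ : Set ℝ) := ⟨hz, mem_univ _⟩
  set A := mfderiv 𝓘(ℝ, ℝ × ℝ) (𝓡 2) Φ z ((1, 0) : ℝ × ℝ)
  set B := mfderiv 𝓘(ℝ, ℝ × ℝ) (𝓡 2) Φ z ((0, 1) : ℝ × ℝ)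
  have h1 : w.1 • A + w.2 • B = 0 := by
    rw [← hw]
    have h2 : w = w.1 • ((1, 0) : ℝ × ℝ) + w.2 • ((0, 1) : ℝ × ℝ) := by
      ext <;> simp
    conv_rhs => rw [h2]
    exact (((mfderiv 𝓘(ℝ, ℝ × ℝ) (𝓡 2) Φ z).map_add _ _).trans
      (congrArg₂ (· + ·) ((mfderiv 𝓘(ℝ, ℝ × ℝ) (𝓡 2) Φ z).map_smul _ _)
        ((mfderiv 𝓘(ℝ, ℝ × ℝ) (𝓡 2) Φ z).map_smul _ _))).symm
  have h3 := bilinear_right (g (Φ z)) A B w.1 w.2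
  have h4 := bilinear_left (g (Φ z)) A B w.1 w.2
  rw [h1] at h3 h4
  rw [h.metric_rho z hz', h.metric_mixed z hz',
    (g (Φ z)).map_coord_zero (m := ![A, 0]) 1 rfl] at h3
  rw [h.metric_theta z hz', h.metric_mixed z hz',
    (g (Φ z)).map_coord_zero (m := ![0, B]) 0 rfl] at h4
  have h5 : 0 < Real.sinh z.1 := Real.sinh_pos_iff.2 hz.1
  have h6 : w.2 = 0 := by
    have : w.2 * Real.sinh z.1 ^ 2 = 0 := by linarith
    exact (mul_eq_zero.1 this).resolve_right (by positivity)
  ext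
  · simpa using h3.symm
  · exact h6

theorem comp_eventuallyEq {k : ℕ} {u : TensorField M k} {y : Plane} {F : Plane → M}
    (hF : (e.symm : Plane → M) =ᶠ[𝓝 y] F) (I : Fin k → Fin 2) :
    comp e u y I = u (F y) (fun a => mfderiv (𝓡 2) (𝓡 2) F y (stdVec (I a))) := by
  have key : ∀ x, e.symm y = x → ∀ X : Fin k → Plane,
      (∀ a, (mfderiv (𝓡 2) (𝓡 2) e.symm y (stdVec (I a)) : Plane) = X a) →
      comp e u y I = u x X := by
    rintro x rfl X hX
    rw [← funext hX]
    rfl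
  refine key _ hF.eq_of_nhds _ fun a => ?_
  have h1 : mfderiv (𝓡 2) (𝓡 2) e.symm y = mfderiv (𝓡 2) (𝓡 2) F y := hF.mfderiv_eq
  exact congrArg (fun L => L (stdVec (I a))) h1

/-- Around every point of the end there is a chart with cylindrical coordinates. -/
theorem exists_chart (h : IsCylindrical g S q α r Φ) {ρ : ℝ} (hρ : ρ ∈ Ioo 0 r) (θ : ℝ) :
    ∃ e ∈ IsManifold.maximalAtlas (𝓡 2) 2 M, Φ (ρ, θ) ∈ e.source ∧ ∀ y ∈ e.target,
      y 0 ∈ Ioo 0 r ∧ e.symm y = Φ (y 0, y 1) ∧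
      gram e g y 0 0 = 1 ∧ gram e g y 0 1 = 0 ∧ gram e g y 1 1 = Real.sinh (y 0) ^ 2 := by
  set F : Plane → M := Φ ∘ coordPair with hF
  set B : Set Plane := {y | y 0 ∈ Ioo 0 r} with hB
  have hBo : IsOpen B := isOpen_Ioo.preimage (EuclideanSpace.proj (0 : Fin 2)).continuous
  have hFs : ∀ y ∈ B, ContMDiffAt (𝓡 2) (𝓡 2) 2 F y := fun y hy =>
    (h.contMDiffAt (z := coordPair y) hy).comp y coordPair.contMDiff.contMDiffAt
  have hFd : ∀ y ∈ B, ∀ v : Plane, (mfderiv (𝓡 2) (𝓡 2) F y v : Plane)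
      = mfderiv 𝓘(ℝ, ℝ × ℝ) (𝓡 2) Φ (coordPair y) (coordPair v) := by
    intro y hy v
    have h1 := mfderiv_comp y ((h.contMDiffAt (z := coordPair y) hy).mdifferentiableAt
      (by norm_num)) (coordPair.mdifferentiableAt (x := y))
    have h2 := congrArg (fun L => L v) h1
    refine h2.trans ?_
    rw [ContinuousLinearMap.mfderiv_eq]
    rfl
  set y₀ : Plane := !₂[ρ, θ]
  have hy₀ : F y₀ = Φ (ρ, θ) := rfl
  have hy₀B : y₀ ∈ B := hρ
  set c := chartAt Plane (Φ (ρ, θ))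
  have hc : c ∈ IsManifold.maximalAtlas (𝓡 2) 2 M := chartAt_mem_maximalAtlas _
  set U : Set Plane := B ∩ F ⁻¹' c.source
  have hUo : IsOpen U := ContinuousOn.isOpen_inter_preimage
    (fun y hy => (hFs y hy).continuousAt.continuousWithinAt) hBo c.open_source
  have hy₀U : y₀ ∈ U := ⟨hρ, mem_chart_source _ _⟩
  have hG : ∀ y ∈ U, ContDiffAt ℝ 2 (c ∘ F) y := fun y hy => by
    rw [← contMDiffAt_iff_contDiffAt]
    exact (((contMDiffOn_of_mem_maximalAtlas hc).contMDiffAt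
      (c.open_source.mem_nhds hy.2)).comp y (hFs y hy.1))
  have hinj : ∀ y ∈ U, Function.Injective (fderiv ℝ (c ∘ F) y) := by
    intro y hy
    refine (injective_iff_map_eq_zero _).2 fun v hv => ?_
    have h1 := mfderiv_comp y (mdifferentiableAt_chart hc hy.2)
      ((hFs y hy.1).mdifferentiableAt (by norm_num))
    rw [mfderiv_eq_fderiv] at h1
    have h2 : mfderiv (𝓡 2) (𝓡 2) c (F y) (mfderiv (𝓡 2) (𝓡 2) F y v) = 0 := by
      refine Eq.trans ?_ hv
      exact (congrArg (fun L => L v) h1).symm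
    have h3 := mfderiv_symm_comp_mfderiv hc hy.2 (mfderiv (𝓡 2) (𝓡 2) F y v)
    rw [h2, map_zero] at h3
    have h4 : coordPair v = 0 := h.mfderiv_injective (z := coordPair y) hy.1
      ((hFd y hy.1 v).symm.trans h3.symm)
    rw [coordPair_apply] at h4
    ext i
    fin_cases i
    · exact congrArg Prod.fst h4
    · exact congrArg Prod.snd h4
  -- An injective endomorphism of the plane is invertible, so the inverse function theorem applies
  -- at every point of U.
  have hequiv : ∀ y ∈ U, ∃ J : Plane ≃L[ℝ] Plane, HasFDerivAt (c ∘ F) (J : Plane →L[ℝ] Plane) y := by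
    intro y hy
    refine ⟨(LinearEquiv.ofInjectiveEndo (fderiv ℝ (c ∘ F) y).toLinearMap
      (hinj y hy)).toContinuousLinearEquiv, ?_⟩
    have h1 := ((hG y hy).differentiableAt (by norm_num)).hasFDerivAt
    exact h1.congr_fderiv (by ext v; rfl)
  obtain ⟨J, hJ⟩ := hequiv y₀ hy₀U
  -- The restriction to U keeps the derivative invertible on the whole source. The inverse is then
  -- C² at every point of the target, not only at the image of the centre, and the resulting chart
  -- belongs to the maximal atlas.
  set D := ((hG y₀ hy₀U).toOpenPartialHomeomorph (c ∘ F) hJ (by norm_num)).restrOpen U hUo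
  have hD : ∀ y, D y = c (F y) := fun y => rfl
  have hDs : ∀ y ∈ D.source, y ∈ U := fun y hy => hy.2
  have hy₀D : y₀ ∈ D.source :=
    ⟨(hG y₀ hy₀U).mem_toOpenPartialHomeomorph_source hJ (by norm_num), hy₀U⟩
  set e := c.trans D.symm
  have het : ∀ y ∈ e.target, y ∈ D.source := fun y hy => hy.1
  have hes : ∀ y ∈ e.target, e.symm y = F y := fun y hy => by
    change c.symm (c (F y)) = F y
    exact c.left_inv (hDs y (het y hy)).2
  have hmem : e ∈ IsManifold.maximalAtlas (𝓡 2) 2 M := by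
    refine OpenPartialHomeomorph.mem_maximalAtlas_of_contMDiffOn e ?_ ?_
    · intro x hx
      have hxD : c x ∈ D.target := hx.2
      have hyD : D.symm (c x) ∈ D.source := D.map_target hxD
      obtain ⟨J', hJ'⟩ := hequiv _ (hDs _ hyD)
      have h1 : ContDiffAt ℝ 2 D.symm (c x) := D.contDiffAt_symm hxD hJ' (hG _ (hDs _ hyD))
      exact ((contMDiffAt_iff_contDiffAt.2 h1).comp x
        ((contMDiffOn_of_mem_maximalAtlas hc).contMDiffAt
          (c.open_source.mem_nhds hx.1))).contMDiffWithinAt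
    · intro y hy
      refine ((hFs y (hDs y (het y hy)).1).congr_of_eventuallyEq ?_).contMDiffWithinAt
      filter_upwards [e.open_target.mem_nhds hy] with z hz using hes z hz
  refine ⟨e, hmem, ⟨mem_chart_source _ _, ?_⟩, fun y hy => ?_⟩
  · exact D.map_source hy₀D
  · have hyB : y ∈ B := (hDs y (het y hy)).1
    have hz : coordPair y ∈ Ioo 0 r ×ˢ (univ : Set ℝ) := ⟨hyB, mem_univ _⟩
    have hev : (e.symm : Plane → M) =ᶠ[𝓝 y] F := by
      filter_upwards [e.open_target.mem_nhds hy] with z hz using hes z hz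
    have hgr : ∀ i j, gram e g y i j = g (Φ (coordPair y))
        ![mfderiv 𝓘(ℝ, ℝ × ℝ) (𝓡 2) Φ (coordPair y) (coordPair (stdVec i)),
          mfderiv 𝓘(ℝ, ℝ × ℝ) (𝓡 2) Φ (coordPair y) (coordPair (stdVec j))] := by
      intro i j
      refine (comp_eventuallyEq hev ![i, j]).trans ?_
      congr 1
      funext a
      fin_cases a
      · exact hFd y hyB _
      · exact hFd y hyB _
    refine ⟨hyB, hes y hy, ?_, ?_, ?_⟩
    · rw [hgr, coordPair_stdVec_zero]
      exact h.metric_rho _ hz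
    · rw [hgr, coordPair_stdVec_zero, coordPair_stdVec_one]
      exact h.metric_mixed _ hz
    · rw [hgr, coordPair_stdVec_one]
      exact h.metric_theta _ hz

end IsCylindrical

end CylinderCharts

/-! ### Functions of the radius on a conical end. -/

section Radial

variable {M : Type*} [TopologicalSpace M] [ChartedSpace Plane M] [IsManifold (𝓡 2) 2 M]
variable {e e' : OpenPartialHomeomorph M Plane} {S : Set M} {g : TensorField M 2}

/-- A tensor field is of class `C¹` if this holds in one chart around every point. -/
theorem isCr_one_of_exists_chart {k : ℕ} {u : TensorField M k}
    (h : ∀ x ∈ S, ∃ e ∈ IsManifold.maximalAtlas (𝓡 2) 2 M, x ∈ e.source ∧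
      ∀ I, ContDiffAt ℝ 1 (fun y => comp e u y I) (e x)) : IsCr 1 S u := by
  intro e' he' I y hy
  have he'2 := mem_maximalAtlas he'
  obtain ⟨e, he, hxe, hu⟩ := h _ hy.2
  have hy' : y ∈ transDom e' e := ⟨hy.1, hxe⟩
  have h1 : (fun z => comp e' u z I) =ᶠ[𝓝 y] fun z =>
      ∑ J : Fin k → Fin 2, (∏ a, jac e' e z (J a) (I a)) * comp e u (trans e' e z) J := by
    filter_upwards [isOpen_transDom.mem_nhds hy'] with z hz
    rw [comp_eq_tact he'2 he hz]
    rfl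
  refine (ContDiffAt.congr_of_eventuallyEq ?_ h1).contDiffWithinAt
  refine ContDiffAt.sum fun J _ => ContDiffAt.mul ?_ ?_
  · exact contDiffAt_prod fun a _ => contDiffAt_jac he'2 he hy' _ _
  · exact ContDiffAt.comp y (hu J) ((contDiffAt_trans he'2 he hy').of_le (by norm_num))

theorem contDiffAt_comp_of_eventually_zero {k : ℕ} {u : TensorField M k} {x : M}
    (h : ∀ᶠ x' in 𝓝 x, u x' = 0) (I : Fin k → Fin 2) :
    ContDiffAt ℝ 1 (fun y => comp (chartAt Plane x) u y I) (chartAt Plane x x) := by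
  refine (contDiffAt_const (c := (0 : ℝ))).congr_of_eventuallyEq ?_
  have h1 : Tendsto (chartAt Plane x).symm (𝓝 (chartAt Plane x x)) (𝓝 x) := by
    have := (chartAt Plane x).continuousAt_symm (mem_chart_target Plane x)
    rwa [ContinuousAt, chartAt_symm_apply] at this
  filter_upwards [h1.eventually h] with y hy
  simp only [comp]
  rw [hy]
  rfl

/-- A chart of cylindrical coordinates. -/
structure IsCylChart (g : TensorField M 2) (r : ℝ) (Φ : ℝ × ℝ → M)
    (e : OpenPartialHomeomorph M Plane) : Prop where
  mem : e ∈ IsManifold.maximalAtlas (𝓡 2) 2 M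
  fst_mem : ∀ y ∈ e.target, y 0 ∈ Ioo 0 r
  symm_eq : ∀ y ∈ e.target, e.symm y = Φ (y 0, y 1)
  gram_zero_zero : ∀ y ∈ e.target, gram e g y 0 0 = 1
  gram_zero_one : ∀ y ∈ e.target, gram e g y 0 1 = 0
  gram_one_one : ∀ y ∈ e.target, gram e g y 1 1 = Real.sinh (y 0) ^ 2

/-- The part `ρ < b` of the end with cylindrical coordinates `Φ`. -/
def tube (Φ : ℝ × ℝ → M) (b : ℝ) : Set M := Φ '' (Ioo 0 b ×ˢ univ)

/-- The function that is `F ρ` on the end with cylindrical coordinates `Φ`, and `0` elsewhere. -/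
def radial (Φ : ℝ × ℝ → M) (r : ℝ) (F : ℝ → ℝ) (x : M) : ℝ :=
  open Classical in if h : x ∈ tube Φ r then F h.choose.1 else 0

variable {q : M} {α r : ℝ} {Φ : ℝ × ℝ → M}

theorem radial_of_notMem (F : ℝ → ℝ) {x : M} (h : x ∉ tube Φ r) : radial Φ r F x = 0 :=
  dif_neg h

namespace IsCylindrical

theorem exists_isCylChart (h : IsCylindrical g S q α r Φ) {x : M} (hx : x ∈ tube Φ r) :
    ∃ e, IsCylChart g r Φ e ∧ x ∈ e.source := by
  obtain ⟨⟨ρ, θ⟩, ⟨hρ, -⟩, rfl⟩ := hx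
  obtain ⟨e, he, hx, h2⟩ := h.exists_chart hρ θ
  exact ⟨e, ⟨he, fun y hy => (h2 y hy).1, fun y hy => (h2 y hy).2.1, fun y hy => (h2 y hy).2.2.1,
    fun y hy => (h2 y hy).2.2.2.1, fun y hy => (h2 y hy).2.2.2.2⟩, hx⟩

/-- `radial` picks an arbitrary preimage under Φ. Two preimages of a point differ by a multiple of
the period in θ, so ρ does not depend on the choice. -/
theorem radial_apply (h : IsCylindrical g S q α r Φ) (F : ℝ → ℝ) {ρ : ℝ} (hρ : ρ ∈ Ioo 0 r)
    (θ : ℝ) : radial Φ r F (Φ (ρ, θ)) = F ρ := by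
  have hx : Φ (ρ, θ) ∈ tube Φ r := ⟨_, ⟨hρ, mem_univ _⟩, rfl⟩
  rw [radial, dif_pos hx]
  have h1 := hx.choose_spec
  have h2 := (h.eq_iff hx.choose.1 h1.1.1 ρ hρ hx.choose.2 θ).1 h1.2
  rw [h2.1]

theorem radial_symm_apply (h : IsCylindrical g S q α r Φ) (he : IsCylChart g r Φ e) (F : ℝ → ℝ)
    {y : Plane} (hy : y ∈ e.target) : radial Φ r F (e.symm y) = F (y 0) := by
  rw [he.symm_eq y hy, h.radial_apply F (he.fst_mem y hy)]

theorem symm_mem (h : IsCylindrical g S q α r Φ) (he : IsCylChart g r Φ e) {y : Plane}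
    (hy : y ∈ e.target) : y ∈ chartDom e S :=
  ⟨hy, by rw [mem_preimage, he.symm_eq y hy]; exact h.mem _ ⟨he.fst_mem y hy, mem_univ _⟩⟩

theorem tube_subset (h : IsCylindrical g S q α r Φ) : tube Φ r ⊆ S := by
  rintro _ ⟨z, hz, rfl⟩
  exact h.mem z hz

/-- By periodicity in θ the annulus is already the image of the compact rectangle [a, b] × [0, 2πα].
-/
theorem isCompact_annulus (h : IsCylindrical g S q α r Φ) (hα : 0 < α) {a b : ℝ} (ha : 0 < a)
    (hb : b < r) : IsCompact (Φ '' (Icc a b ×ˢ univ)) := by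
  have hP : 0 < 2 * Real.pi * α := by positivity
  have h1 : Φ '' (Icc a b ×ˢ univ) = Φ '' (Icc a b ×ˢ Icc 0 (2 * Real.pi * α)) := by
    refine Subset.antisymm ?_ (image_mono (Set.prod_mono subset_rfl (subset_univ _)))
    rintro _ ⟨⟨ρ, θ⟩, ⟨hρ, -⟩, rfl⟩
    have hρ' : ρ ∈ Ioo 0 r := ⟨ha.trans_le hρ.1, hρ.2.trans_lt hb⟩
    have h2 := toIcoMod_mem_Ico hP 0 θ
    refine ⟨(ρ, toIcoMod hP 0 θ), ⟨hρ, h2.1, by simpa using h2.2.le⟩, ?_⟩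
    rw [h.eq_iff ρ hρ' ρ hρ']
    refine ⟨rfl, toIcoDiv hP 0 θ, ?_⟩
    have := toIcoMod_add_toIcoDiv_zsmul hP 0 θ
    rw [zsmul_eq_mul] at this
    exact this.symm
  rw [h1]
  refine (isCompact_Icc.prod isCompact_Icc).image_of_continuousOn
    (h.contMDiffOn.continuousOn.mono ?_)
  rintro ⟨ρ, θ⟩ ⟨hρ, -⟩
  exact ⟨⟨ha.trans_le hρ.1, hρ.2.trans_lt hb⟩, mem_univ _⟩

/-- The region 0 < ρ ≤ b is closed in M ∖ {q}. Separate x from q by open sets: the points with ρ < s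
lie in the neighbourhood of q for some s, by `map_eq`, and those with s/2 ≤ ρ ≤ b form a compact
set. This is what allows functions of ρ that vanish for ρ > b to be extended by zero. -/
theorem eventually_notMem_tube [T2Space M] (h : IsCylindrical g S q α r Φ) (hα : 0 < α)
    {b : ℝ} (hb : b < r) {x : M} (hxq : x ≠ q) (hx : x ∉ Φ '' (Ioc 0 b ×ˢ univ)) :
    ∀ᶠ x' in 𝓝 x, x' ∉ Φ '' (Ioc 0 b ×ˢ univ) := by
  obtain ⟨V, U, hV, hU, hxV, hqU, hUV⟩ := t2_separation hxq
  have h1 : U \ {q} ∈ 𝓝[≠] q := sdiff_mem_nhdsWithin_compl (hU.mem_nhds hqU) _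
  rw [← h.map_eq, mem_map] at h1
  obtain ⟨A, hA, B, hB, hAB⟩ := mem_prod_iff.1 h1
  rw [mem_top] at hB
  subst hB
  obtain ⟨s, hs, hsA⟩ := mem_nhdsGT_iff_exists_Ioo_subset.1 hA
  have hc := (h.isCompact_annulus hα (show 0 < s / 2 by have : 0 < s := hs; linarith) hb).isClosed
  have hxc : x ∉ Φ '' (Icc (s / 2) b ×ˢ univ) := fun hx' => hx (by
    have hs0 : 0 < s := hs
    have hI : Icc (s / 2) b ⊆ Ioc 0 b := fun t ht => ⟨by linarith [ht.1], ht.2⟩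
    exact image_mono (Set.prod_mono hI subset_rfl) hx')
  filter_upwards [hV.mem_nhds hxV, hc.isOpen_compl.mem_nhds hxc] with x' hx' hx'c
  rintro ⟨⟨ρ, θ⟩, ⟨hρ, -⟩, rfl⟩
  rcases lt_or_ge ρ s with hρs | hρs
  · have h3 : Φ (ρ, θ) ∈ U \ {q} := hAB (⟨hsA ⟨hρ.1, hρs⟩, mem_univ _⟩ : (ρ, θ) ∈ A ×ˢ univ)
    exact disjoint_left.1 hUV hx' h3.1
  · have hs0 : 0 < s := hs
    exact hx'c ⟨(ρ, θ), ⟨⟨by linarith, hρ.2⟩, mem_univ _⟩, rfl⟩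

theorem eventually_radial_eq_zero [T2Space M] (h : IsCylindrical g S q α r Φ) (hα : 0 < α)
    {b : ℝ} (hb : b < r) {x : M} (hxq : x ≠ q) (hx : x ∉ tube Φ r) :
    ∀ᶠ x' in 𝓝 x, ∀ F : ℝ → ℝ, (∀ ρ, b < ρ → F ρ = 0) → radial Φ r F x' = 0 := by
  have hI : Ioc 0 b ⊆ Ioo 0 r := fun t ht => ⟨ht.1, ht.2.trans_lt hb⟩
  have hx' : x ∉ Φ '' (Ioc 0 b ×ˢ univ) := fun hx' => hx
    (image_mono (Set.prod_mono hI subset_rfl) hx')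
  filter_upwards [h.eventually_notMem_tube hα hb hxq hx'] with x' hx' F hF
  by_cases hxt : x' ∈ tube Φ r
  · obtain ⟨⟨ρ, θ⟩, ⟨hρ, -⟩, rfl⟩ := hxt
    rw [h.radial_apply F hρ]
    refine hF ρ ?_
    by_contra! hρb
    exact hx' ⟨(ρ, θ), ⟨⟨hρ.1, hρb⟩, mem_univ _⟩, rfl⟩
  · exact radial_of_notMem F hxt

/-- A tensor field that vanishes where `ρ > b` and off the end is of class `C¹` if it is so in
cylindrical coordinates. -/
theorem isCr_one_of_isCylChart [T2Space M] (h : IsCylindrical g S q α r Φ)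
    (hα : 0 < α) (hq : q ∉ S) {b : ℝ} (hb : b < r) {k : ℕ} {u : TensorField M k}
    (hu0 : ∀ x, (∀ F : ℝ → ℝ, (∀ ρ, b < ρ → F ρ = 0) → radial Φ r F x = 0) → u x = 0)
    (hu : ∀ e, IsCylChart g r Φ e → ∀ y ∈ e.target, ∀ I,
      ContDiffAt ℝ 1 (fun z => comp e u z I) y) : IsCr 1 S u := by
  refine isCr_one_of_exists_chart fun x hx => ?_
  by_cases hxt : x ∈ tube Φ r
  · obtain ⟨e, he, hxe⟩ := h.exists_isCylChart hxt
    exact ⟨e, he.mem, hxe, fun I => hu e he _ (e.map_source hxe) I⟩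
  -- Off the end the tensor vanishes in a full neighbourhood of the point, because x ∈ S is not the
  -- cone point.
  · refine ⟨chartAt Plane x, chartAt_mem_maximalAtlas x, mem_chart_source _ _, fun I =>
      contDiffAt_comp_of_eventually_zero ?_ I⟩
    filter_upwards [h.eventually_radial_eq_zero hα hb (fun hxq => hq (hxq ▸ hx)) hxt] with x' hx'
    exact hu0 x' hx'

theorem contDiffAt_fst {F : ℝ → ℝ} {y : Plane} {n : WithTop ℕ∞} (hF : ContDiffAt ℝ n F (y 0)) :
    ContDiffAt ℝ n (fun z : Plane => F (z 0)) y :=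
  hF.comp y (EuclideanSpace.proj (0 : Fin 2) : Plane →L[ℝ] ℝ).contDiff.contDiffAt

theorem pderiv_fst {F : ℝ → ℝ} {y : Plane} (hF : DifferentiableAt ℝ F (y 0)) :
    pderiv 0 (fun z : Plane => F (z 0)) y = deriv F (y 0) ∧
      pderiv 1 (fun z : Plane => F (z 0)) y = 0 := by
  have h1 := hF.hasDerivAt.comp_hasFDerivAt y
    (EuclideanSpace.proj (0 : Fin 2) : Plane →L[ℝ] ℝ).hasFDerivAt
  have h2 : fderiv ℝ (fun z : Plane => F (z 0)) y = _ := h1.fderiv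
  constructor
  · rw [pderiv, h2]
    simp [stdVec]
  · rw [pderiv, h2]
    simp [stdVec]

theorem isCr_radial [T2Space M] (h : IsCylindrical g S q α r Φ)
    (hα : 0 < α) (hq : q ∉ S) {b : ℝ} (hb : b < r) {F : ℝ → ℝ}
    (hF : ∀ ρ ∈ Ioo 0 r, ContDiffAt ℝ 1 F ρ) (hF0 : ∀ ρ, b < ρ → F ρ = 0) :
    IsCr 1 S (ofFun (radial Φ r F)) := by
  refine h.isCr_one_of_isCylChart hα hq hb (fun x hx => ?_) fun e he y hy I => ?_
  · rw [ofFun, hx F hF0]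
    rfl
  · refine (contDiffAt_fst (hF _ (he.fst_mem y hy))).congr_of_eventuallyEq ?_
    filter_upwards [e.open_target.mem_nhds hy] with z hz
    rw [comp_ofFun, h.radial_symm_apply he F hz]

theorem comp_symCovDeriv_radial [T2Space M] (h : IsCylindrical g S q α r Φ) (hS : IsOpen S)
    (hα : 0 < α) (hq : q ∉ S) {b : ℝ} (hb : b < r) {F : ℝ → ℝ}
    (hF : ∀ ρ ∈ Ioo 0 r, ContDiffAt ℝ 1 F ρ) (hF0 : ∀ ρ, b < ρ → F ρ = 0)
    (he : IsCylChart g r Φ e) {y : Plane} (hy : y ∈ e.target) :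
    comp e (symCovDeriv g (ofFun (radial Φ r F))) y ![0] = deriv F (y 0) ∧
      comp e (symCovDeriv g (ofFun (radial Φ r F))) y ![1] = 0 := by
  have h1 := comp_symCovDeriv_zero (g := g) hS he.mem (h.symm_mem he hy)
    (h.isCr_radial hα hq hb hF hF0)
  have h2 : (fun z => comp e (ofFun (radial Φ r F)) z ![]) =ᶠ[𝓝 y] fun z => F (z 0) := by
    filter_upwards [e.open_target.mem_nhds hy] with z hz
    rw [comp_ofFun, h.radial_symm_apply he F hz]
  have h3 := pderiv_fst ((hF _ (he.fst_mem y hy)).differentiableAt (by norm_num))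
  rw [h1, h1, pderiv_congr h2, pderiv_congr h2]
  exact h3

end IsCylindrical

end Radial

/-! ### The connection and the pairings in cylindrical coordinates. -/

section CylinderCalculus

variable {M : Type*} [TopologicalSpace M] [ChartedSpace Plane M] [IsManifold (𝓡 2) 2 M]
variable {e : OpenPartialHomeomorph M Plane} {S : Set M} {g : TensorField M 2}
variable {q : M} {α r : ℝ} {Φ : ℝ × ℝ → M}

namespace IsCylChart

theorem sinh_pos (he : IsCylChart g r Φ e) {y : Plane} (hy : y ∈ e.target) :
    0 < Real.sinh (y 0) := Real.sinh_pos_iff.2 (he.fst_mem y hy).1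

theorem gram_one_zero (hg : IsRiem S g) (he : IsCylChart g r Φ e) {y : Plane}
    (hy : y ∈ chartDom e S) : gram e g y 1 0 = 0 := by
  rw [gram_apply_comm (hg.symm _ hy.2), he.gram_zero_one y hy.1]

theorem gramInv_eq (hg : IsRiem S g) (he : IsCylChart g r Φ e) {y : Plane}
    (hy : y ∈ chartDom e S) :
    gramInv e g y 0 0 = 1 ∧ gramInv e g y 0 1 = 0 ∧ gramInv e g y 1 0 = 0 ∧
      gramInv e g y 1 1 = (Real.sinh (y 0) ^ 2)⁻¹ := by
  have hs := he.sinh_pos hy.1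
  have hd : (gram e g y).det = Real.sinh (y 0) ^ 2 := by
    rw [Matrix.det_fin_two, he.gram_zero_zero y hy.1, he.gram_zero_one y hy.1,
      he.gram_one_one y hy.1]
    ring
  simp only [gramInv, gramInv_apply (gram e g y), hd, he.gram_zero_zero y hy.1,
    he.gram_zero_one y hy.1, he.gram_one_one y hy.1, he.gram_one_zero hg hy]
  refine ⟨?_, ?_, ?_, ?_⟩
  · simp
    field_simp
  all_goals simp

theorem pderiv_gram (hg : IsRiem S g) (he : IsCylChart g r Φ e) {y : Plane}
    (hy : y ∈ chartDom e S) (i : Fin 2) :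
    pderiv i (fun z => gram e g z 0 0) y = 0 ∧ pderiv i (fun z => gram e g z 0 1) y = 0 ∧
      pderiv i (fun z => gram e g z 1 0) y = 0 := by
  have hc : ∀ c : ℝ, pderiv i (fun _ => c) y = 0 := fun c => by simp [pderiv]
  refine ⟨?_, ?_, ?_⟩
  · rw [pderiv_congr (f' := fun _ => 1), hc]
    filter_upwards [e.open_target.mem_nhds hy.1] with z hz using he.gram_zero_zero z hz
  · rw [pderiv_congr (f' := fun _ => 0), hc]
    filter_upwards [e.open_target.mem_nhds hy.1] with z hz using he.gram_zero_one z hz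
  · rw [pderiv_congr (f' := fun _ => 0), hc]
    filter_upwards [(isOpen_chartDom hg.isOpen).mem_nhds hy] with z hz
      using he.gram_one_zero hg hz

theorem pderiv_gram_one_one (he : IsCylChart g r Φ e) {y : Plane} (hy : y ∈ e.target) :
    pderiv 0 (fun z => gram e g z 1 1) y = 2 * Real.sinh (y 0) * Real.cosh (y 0) ∧
      pderiv 1 (fun z => gram e g z 1 1) y = 0 := by
  have h1 : (fun z => gram e g z 1 1) =ᶠ[𝓝 y] fun z => (fun t => Real.sinh t ^ 2) (z 0) := by
    filter_upwards [e.open_target.mem_nhds hy] with z hz using he.gram_one_one z hz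
  have h2 : HasDerivAt (fun t => Real.sinh t ^ 2) (2 * Real.sinh (y 0) * Real.cosh (y 0)) (y 0) := by
    simpa using (Real.hasDerivAt_sinh (y 0)).fun_pow 2
  have h3 := IsCylindrical.pderiv_fst h2.differentiableAt
  rw [pderiv_congr h1, pderiv_congr h1, h3.1, h3.2, h2.deriv]
  exact ⟨rfl, rfl⟩

theorem christoffel_eq (hg : IsRiem S g) (he : IsCylChart g r Φ e) {y : Plane}
    (hy : y ∈ chartDom e S) :
    christoffel e g y 0 0 0 = 0 ∧ christoffel e g y 1 0 0 = 0 ∧ christoffel e g y 0 0 1 = 0 ∧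
      christoffel e g y 0 1 0 = 0 ∧ christoffel e g y 1 1 1 = 0 ∧
      christoffel e g y 1 0 1 = Real.cosh (y 0) / Real.sinh (y 0) ∧
      christoffel e g y 1 1 0 = Real.cosh (y 0) / Real.sinh (y 0) ∧
      christoffel e g y 0 1 1 = -(Real.sinh (y 0) * Real.cosh (y 0)) := by
  have hs := he.sinh_pos hy.1
  obtain ⟨w1, w2, w3, w4⟩ := he.gramInv_eq hg hy
  have h0 := he.pderiv_gram hg hy 0
  have h1 := he.pderiv_gram hg hy 1
  have h2 := he.pderiv_gram_one_one hy.1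
  simp only [christoffel, Fin.sum_univ_two, w1, w2, w3, w4, h0.1, h0.2.1, h0.2.2, h1.1, h1.2.1,
    h1.2.2, h2.1, h2.2]
  refine ⟨?_, ?_, ?_, ?_, ?_, ?_, ?_, ?_⟩
  all_goals field_simp
  all_goals ring

theorem cov1_cyl (hg : IsRiem S g) (he : IsCylChart g r Φ e) {y : Plane}
    (hy : y ∈ chartDom e S) (u : TensorField M 1) :
    cov1 e g u y 0 0 = pderiv 0 (fun z => comp e u z ![0]) y ∧
    cov1 e g u y 0 1 = pderiv 0 (fun z => comp e u z ![1]) y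
      - Real.cosh (y 0) / Real.sinh (y 0) * comp e u y ![1] ∧
    cov1 e g u y 1 0 = pderiv 1 (fun z => comp e u z ![0]) y
      - Real.cosh (y 0) / Real.sinh (y 0) * comp e u y ![1] ∧
    cov1 e g u y 1 1 = pderiv 1 (fun z => comp e u z ![1]) y
      + Real.sinh (y 0) * Real.cosh (y 0) * comp e u y ![0] := by
  obtain ⟨c1, c2, c3, c4, c5, c6, c7, c8⟩ := he.christoffel_eq hg hy
  simp only [cov1, Fin.sum_univ_two, c1, c2, c3, c4, c5, c6, c7, c8]
  refine ⟨?_, ?_, ?_, ?_⟩ <;> ring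

theorem tensorInner_one_cyl (hg : IsRiem S g) (he : IsCylChart g r Φ e) {y : Plane}
    (hy : y ∈ chartDom e S) (u v : TensorField M 1) :
    tensorInner g u v (e.symm y) = comp e u y ![0] * comp e v y ![0]
      + comp e u y ![1] * comp e v y ![1] / Real.sinh (y 0) ^ 2 := by
  obtain ⟨w1, w2, w3, w4⟩ := he.gramInv_eq hg hy
  rw [tensorInner_one he.mem hy.1]
  simp only [Fin.sum_univ_two, w1, w2, w3, w4]
  ring

/-- The three summands come from the ρρ, ρθ and θθ components of Sym∇u; the factor 2 counts the two
equal mixed components, and each index θ contributes a factor sinh⁻²ρ. -/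
theorem tensorInner_symCovDeriv_cyl (hg : IsRiem S g) (he : IsCylChart g r Φ e) {y : Plane}
    (hy : y ∈ chartDom e S) {u : TensorField M 1} (hu : IsCr 1 S u) :
    tensorInner g (symCovDeriv g u) (symCovDeriv g u) (e.symm y) =
      pderiv 0 (fun z => comp e u z ![0]) y ^ 2
      + 2 * (1 / 2 * (pderiv 0 (fun z => comp e u z ![1]) y
        + pderiv 1 (fun z => comp e u z ![0]) y)
        - Real.cosh (y 0) / Real.sinh (y 0) * comp e u y ![1]) ^ 2 / Real.sinh (y 0) ^ 2
      + (pderiv 1 (fun z => comp e u z ![1]) y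
        + Real.sinh (y 0) * Real.cosh (y 0) * comp e u y ![0]) ^ 2 / Real.sinh (y 0) ^ 4 := by
  have hs := he.sinh_pos hy.1
  obtain ⟨w1, w2, w3, w4⟩ := he.gramInv_eq hg hy
  obtain ⟨c1, c2, c3, c4⟩ := he.cov1_cyl hg hy u
  rw [tensorInner_two he.mem hy.1]
  simp only [Fin.sum_univ_two, w1, w2, w3, w4, gram_symCovDeriv hg he.mem hy hu, c1, c2, c3, c4]
  field_simp
  ring

theorem val_divergence_cyl (hg : IsRiem S g) (he : IsCylChart g r Φ e) {y : Plane}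
    (hy : y ∈ chartDom e S) {γ : TensorField M 1} (hγ : IsCr 1 S γ) :
    -val (divergence g γ) (e.symm y) = pderiv 0 (fun z => comp e γ z ![0]) y
      + Real.cosh (y 0) / Real.sinh (y 0) * comp e γ y ![0]
      + pderiv 1 (fun z => comp e γ z ![1]) y / Real.sinh (y 0) ^ 2 := by
  have hs := he.sinh_pos hy.1
  obtain ⟨w1, w2, w3, w4⟩ := he.gramInv_eq hg hy
  obtain ⟨c1, c2, c3, c4⟩ := he.cov1_cyl hg hy γ
  rw [val_divergence hg he.mem hγ hy]
  simp only [Fin.sum_univ_two, w1, w2, w3, w4, c1, c2, c3, c4]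
  field_simp
  ring

end IsCylChart

end CylinderCalculus

/-! ### Real inequalities behind the Hardy inequality. -/

section HardyField

theorem cosh_le_two {x : ℝ} (h0 : 0 < x) (h1 : x < 1 / 4) : Real.cosh x ≤ 2 := by
  have h2 := Real.add_one_le_exp (-x)
  have h3 : Real.exp x * Real.exp (-x) = 1 := by rw [← Real.exp_add]; simp
  have h4 := Real.exp_pos x
  have h5 : Real.exp (-x) ≤ 1 := Real.exp_le_one_iff.2 (by linarith)
  rw [Real.cosh_eq]
  nlinarith

theorem sinh_le_two_mul {x : ℝ} (h0 : 0 < x) (h1 : x < 1 / 4) : Real.sinh x ≤ 2 * x := by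
  have h2 := Real.add_one_le_exp (-x)
  have h3 : Real.exp x * Real.exp (-x) = 1 := by rw [← Real.exp_add]; simp
  have h4 := Real.exp_pos x
  have h6 : Real.exp x ≤ 1 + 4 / 3 * x := by nlinarith
  rw [Real.sinh_eq]
  linarith

/-- The bound 1/4 on the radius is below 1/e, so that κ = 1/log(1/ρ) is at most 1. -/
theorem one_le_neg_log {x : ℝ} (h0 : 0 < x) (h1 : x < 1 / 4) : 1 ≤ -Real.log x := by
  have h2 : Real.log x ≤ -1 := by
    rw [Real.log_le_iff_le_exp h0, Real.exp_neg]
    have := Real.exp_one_lt_d9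
    calc x ≤ 4⁻¹ := by linarith
      _ ≤ _ := inv_anti₀ (Real.exp_pos 1) (by linarith)
  linarith

/-- T₁, T₃, T₂ stand for the ρρ, ρθ and θθ components of Sym∇u, w for b/s². The three scalar
products with Sym∇u are absorbed by the squares (aκ + 8sT₁)²/s, (ws + 2T₃)²/s and (a + T₂/s)²/s; the
first explains 64 = 8². The coefficient 8 of a²κ²/ρ is large enough because 1 is spent on T₁, 1 on
T₂, 4 on the term −2ca²/s with c ≤ 2, and 1 is wanted on the left. For w, the term 2w²sc ≥ 2w²s pays
both for the square and for the left side. The last term, from the derivative of κ² in the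
coefficient of b², is nonnegative and is dropped. -/
theorem hardy_bound {ρ s c κ a w T₁ T₂ T₃ : ℝ} (hρ : 0 < ρ) (hs : ρ ≤ s) (hc : 1 ≤ c) (hc2 : c ≤ 2)
    (hκ : 0 < κ) (hκ1 : κ ≤ 1) :
    a ^ 2 * κ ^ 2 / s + w ^ 2 * s * κ ^ 2
        - 64 * s * (T₁ ^ 2 + 2 * T₃ ^ 2 / s ^ 2 + T₂ ^ 2 / s ^ 4) ≤
      8 * a ^ 2 * κ ^ 2 / ρ + 16 * a * T₁ * κ + κ ^ 2 * (4 * w * T₃ + 2 * w ^ 2 * s * c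
        + 2 * T₂ * a / s ^ 2 - 2 * c * a ^ 2 / s) + 2 * w ^ 2 * s ^ 2 * κ ^ 3 / ρ := by
  have hs0 : 0 < s := hρ.trans_le hs
  have hκ2 : κ ^ 2 ≤ 1 := pow_le_one₀ hκ.le hκ1
  have h1 : 0 ≤ a ^ 2 * κ ^ 2 / s + 16 * a * T₁ * κ + 64 * s * T₁ ^ 2 := by
    have : a ^ 2 * κ ^ 2 / s + 16 * a * T₁ * κ + 64 * s * T₁ ^ 2
        = (a * κ + 8 * s * T₁) ^ 2 / s := by field_simp; ring
    rw [this]; positivity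
  have h2 : 0 ≤ w ^ 2 * s + 4 * w * T₃ + 4 * T₃ ^ 2 / s := by
    have : w ^ 2 * s + 4 * w * T₃ + 4 * T₃ ^ 2 / s = (w * s + 2 * T₃) ^ 2 / s := by
      field_simp; ring
    rw [this]; positivity
  have h3 : 0 ≤ a ^ 2 / s + 2 * T₂ * a / s ^ 2 + T₂ ^ 2 / s ^ 3 := by
    have : a ^ 2 / s + 2 * T₂ * a / s ^ 2 + T₂ ^ 2 / s ^ 3 = (a + T₂ / s) ^ 2 / s := by
      field_simp; ring
    rw [this]; positivity
  have h4 : 0 ≤ 4 * (a ^ 2 / s) - 2 * c * a ^ 2 / s := by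
    have : 4 * (a ^ 2 / s) - 2 * c * a ^ 2 / s = 2 * (2 - c) * (a ^ 2 / s) := by ring
    rw [this]
    exact mul_nonneg (by linarith) (by positivity)
  have h5 : 8 * a ^ 2 * κ ^ 2 / s ≤ 8 * a ^ 2 * κ ^ 2 / ρ :=
    div_le_div_of_nonneg_left (by positivity) hρ hs
  have h6 : 0 ≤ 2 * w ^ 2 * s * c - 2 * w ^ 2 * s := by
    have : 2 * w ^ 2 * s * c - 2 * w ^ 2 * s = 2 * w ^ 2 * s * (c - 1) := by ring
    rw [this]
    exact mul_nonneg (by positivity) (by linarith)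
  have h7 : 0 ≤ 2 * w ^ 2 * s ^ 2 * κ ^ 3 / ρ := by positivity
  have h8 : 0 ≤ (1 - κ ^ 2) * (4 * T₃ ^ 2 / s + T₂ ^ 2 / s ^ 3) :=
    mul_nonneg (by linarith) (by positivity)
  have h9 := mul_nonneg (sq_nonneg κ) (add_nonneg (add_nonneg h2 h3) (add_nonneg h4 h6))
  have h10 : 0 ≤ 124 * T₃ ^ 2 / s + 63 * T₂ ^ 2 / s ^ 3 + 2 * a ^ 2 * κ ^ 2 / s := by positivity
  have h11 : 64 * s * (T₁ ^ 2 + 2 * T₃ ^ 2 / s ^ 2 + T₂ ^ 2 / s ^ 4)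
      = 64 * s * T₁ ^ 2 + 128 * T₃ ^ 2 / s + 64 * T₂ ^ 2 / s ^ 3 := by field_simp; ring
  rw [h11]
  have h12 : κ ^ 2 * (w ^ 2 * s + 4 * w * T₃ + 4 * T₃ ^ 2 / s +
      (a ^ 2 / s + 2 * T₂ * a / s ^ 2 + T₂ ^ 2 / s ^ 3) +
      (4 * (a ^ 2 / s) - 2 * c * a ^ 2 / s + (2 * w ^ 2 * s * c - 2 * w ^ 2 * s)))
      = κ ^ 2 * (4 * w * T₃ + 2 * w ^ 2 * s * c + 2 * T₂ * a / s ^ 2 - 2 * c * a ^ 2 / s)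
        + κ ^ 2 * (4 * T₃ ^ 2 / s + T₂ ^ 2 / s ^ 3) + 5 * (a ^ 2 * κ ^ 2 / s)
        - w ^ 2 * s * κ ^ 2 := by ring
  rw [h12] at h9
  have e1 : 8 * a ^ 2 * κ ^ 2 / s = 8 * (a ^ 2 * κ ^ 2 / s) := by ring
  have e2 : 2 * a ^ 2 * κ ^ 2 / s = 2 * (a ^ 2 * κ ^ 2 / s) := by ring
  have e3 : 128 * T₃ ^ 2 / s = 124 * T₃ ^ 2 / s + 4 * T₃ ^ 2 / s := by ring
  have e4 : 64 * T₂ ^ 2 / s ^ 3 = 63 * T₂ ^ 2 / s ^ 3 + T₂ ^ 2 / s ^ 3 := by ring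
  have e5 : (1 - κ ^ 2) * (4 * T₃ ^ 2 / s + T₂ ^ 2 / s ^ 3) = 4 * T₃ ^ 2 / s + T₂ ^ 2 / s ^ 3
    - κ ^ 2 * (4 * T₃ ^ 2 / s + T₂ ^ 2 / s ^ 3) := by ring
  have h13 : 0 ≤ a ^ 2 * κ ^ 2 / s := by positivity
  rw [e1] at h5
  rw [e5] at h8
  rw [e3, e4]
  have h14 : 0 ≤ 124 * T₃ ^ 2 / s := by positivity
  have h15 : 0 ≤ 63 * T₂ ^ 2 / s ^ 3 := by positivity
  linarith

/-- The pointwise inequality behind the Hardy inequality, in cylindrical coordinates. -/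
theorem hardy_pointwise {ρ s c κ a b ψ ψ' C p₀₀ p₀₁ p₁₀ p₁₁ : ℝ} (hρ : 0 < ρ) (hs : ρ ≤ s)
    (hc : 1 ≤ c) (hc2 : c ≤ 2) (hκ : 0 < κ) (hκ1 : κ ≤ 1) (hψ : 0 ≤ ψ) (hC : 0 ≤ C)
    (hψ' : -(C * ρ) ≤ ψ') :
    ψ * ((a ^ 2 + b ^ 2 / s ^ 2) * κ ^ 2 / s ^ 2
        - 64 * (p₀₀ ^ 2 + 2 * (1 / 2 * (p₀₁ + p₁₀) - c / s * b) ^ 2 / s ^ 2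
          + (p₁₁ + s * c * a) ^ 2 / s ^ 4)) - 8 * C * (a ^ 2 + b ^ 2 / s ^ 2) ≤
      8 * (ψ' * (κ / s) + ψ * (κ ^ 2 / ρ / s - κ * c / s ^ 2)) * a ^ 2
        + 8 * ψ * κ / s * (2 * a * p₀₀)
        + (ψ' * (κ ^ 2 / s ^ 3) + ψ * (2 * κ ^ 3 / ρ / s ^ 3 - 3 * κ ^ 2 * c / s ^ 4)) * b ^ 2
        + ψ * κ ^ 2 / s ^ 3 * (2 * b * p₀₁)
        + c / s * (8 * ψ * κ / s * a ^ 2 + ψ * κ ^ 2 / s ^ 3 * b ^ 2)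
        + 2 * ψ * κ ^ 2 / s * (p₁₀ * b + a * p₁₁) / s ^ 2 := by
  have hs0 : 0 < s := hρ.trans_le hs
  have hκ2 : κ ^ 2 ≤ 1 := pow_le_one₀ hκ.le hκ1
  -- T₂ and T₃ are the θθ and ρθ components of Sym∇u, and w is the θ component of the dual vector
  -- field. The derivatives ∂_ρ b and ∂_θ a have the same coefficient on the right, so they can be
  -- traded for T₃. This trade contributes +4c b²κ²/s⁴, which overcomes the −2c b²κ²/s⁴ due to the
  -- powers of s.
  set T₂ := p₁₁ + s * c * a with hT₂
  set T₃ := 1 / 2 * (p₀₁ + p₁₀) - c / s * b with hT₃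
  set w := b / s ^ 2 with hw
  have h1 := mul_le_mul_of_nonneg_left
    (hardy_bound (a := a) (w := w) (T₁ := p₀₀) (T₂ := T₂) (T₃ := T₃) hρ hs hc hc2 hκ hκ1)
    (div_nonneg hψ hs0.le)
  -- The coefficient of ψ' is nonnegative, so a lower bound on ψ' is enough. The loss Cρ/s is at
  -- most C because ρ ≤ s.
  have h2 : 0 ≤ (ψ' + C * ρ) * ((8 * a ^ 2 * κ + w ^ 2 * s ^ 2 * κ ^ 2) / s) :=
    mul_nonneg (by linarith) (by positivity)
  have h3 : C * ρ * ((8 * a ^ 2 * κ + w ^ 2 * s ^ 2 * κ ^ 2) / s)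
      ≤ 8 * C * (a ^ 2 + b ^ 2 / s ^ 2) := by
    have h4 : 8 * a ^ 2 * κ + w ^ 2 * s ^ 2 * κ ^ 2 ≤ 8 * (a ^ 2 + b ^ 2 / s ^ 2) := by
      have h5 : w ^ 2 * s ^ 2 = b ^ 2 / s ^ 2 := by rw [hw]; field_simp
      rw [h5]
      have h6 : a ^ 2 * κ ≤ a ^ 2 := mul_le_of_le_one_right (sq_nonneg a) hκ1
      have h7 : b ^ 2 / s ^ 2 * κ ^ 2 ≤ b ^ 2 / s ^ 2 :=
        mul_le_of_le_one_right (by positivity) hκ2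
      have h8 : 0 ≤ b ^ 2 / s ^ 2 := by positivity
      linarith
    have h5 : ρ / s ≤ 1 := (div_le_one hs0).2 hs
    calc _ = C * (ρ / s * (8 * a ^ 2 * κ + w ^ 2 * s ^ 2 * κ ^ 2)) := by ring
      _ ≤ C * (1 * (8 * (a ^ 2 + b ^ 2 / s ^ 2))) := by gcongr
      _ = _ := by ring
  have e1 : p₀₁ = 2 * T₃ + 2 * (c / s) * b - p₁₀ := by rw [hT₃]; ring
  have e2 : p₁₁ = T₂ - s * c * a := by rw [hT₂]; ring
  have e3 : b = w * s ^ 2 := by rw [hw]; field_simp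
  have e4 : ψ / s * (a ^ 2 * κ ^ 2 / s + w ^ 2 * s * κ ^ 2
        - 64 * s * (p₀₀ ^ 2 + 2 * T₃ ^ 2 / s ^ 2 + T₂ ^ 2 / s ^ 4))
      = ψ * ((a ^ 2 + b ^ 2 / s ^ 2) * κ ^ 2 / s ^ 2
        - 64 * (p₀₀ ^ 2 + 2 * T₃ ^ 2 / s ^ 2 + T₂ ^ 2 / s ^ 4)) := by
    rw [hw]; field_simp
  have e5 : 8 * (ψ' * (κ / s) + ψ * (κ ^ 2 / ρ / s - κ * c / s ^ 2)) * a ^ 2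
        + 8 * ψ * κ / s * (2 * a * p₀₀)
        + (ψ' * (κ ^ 2 / s ^ 3) + ψ * (2 * κ ^ 3 / ρ / s ^ 3 - 3 * κ ^ 2 * c / s ^ 4)) * b ^ 2
        + ψ * κ ^ 2 / s ^ 3 * (2 * b * p₀₁)
        + c / s * (8 * ψ * κ / s * a ^ 2 + ψ * κ ^ 2 / s ^ 3 * b ^ 2)
        + 2 * ψ * κ ^ 2 / s * (p₁₀ * b + a * p₁₁) / s ^ 2
      = ψ' * ((8 * a ^ 2 * κ + w ^ 2 * s ^ 2 * κ ^ 2) / s) +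
        ψ / s * (8 * a ^ 2 * κ ^ 2 / ρ + 16 * a * p₀₀ * κ + κ ^ 2 * (4 * w * T₃ + 2 * w ^ 2 * s * c
        + 2 * T₂ * a / s ^ 2 - 2 * c * a ^ 2 / s) + 2 * w ^ 2 * s ^ 2 * κ ^ 3 / ρ) := by
    clear_value T₂ T₃ w
    rw [e1, e2, e3]
    field_simp
    ring
  rw [e5]
  rw [e4] at h1
  rw [add_mul] at h2
  linarith

end HardyField

/-! ### The vector field of the Hardy inequality and its divergence. -/

section HardyInequality

variable {M : Type*} [TopologicalSpace M] [ChartedSpace Plane M] [IsManifold (𝓡 2) 2 M]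
variable {e : OpenPartialHomeomorph M Plane} {S : Set M} {g : TensorField M 2}
variable {q : M} {α r b : ℝ} {Φ : ℝ × ℝ → M} {F₀ ψ : ℝ → ℝ} {u : TensorField M 1}

/-- The inverse of `log (1 / ρ)`. -/
def invLog (ρ : ℝ) : ℝ := (-Real.log ρ)⁻¹

theorem invLog_pos {ρ : ℝ} (h0 : 0 < ρ) (h1 : ρ < 1 / 4) : 0 < invLog ρ :=
  inv_pos.2 (by linarith [one_le_neg_log h0 h1])

theorem invLog_le_one {ρ : ℝ} (h0 : 0 < ρ) (h1 : ρ < 1 / 4) : invLog ρ ≤ 1 :=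
  inv_le_one_of_one_le₀ (one_le_neg_log h0 h1)

theorem hasDerivAt_invLog {ρ : ℝ} (h0 : 0 < ρ) (h1 : ρ < 1 / 4) :
    HasDerivAt invLog (invLog ρ ^ 2 / ρ) ρ := by
  have h2 : -Real.log ρ ≠ 0 := by linarith [one_le_neg_log h0 h1]
  refine ((Real.hasDerivAt_log h0.ne').fun_neg.fun_inv h2).congr_deriv ?_
  rw [invLog]
  field_simp

theorem contDiffAt_invLog {ρ : ℝ} (h0 : 0 < ρ) (h1 : ρ < 1 / 4) : ContDiffAt ℝ 1 invLog ρ :=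
  (Real.contDiffAt_log.2 h0.ne').neg.inv (by linarith [one_le_neg_log h0 h1])

theorem contDiffAt_inv_sinh {ρ : ℝ} (h0 : 0 < ρ) : ContDiffAt ℝ 1 (fun t => (Real.sinh t)⁻¹) ρ :=
  Real.contDiff_sinh.contDiffAt.inv (Real.sinh_pos_iff.2 h0).ne'

theorem hasDerivAt_inv_sinh {ρ : ℝ} (h0 : 0 < ρ) :
    HasDerivAt (fun t => (Real.sinh t)⁻¹) (-Real.cosh ρ / Real.sinh ρ ^ 2) ρ :=
  (Real.hasDerivAt_sinh ρ).fun_inv (Real.sinh_pos_iff.2 h0).ne'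

/-- The first coefficient of the field in the Hardy inequality. -/
def hardyCoeff₁ (ψ : ℝ → ℝ) (ρ : ℝ) : ℝ := 8 * (ψ ρ * (invLog ρ * (Real.sinh ρ)⁻¹))

/-- The second coefficient of the field in the Hardy inequality. -/
def hardyCoeff₂ (ψ : ℝ → ℝ) (ρ : ℝ) : ℝ := ψ ρ * (invLog ρ ^ 2 * (Real.sinh ρ)⁻¹)

/-- The weight in the Hardy inequality. -/
def hardyWeight (ψ : ℝ → ℝ) (ρ : ℝ) : ℝ := ψ ρ * (invLog ρ ^ 2 * (Real.sinh ρ)⁻¹ ^ 2)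

/-- The field whose divergence yields the Hardy inequality. -/
def hardyField (g : TensorField M 2) (r : ℝ) (Φ : ℝ × ℝ → M) (F₀ ψ : ℝ → ℝ)
    (u : TensorField M 1) : TensorField M 1 := fun x =>
  ((radial Φ r (hardyCoeff₁ ψ) x - 3 * radial Φ r (hardyCoeff₂ ψ) x) *
      tensorInner g u (symCovDeriv g (ofFun (radial Φ r F₀))) x ^ 2 +
    radial Φ r (hardyCoeff₂ ψ) x * tensorInner g u u x) •
      symCovDeriv g (ofFun (radial Φ r F₀)) x +
  (2 * radial Φ r (hardyCoeff₂ ψ) x *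
    tensorInner g u (symCovDeriv g (ofFun (radial Φ r F₀))) x) • u x

theorem contDiffAt_hardyCoeff₁ {ρ : ℝ} (h0 : 0 < ρ) (h1 : ρ < 1 / 4) (hψ : ContDiffAt ℝ 1 ψ ρ) :
    ContDiffAt ℝ 1 (hardyCoeff₁ ψ) ρ :=
  contDiffAt_const.mul (hψ.mul ((contDiffAt_invLog h0 h1).mul (contDiffAt_inv_sinh h0)))

theorem contDiffAt_hardyCoeff₂ {ρ : ℝ} (h0 : 0 < ρ) (h1 : ρ < 1 / 4) (hψ : ContDiffAt ℝ 1 ψ ρ) :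
    ContDiffAt ℝ 1 (hardyCoeff₂ ψ) ρ :=
  hψ.mul (((contDiffAt_invLog h0 h1).pow 2).mul (contDiffAt_inv_sinh h0))

theorem contDiffAt_hardyWeight {ρ : ℝ} (h0 : 0 < ρ) (h1 : ρ < 1 / 4) (hψ : ContDiffAt ℝ 1 ψ ρ) :
    ContDiffAt ℝ 1 (hardyWeight ψ) ρ :=
  hψ.mul (((contDiffAt_invLog h0 h1).pow 2).mul ((contDiffAt_inv_sinh h0).pow 2))

variable [T2Space M]

/-- The invariant expression is arranged to give these components when d`F₀` = dρ: the three
contributions of `hardyCoeff₂` to the a² term are 1, 2 and −3 and cancel, leaving `hardyCoeff₁`. The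
mixed component has the coefficient that pairs ∂_θ a with ∂_ρ b symmetrically in the divergence. -/
theorem comp_hardyField (hg : IsRiem S g) (h : IsCylindrical g S q α r Φ)
    (hα : 0 < α) (hq : q ∉ S) {b' : ℝ} (hb' : b' < r) (hF : ∀ ρ ∈ Ioo 0 r, ContDiffAt ℝ 1 F₀ ρ)
    (hF0 : ∀ ρ, b' < ρ → F₀ ρ = 0) (hF1 : ∀ ρ ∈ Ioc 0 b, deriv F₀ ρ = 1)
    (hψ0 : ∀ ρ, b < ρ → ψ ρ = 0) (he : IsCylChart g r Φ e) {y : Plane} (hy : y ∈ e.target) :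
    comp e (hardyField g r Φ F₀ ψ u) y ![0] =
      hardyCoeff₁ ψ (y 0) * comp e u y ![0] ^ 2
        + hardyWeight ψ (y 0) * (Real.sinh (y 0))⁻¹ * comp e u y ![1] ^ 2 ∧
    comp e (hardyField g r Φ F₀ ψ u) y ![1] =
      2 * hardyCoeff₂ ψ (y 0) * (comp e u y ![0] * comp e u y ![1]) := by
  have hs := he.sinh_pos hy
  have hyS := h.symm_mem he hy
  obtain ⟨d0, d1⟩ := h.comp_symCovDeriv_radial hg.isOpen hα hq hb' hF hF0 he hy
  have hc : ∀ I, comp e (hardyField g r Φ F₀ ψ u) y I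
      = ((radial Φ r (hardyCoeff₁ ψ) (e.symm y) - 3 * radial Φ r (hardyCoeff₂ ψ) (e.symm y)) *
      tensorInner g u (symCovDeriv g (ofFun (radial Φ r F₀))) (e.symm y) ^ 2 +
    radial Φ r (hardyCoeff₂ ψ) (e.symm y) * tensorInner g u u (e.symm y)) *
      comp e (symCovDeriv g (ofFun (radial Φ r F₀))) y I +
  (2 * radial Φ r (hardyCoeff₂ ψ) (e.symm y) *
    tensorInner g u (symCovDeriv g (ofFun (radial Φ r F₀))) (e.symm y)) * comp e u y I :=
    fun I => rfl
  rw [hc, hc]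
  simp only [h.radial_symm_apply he _ hy, he.tensorInner_one_cyl hg hyS, d0, d1]
  -- For ρ > b the form d`F₀` need not be dρ, but there ψ and hence the field vanish.
  rcases le_or_gt (y 0) b with hyb | hyb
  · rw [hF1 _ ⟨(he.fst_mem y hy).1, hyb⟩]
    simp only [hardyCoeff₂, hardyWeight]
    constructor
    · field_simp
      ring
    · ring
  · simp only [hardyCoeff₁, hardyCoeff₂, hardyWeight, hψ0 _ hyb]
    constructor <;> ring

/-- A priori d`F₀` is only continuous. The explicit components in cylindrical charts, in which d`F₀`
no longer appears, are C¹. -/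
theorem isCr_hardyField (hg : IsRiem S g) (h : IsCylindrical g S q α r Φ) (hr : r ≤ 1 / 4)
    (hα : 0 < α) (hq : q ∉ S) {b' : ℝ} (hb' : b' < r) (hF : ∀ ρ ∈ Ioo 0 r, ContDiffAt ℝ 1 F₀ ρ)
    (hF0 : ∀ ρ, b' < ρ → F₀ ρ = 0) (hF1 : ∀ ρ ∈ Ioc 0 b, deriv F₀ ρ = 1) (hb : b < r)
    (hψ : ∀ ρ ∈ Ioo 0 r, ContDiffAt ℝ 1 ψ ρ) (hψ0 : ∀ ρ, b < ρ → ψ ρ = 0) (hu : IsCr 1 S u) :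
    IsCr 1 S (hardyField g r Φ F₀ ψ u) := by
  refine h.isCr_one_of_isCylChart hα hq hb (fun x hx => ?_) fun e he y hy I => ?_
  · have h1 := hx (hardyCoeff₁ ψ) fun ρ hρ => by simp [hardyCoeff₁, hψ0 ρ hρ]
    have h2 := hx (hardyCoeff₂ ψ) fun ρ hρ => by simp [hardyCoeff₂, hψ0 ρ hρ]
    simp [hardyField, h1, h2]
  · have hρ := he.fst_mem y hy
    have hρ4 : y 0 < 1 / 4 := hρ.2.trans_le hr
    have hcu := fun I => contDiffAt_comp le_rfl hg.isOpen hu he.mem (h.symm_mem he hy) I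
    have c1 := IsCylindrical.contDiffAt_fst (contDiffAt_hardyCoeff₁ hρ.1 hρ4 (hψ _ hρ))
    have c2 := IsCylindrical.contDiffAt_fst (contDiffAt_hardyCoeff₂ hρ.1 hρ4 (hψ _ hρ))
    have c3 := IsCylindrical.contDiffAt_fst (contDiffAt_hardyWeight hρ.1 hρ4 (hψ _ hρ))
    have c4 := IsCylindrical.contDiffAt_fst (contDiffAt_inv_sinh hρ.1)
    rw [fin_one_eq I]
    generalize I 0 = i
    fin_cases i
    · refine ((c1.mul ((hcu ![0]).pow 2)).add ((c3.mul c4).mul ((hcu ![1]).pow 2)))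
        |>.congr_of_eventuallyEq ?_
      filter_upwards [e.open_target.mem_nhds hy] with z hz
      exact (comp_hardyField hg h hα hq hb' hF hF0 hF1 hψ0 he hz).1
    · refine (((contDiffAt_const (c := (2 : ℝ))).mul c2).mul ((hcu ![0]).mul (hcu ![1])))
        |>.congr_of_eventuallyEq ?_
      filter_upwards [e.open_target.mem_nhds hy] with z hz
      exact (comp_hardyField hg h hα hq hb' hF hF0 hF1 hψ0 he hz).2

/-- This is `hardy_pointwise` with κ = `invLog`, s = sinh ρ and c = cosh ρ, once the derivatives of
the components are computed. The sign of `divergence` is opposite to that of the trace divergence,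
hence the minus sign. -/
theorem hardy_divergence (hg : IsRiem S g) (h : IsCylindrical g S q α r Φ) (hr : r ≤ 1 / 4)
    (hα : 0 < α) (hq : q ∉ S) {b' : ℝ} (hb' : b' < r) (hF : ∀ ρ ∈ Ioo 0 r, ContDiffAt ℝ 1 F₀ ρ)
    (hF0 : ∀ ρ, b' < ρ → F₀ ρ = 0) (hF1 : ∀ ρ ∈ Ioc 0 b, deriv F₀ ρ = 1) (hb : b < r)
    (hψ : ∀ ρ ∈ Ioo 0 r, ContDiffAt ℝ 1 ψ ρ) (hψ0 : ∀ ρ, b < ρ → ψ ρ = 0) (hu : IsCr 1 S u)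
    (hψ1 : ∀ ρ, ψ ρ ∈ Icc (0 : ℝ) 1) {C : ℝ} (hC : 0 ≤ C)
    (hψC : ∀ ρ ∈ Ioo 0 r, -(C * ρ) ≤ deriv ψ ρ) {x : M} (hx : x ∈ tube Φ r) :
    radial Φ r (hardyWeight ψ) x * tensorInner g u u x ≤
      -val (divergence g (hardyField g r Φ F₀ ψ u)) x
      + 64 * tensorInner g (symCovDeriv g u) (symCovDeriv g u) x
      + 8 * C * tensorInner g u u x := by
  obtain ⟨e, he, hxe⟩ := h.exists_isCylChart hx
  obtain ⟨y, hy, rfl⟩ : ∃ y ∈ e.target, e.symm y = x := ⟨e x, e.map_source hxe, e.left_inv hxe⟩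
  have hyS := h.symm_mem he hy
  have hρ := he.fst_mem y hy
  have hρ4 : y 0 < 1 / 4 := hρ.2.trans_le hr
  have hQ := tensorInner_self_nonneg hg hyS.2 (symCovDeriv g u)
  have hcu := fun I => (contDiffAt_comp le_rfl hg.isOpen hu he.mem hyS I).differentiableAt
    one_ne_zero
  rw [he.val_divergence_cyl hg hyS (isCr_hardyField hg h hr hα hq hb' hF hF0 hF1 hb hψ hψ0 hu),
    (comp_hardyField hg h hα hq hb' hF hF0 hF1 hψ0 he hy).1]
  have d1 := ((hψ _ hρ).differentiableAt one_ne_zero).hasDerivAt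
  have d2 := hasDerivAt_invLog hρ.1 hρ4
  have d3 := hasDerivAt_inv_sinh hρ.1
  have f1 : HasDerivAt (hardyCoeff₁ ψ) _ (y 0) := (d1.fun_mul (d2.fun_mul d3)).const_mul 8
  have f2 : HasDerivAt (fun t => hardyWeight ψ t * (Real.sinh t)⁻¹) _ (y 0) :=
    (d1.fun_mul ((d2.fun_pow 2).fun_mul (d3.fun_pow 2))).fun_mul d3
  have g1 := IsCylindrical.pderiv_fst f1.differentiableAt
  have g2 := IsCylindrical.pderiv_fst f2.differentiableAt
  have c1 := (IsCylindrical.contDiffAt_fst (contDiffAt_hardyCoeff₁ hρ.1 hρ4 (hψ _ hρ))).differentiableAt one_ne_zero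
  have c2 := (contDiffAt_const (c := (2 : ℝ)) |>.mul (IsCylindrical.contDiffAt_fst
    (contDiffAt_hardyCoeff₂ hρ.1 hρ4 (hψ _ hρ)))).differentiableAt one_ne_zero
  have c3 := (IsCylindrical.contDiffAt_fst ((contDiffAt_hardyWeight hρ.1 hρ4 (hψ _ hρ)).mul
    (contDiffAt_inv_sinh hρ.1))).differentiableAt one_ne_zero
  have g3 := (IsCylindrical.pderiv_fst (F := fun t => 2 * hardyCoeff₂ ψ t) ((contDiffAt_const.mul
    (contDiffAt_hardyCoeff₂ hρ.1 hρ4 (hψ _ hρ))).differentiableAt one_ne_zero)).2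
  have k0 : pderiv 0 (fun z => comp e (hardyField g r Φ F₀ ψ u) z ![0]) y =
      deriv (hardyCoeff₁ ψ) (y 0) * comp e u y ![0] ^ 2 + hardyCoeff₁ ψ (y 0) *
        (2 * comp e u y ![0] * pderiv 0 (fun z => comp e u z ![0]) y)
      + (deriv (fun t => hardyWeight ψ t * (Real.sinh t)⁻¹) (y 0) * comp e u y ![1] ^ 2
        + hardyWeight ψ (y 0) * (Real.sinh (y 0))⁻¹ *
        (2 * comp e u y ![1] * pderiv 0 (fun z => comp e u z ![1]) y)) := by
    rw [pderiv_congr (f' := fun z => hardyCoeff₁ ψ (z 0) * (comp e u z ![0] * comp e u z ![0])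
        + (hardyWeight ψ (z 0) * (Real.sinh (z 0))⁻¹) * (comp e u z ![1] * comp e u z ![1]))]
    · rw [pderiv_add (c1.fun_mul ((hcu _).fun_mul (hcu _))) (c3.fun_mul ((hcu _).fun_mul (hcu _))),
        pderiv_mul c1 ((hcu _).fun_mul (hcu _)), pderiv_mul c3 ((hcu _).fun_mul (hcu _)),
        pderiv_mul (hcu _) (hcu _), pderiv_mul (hcu _) (hcu _), g1.1, g2.1]
      ring
    · filter_upwards [e.open_target.mem_nhds hy] with z hz
      rw [(comp_hardyField hg h hα hq hb' hF hF0 hF1 hψ0 he hz).1]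
      ring
  have k1 : pderiv 1 (fun z => comp e (hardyField g r Φ F₀ ψ u) z ![1]) y =
      2 * hardyCoeff₂ ψ (y 0) * (pderiv 1 (fun z => comp e u z ![0]) y * comp e u y ![1]
        + comp e u y ![0] * pderiv 1 (fun z => comp e u z ![1]) y) := by
    rw [pderiv_congr (f' := fun z => (2 * hardyCoeff₂ ψ (z 0)) *
      (comp e u z ![0] * comp e u z ![1]))]
    · rw [pderiv_mul c2 ((hcu _).fun_mul (hcu _)), pderiv_mul (hcu _) (hcu _), g3]
      ring
    · filter_upwards [e.open_target.mem_nhds hy] with z hz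
      rw [(comp_hardyField hg h hα hq hb' hF hF0 hF1 hψ0 he hz).2]
  rw [k0, k1, f1.deriv, f2.deriv, h.radial_symm_apply he _ hy]
  -- The pointwise inequality carries ψ in front of |Sym∇u|²; ψ ≤ 1 removes it.
  have hQ2 := mul_le_of_le_one_left hQ (hψ1 (y 0)).2
  rw [he.tensorInner_symCovDeriv_cyl hg hyS hu] at hQ2 ⊢
  rw [he.tensorInner_one_cyl hg hyS]
  have key := hardy_pointwise (a := comp e u y ![0]) (b := comp e u y ![1])
    (p₀₀ := pderiv 0 (fun z => comp e u z ![0]) y) (p₀₁ := pderiv 0 (fun z => comp e u z ![1]) y)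
    (p₁₀ := pderiv 1 (fun z => comp e u z ![0]) y) (p₁₁ := pderiv 1 (fun z => comp e u z ![1]) y)
    hρ.1 (Real.self_le_sinh_iff.2 hρ.1.le) (Real.one_le_cosh _) (cosh_le_two hρ.1 hρ4)
    (invLog_pos hρ.1 hρ4) (invLog_le_one hρ.1 hρ4) (hψ1 (y 0)).1 hC (hψC _ hρ)
  have hs := he.sinh_pos hy
  have hρ0 := hρ.1
  simp only [hardyCoeff₁, hardyCoeff₂, hardyWeight]
  generalize pderiv 0 (fun z => comp e u z ![0]) y = p₀₀ at *
  generalize pderiv 0 (fun z => comp e u z ![1]) y = p₀₁ at *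
  generalize pderiv 1 (fun z => comp e u z ![0]) y = p₁₀ at *
  generalize pderiv 1 (fun z => comp e u z ![1]) y = p₁₁ at *
  generalize comp e u y ![0] = A at *
  generalize comp e u y ![1] = B at *
  generalize deriv ψ (y 0) = ψ' at *
  generalize ψ (y 0) = ψv at *
  generalize invLog (y 0) = κ at *
  generalize Real.sinh (y 0) = s at *
  generalize Real.cosh (y 0) = c at *
  generalize y 0 = ρ at *
  clear d1 d2 d3 f1 f2 g1 g2 c1 c2 c3 g3 k0 k1 hcu
  refine le_trans (le_of_eq ?_) (add_le_add (add_le_add (key.trans (le_of_eq ?_))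
    (mul_le_mul_of_nonneg_left hQ2 (show (0 : ℝ) ≤ 64 by norm_num))) le_rfl)
  · field_simp
    ring
  · simp only [Nat.add_one_sub_one, pow_one, Nat.cast_ofNat]
    field_simp
    ring

end HardyInequality

/-! ### Integration of the Hardy inequality. -/

section HardyIntegral

theorem exists_abs_deriv_smoothTransition_le :
    ∃ C : ℝ, 0 ≤ C ∧ ∀ x, |deriv Real.smoothTransition x| ≤ C := by
  have h1 : Continuous (deriv Real.smoothTransition) :=
    (Real.smoothTransition.contDiff (n := 1)).continuous_deriv (by norm_num)
  obtain ⟨C, hC⟩ := isCompact_Icc.exists_bound_of_continuousOn (s := Icc (0 : ℝ) 1)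
    h1.continuousOn
  refine ⟨C, (norm_nonneg _).trans (hC 0 (by simp)), fun x => ?_⟩
  have hC0 : 0 ≤ C := (norm_nonneg _).trans (hC 0 (by simp))
  rcases lt_or_ge x 0 with hx | hx
  · have : Real.smoothTransition =ᶠ[𝓝 x] fun _ => 0 := by
      filter_upwards [eventually_lt_nhds hx] with t ht
        using Real.smoothTransition.zero_of_nonpos ht.le
    rw [this.deriv_eq]
    simpa using hC0
  rcases lt_or_ge 1 x with hx1 | hx1
  · have : Real.smoothTransition =ᶠ[𝓝 x] fun _ => 1 := by
      filter_upwards [eventually_gt_nhds hx1] with t ht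
        using Real.smoothTransition.one_of_one_le ht.le
    rw [this.deriv_eq]
    simpa using hC0
  · exact hC x ⟨hx, hx1⟩

theorem hasDerivAt_smoothTransition_comp {f : ℝ → ℝ} {f' x : ℝ} (hf : HasDerivAt f f' x) :
    HasDerivAt (fun t => Real.smoothTransition (f t))
      (deriv Real.smoothTransition (f x) * f') x :=
  HasDerivAt.comp x ((Real.smoothTransition.contDiffAt (n := 1)).differentiableAt
    one_ne_zero).hasDerivAt hf

/-- A cutoff function of the radius. -/
def cutoff (r ρ : ℝ) : ℝ := Real.smoothTransition (2 - 32 / r ^ 2 * ρ ^ 2)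

theorem cutoff_eq_one {r ρ : ℝ} (h0 : 0 < ρ) (h : ρ < r / 8) : cutoff r ρ = 1 := by
  have hr : 0 < r := by linarith
  refine Real.smoothTransition.one_of_one_le ?_
  have : 32 / r ^ 2 * ρ ^ 2 ≤ 1 := by
    rw [div_mul_eq_mul_div, div_le_one (by positivity)]
    nlinarith
  linarith

theorem cutoff_eq_zero {r ρ : ℝ} (hr : 0 < r) (h : r / 4 < ρ) : cutoff r ρ = 0 := by
  refine Real.smoothTransition.zero_of_nonpos ?_
  have : 2 ≤ 32 / r ^ 2 * ρ ^ 2 := by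
    rw [div_mul_eq_mul_div, le_div_iff₀ (by positivity)]
    nlinarith
  linarith

variable {M : Type*} [TopologicalSpace M] [ChartedSpace Plane M] [IsManifold (𝓡 2) 2 M]
variable [MeasurableSpace M] [BorelSpace M] [CompactSpace M] [T2Space M] [IsManifold (𝓡 2) ∞ M]
variable {e : OpenPartialHomeomorph M Plane} {S : Set M} {g : TensorField M 2}
variable {q : M} {α r b : ℝ} {Φ : ℝ × ℝ → M} {F₀ ψ : ℝ → ℝ} {u : TensorField M 1}

theorem radial_nonneg (h : IsCylindrical g S q α r Φ) {F : ℝ → ℝ} (hF : ∀ ρ, 0 ≤ F ρ) (x : M) :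
    0 ≤ radial Φ r F x := by
  by_cases hx : x ∈ tube Φ r
  · obtain ⟨⟨ρ, θ⟩, ⟨hρ, -⟩, rfl⟩ := hx
    rw [h.radial_apply F hρ]
    exact hF ρ
  · rw [radial_of_notMem F hx]

theorem hardyWeight_nonneg (hψ1 : ∀ ρ, ψ ρ ∈ Icc (0 : ℝ) 1) (ρ : ℝ) : 0 ≤ hardyWeight ψ ρ :=
  mul_nonneg (hψ1 ρ).1 (by positivity)

theorem radial_eq_zero_of_notMem_annulus (h : IsCylindrical g S q α r Φ) {F : ℝ → ℝ} {ε : ℝ}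
    (hF : ∀ ρ, ρ ∉ Icc ε b → F ρ = 0) {x : M} (hx : x ∉ Φ '' (Icc ε b ×ˢ univ)) :
    radial Φ r F x = 0 := by
  by_cases hxt : x ∈ tube Φ r
  · obtain ⟨⟨ρ, θ⟩, ⟨hρ, -⟩, rfl⟩ := hxt
    rw [h.radial_apply F hρ]
    exact hF ρ fun hρ' => hx ⟨_, ⟨hρ', mem_univ _⟩, rfl⟩
  · exact radial_of_notMem F hxt

/-- The field is supported in a compact annulus, so its divergence integrates to zero. The bound
does not involve ε, which makes it possible to let the inner radius of the annulus tend to zero. -/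
theorem lintegral_hardy_le (hg : IsRiem S g) (h : IsCylindrical g S q α r Φ) (hr : r ≤ 1 / 4)
    (hα : 0 < α) (hq : q ∉ S) {b' : ℝ} (hb' : b' < r) (hF : ∀ ρ ∈ Ioo 0 r, ContDiffAt ℝ 1 F₀ ρ)
    (hF0 : ∀ ρ, b' < ρ → F₀ ρ = 0) (hF1 : ∀ ρ ∈ Ioc 0 b, deriv F₀ ρ = 1) (hb : b < r)
    (hψ : ∀ ρ ∈ Ioo 0 r, ContDiffAt ℝ 1 ψ ρ) {ε : ℝ} (hε : 0 < ε)
    (hψ0 : ∀ ρ, ρ ∉ Icc ε b → ψ ρ = 0) (hu : IsCr 1 S u)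
    (hψ1 : ∀ ρ, ψ ρ ∈ Icc (0 : ℝ) 1) {C : ℝ} (hC : 0 ≤ C)
    (hψC : ∀ ρ ∈ Ioo 0 r, -(C * ρ) ≤ deriv ψ ρ) (hu2 : normSq g S u < ⊤)
    (hs2 : normSq g S (symCovDeriv g u) < ⊤) :
    ∫⁻ x, ENNReal.ofReal (radial Φ r (hardyWeight ψ) x * tensorInner g u u x) ∂areaMeasure g S
      ≤ ENNReal.ofReal 64 * normSq g S (symCovDeriv g u)
        + ENNReal.ofReal (8 * C) * normSq g S u := by
  have hψb : ∀ ρ, b < ρ → ψ ρ = 0 := fun ρ hρ => hψ0 ρ fun h' => absurd h'.2 (not_le.2 hρ)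
  set K := Φ '' (Icc ε b ×ˢ univ)
  have hK : IsCompact K := h.isCompact_annulus hα hε hb
  have hKt : K ⊆ tube Φ r := by
    have hI : Icc ε b ⊆ Ioo 0 r := fun t ht => ⟨hε.trans_le ht.1, ht.2.trans_lt hb⟩
    exact image_mono (Set.prod_mono hI subset_rfl)
  have hKS : K ⊆ S := hKt.trans h.tube_subset
  set γ := hardyField g r Φ F₀ ψ u with hγd
  have hγ : IsCr 1 S γ := isCr_hardyField hg h hr hα hq hb' hF hF0 hF1 hb hψ hψb hu
  have hγ0 : ∀ x ∈ S, x ∉ K → γ x = 0 := by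
    intro x _ hx
    have h1 : radial Φ r (hardyCoeff₁ ψ) x = 0 :=
      radial_eq_zero_of_notMem_annulus h (fun ρ hρ => by simp [hardyCoeff₁, hψ0 ρ hρ]) hx
    have h2 : radial Φ r (hardyCoeff₂ ψ) x = 0 :=
      radial_eq_zero_of_notMem_annulus h (fun ρ hρ => by simp [hardyCoeff₂, hψ0 ρ hρ]) hx
    simp [hγd, hardyField, h1, h2]
  have hw0 : ∀ x ∈ S, x ∉ K → radial Φ r (hardyWeight ψ) x = 0 := fun x _ hx =>
    radial_eq_zero_of_notMem_annulus h (fun ρ hρ => by simp [hardyWeight, hψ0 ρ hρ]) hx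
  have hd0 : ∀ x ∈ S, x ∉ K → val (divergence g γ) x = 0 := fun x hx hxK =>
    val_divergence_eq_zero hg hK hγ hγ0 hx hxK
  have hu0 : IsCr 0 S u := hu.of_le (by norm_num)
  have hsc := isCr_zero_symCovDeriv_one hg hu
  have iu := integrable_tensorInner hg (isMeas_of_isCr hg.isOpen hu0)
    (isMeas_of_isCr hg.isOpen hu0) hu2 hu2
  have is := integrable_tensorInner hg (isMeas_of_isCr hg.isOpen hsc)
    (isMeas_of_isCr hg.isOpen hsc) hs2 hs2
  have id : Integrable (fun x => val (divergence g γ) x) (areaMeasure g S) :=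
    integrable_of_compact hg (continuousOn_val hg.isOpen (isCr_zero_divergence_one hg hγ)) hK hKS hd0
  have hwc : ContinuousOn (radial Φ r (hardyWeight ψ)) S :=
    continuousOn_val (w := ofFun (radial Φ r (hardyWeight ψ))) hg.isOpen ((h.isCr_radial hα hq hb
      (fun ρ hρ => contDiffAt_hardyWeight hρ.1 (hρ.2.trans_le hr) (hψ ρ hρ))
      (fun ρ hρ => by simp [hardyWeight, hψb ρ hρ])).of_le (by norm_num))
  have iw : Integrable (fun x => radial Φ r (hardyWeight ψ) x * tensorInner g u u x)
      (areaMeasure g S) :=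
    integrable_of_compact hg (hwc.mul (continuousOn_tensorInner hg hu0 hu0)) hK hKS
      fun x hx hxK => by simp [hw0 x hx hxK]
  have hpt : ∀ᵐ x ∂areaMeasure g S, radial Φ r (hardyWeight ψ) x * tensorInner g u u x ≤
      -val (divergence g γ) x
      + (64 * tensorInner g (symCovDeriv g u) (symCovDeriv g u) x
      + 8 * C * tensorInner g u u x) := by
    filter_upwards [ae_mem (g := g) hg.isOpen] with x hx
    by_cases hxK : x ∈ K
    · rw [← add_assoc]
      exact hardy_divergence hg h hr hα hq hb' hF hF0 hF1 hb hψ hψb hu hψ1 hC hψC (hKt hxK)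
    · rw [hw0 x hx hxK, hd0 x hx hxK]
      have h1 := tensorInner_self_nonneg hg hx u
      have h2 := tensorInner_self_nonneg hg hx (symCovDeriv g u)
      have h3 := mul_nonneg hC h1
      linarith
  have ig : Integrable (fun x => 64 * tensorInner g (symCovDeriv g u) (symCovDeriv g u) x
      + 8 * C * tensorInner g u u x) (areaMeasure g S) :=
    (is.const_mul 64).add (iu.const_mul (8 * C))
  have h1 := integral_mono_ae iw (id.fun_neg.add ig) hpt
  have h2 : ∫ x, (-val (divergence g γ) x
      + (64 * tensorInner g (symCovDeriv g u) (symCovDeriv g u) x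
      + 8 * C * tensorInner g u u x)) ∂areaMeasure g S
      = ∫ x, (64 * tensorInner g (symCovDeriv g u) (symCovDeriv g u) x
      + 8 * C * tensorInner g u u x) ∂areaMeasure g S := by
    rw [integral_add id.fun_neg ig, integral_neg, integral_divergence hg hγ hK hKS hγ0, neg_zero,
      zero_add]
  have h3 := h1.trans h2.le
  rw [← ofReal_integral_eq_lintegral_ofReal iw]
  · refine (ENNReal.ofReal_le_ofReal h3).trans ?_
    rw [ofReal_integral_eq_lintegral_ofReal ig]
    · rw [normSq, normSq, ← lintegral_const_mul' _ _ ENNReal.ofReal_ne_top,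
        ← lintegral_const_mul' _ _ ENNReal.ofReal_ne_top,
        ← lintegral_add_left' ((is.aemeasurable.ennreal_ofReal).const_mul _)]
      refine lintegral_mono fun x => ?_
      rw [← ENNReal.ofReal_mul (by norm_num), ← ENNReal.ofReal_mul (by positivity)]
      exact ENNReal.ofReal_add_le
    · filter_upwards [ae_mem (g := g) hg.isOpen] with x hx
      have h1 := tensorInner_self_nonneg hg hx u
      have h2 := tensorInner_self_nonneg hg hx (symCovDeriv g u)
      have h3 := mul_nonneg hC h1
      simp only [Pi.zero_apply]
      linarith
  · filter_upwards [ae_mem (g := g) hg.isOpen] with x hx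
    exact mul_nonneg (radial_nonneg h (hardyWeight_nonneg hψ1) x)
      (tensorInner_self_nonneg hg hx u)

/-- **Hardy inequality** for `1`-forms near a cone point. -/
theorem lintegral_hardy_lt_top (hg : IsRiem S g) (h : IsCylindrical g S q α r Φ) (hr : r ≤ 1 / 4)
    (hα : 0 < α) (hq : q ∉ S) (hu : IsCr 1 S u) (hu2 : normSq g S u < ⊤)
    (hs2 : normSq g S (symCovDeriv g u) < ⊤) :
    ∫⁻ x, ENNReal.ofReal (radial Φ r (hardyWeight (cutoff r)) x * tensorInner g u u x)
      ∂areaMeasure g S < ⊤ := by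
  have hr0 := h.radius_pos
  obtain ⟨C, hC0, hC⟩ := exists_abs_deriv_smoothTransition_le
  -- `F₀` is ρ for ρ ≤ r/2 and 0 for ρ ≥ 3r/4. Its differential is dρ on the support ρ ≤ r/4 of the
  -- cutoff.
  set F₀ : ℝ → ℝ := fun ρ => ρ * Real.smoothTransition (3 - 4 / r * ρ) with hF₀
  have hF : ∀ ρ ∈ Ioo 0 r, ContDiffAt ℝ 1 F₀ ρ := fun ρ _ =>
    contDiffAt_id.mul (Real.smoothTransition.contDiffAt.comp ρ
      (contDiffAt_const.sub (contDiffAt_const.mul contDiffAt_id)))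
  have hF0 : ∀ ρ, 3 * r / 4 < ρ → F₀ ρ = 0 := fun ρ hρ => by
    have : 3 - 4 / r * ρ ≤ 0 := by
      have : 3 ≤ 4 / r * ρ := by
        rw [div_mul_eq_mul_div, le_div_iff₀ hr0]; linarith
      linarith
    simp [hF₀, Real.smoothTransition.zero_of_nonpos this]
  have hF1 : ∀ ρ ∈ Ioc 0 (r / 4), deriv F₀ ρ = 1 := fun ρ hρ => by
    have h1 : F₀ =ᶠ[𝓝 ρ] fun t => t := by
      filter_upwards [eventually_lt_nhds (show ρ < r / 2 by linarith [hρ.2])] with t ht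
      have : 1 ≤ 3 - 4 / r * t := by
        have : 4 / r * t ≤ 2 := by
          rw [div_mul_eq_mul_div, div_le_iff₀ hr0]; linarith
        linarith
      simp [hF₀, Real.smoothTransition.one_of_one_le this]
    rw [h1.deriv_eq]
    simp
  -- The first factor vanishes for ρ ≤ 1/(m+1) and equals 1 for ρ ≥ 2/(m+1).
  set ψ : ℕ → ℝ → ℝ := fun m ρ => Real.smoothTransition ((m + 1) * ρ - 1) * cutoff r ρ with hψd
  have hd1 : ∀ (m : ℕ) (ρ : ℝ), HasDerivAt (fun t => Real.smoothTransition ((m + 1) * t - 1))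
      (deriv Real.smoothTransition ((m + 1) * ρ - 1) * (m + 1)) ρ := fun m ρ =>
    hasDerivAt_smoothTransition_comp (by
      simpa using ((hasDerivAt_id ρ).const_mul ((m : ℝ) + 1)).sub_const 1)
  -- The argument of `cutoff` is quadratic in ρ, so the derivative carries the factor ρ demanded by
  -- the condition −Cρ ≤ ψ'.
  have hd2 : ∀ ρ : ℝ, HasDerivAt (cutoff r)
      (deriv Real.smoothTransition (2 - 32 / r ^ 2 * ρ ^ 2) * -(32 / r ^ 2 * (2 * ρ))) ρ := fun ρ =>
    hasDerivAt_smoothTransition_comp (by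
      simpa using ((hasDerivAt_id ρ).fun_pow 2 |>.const_mul (32 / r ^ 2)).const_sub 2)
  have key : ∀ m : ℕ, ∫⁻ x, ENNReal.ofReal (radial Φ r (hardyWeight (ψ m)) x * tensorInner g u u x)
      ∂areaMeasure g S ≤ ENNReal.ofReal 64 * normSq g S (symCovDeriv g u)
        + ENNReal.ofReal (8 * (C * (64 / r ^ 2))) * normSq g S u := by
    intro m
    have hm : (0 : ℝ) < m + 1 := by positivity
    refine lintegral_hardy_le hg h hr hα hq (b' := 3 * r / 4) (by linarith) hF hF0 hF1
      (by linarith) (ψ := ψ m) ?_ (ε := 1 / (m + 1)) (by positivity) ?_ hu ?_ (by positivity) ?_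
      hu2 hs2
    · intro ρ _
      exact (Real.smoothTransition.contDiffAt.comp ρ
        ((contDiffAt_const.mul contDiffAt_id).sub contDiffAt_const)).mul
        (Real.smoothTransition.contDiffAt.comp ρ
        (contDiffAt_const.sub (contDiffAt_const.mul (contDiffAt_id.pow 2))))
    · intro ρ hρ
      rcases lt_or_ge ρ (1 / (m + 1)) with h1 | h1
      · have : ((m : ℝ) + 1) * ρ - 1 ≤ 0 := by
          rw [lt_div_iff₀ hm] at h1
          linarith
        simp [hψd, Real.smoothTransition.zero_of_nonpos this]
      · have h2 : r / 4 < ρ := by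
          by_contra! h2
          exact hρ ⟨h1, h2⟩
        simp [hψd, cutoff_eq_zero hr0 h2]
    · intro ρ
      exact ⟨mul_nonneg (Real.smoothTransition.nonneg _) (Real.smoothTransition.nonneg _),
        mul_le_one₀ (Real.smoothTransition.le_one _) (Real.smoothTransition.nonneg _)
          (Real.smoothTransition.le_one _)⟩
    · intro ρ hρ
      rw [((hd1 m ρ).fun_mul (hd2 ρ)).deriv]
      -- The slope of the inner factor grows with m but is nonnegative. Only the decrease of the
      -- outer cutoff costs something, and that is independent of m.
      have h1 : 0 ≤ deriv Real.smoothTransition ((m + 1) * ρ - 1) :=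
        Real.smoothTransition.monotone.deriv_nonneg
      have h2 : 0 ≤ deriv Real.smoothTransition (2 - 32 / r ^ 2 * ρ ^ 2) :=
        Real.smoothTransition.monotone.deriv_nonneg
      have h3 := (le_abs_self _).trans (hC (2 - 32 / r ^ 2 * ρ ^ 2))
      have h4 : 0 ≤ cutoff r ρ := Real.smoothTransition.nonneg _
      have h5 := Real.smoothTransition.nonneg ((m + 1) * ρ - 1)
      have h6 := Real.smoothTransition.le_one ((m + 1) * ρ - 1)
      have h7 : 0 ≤ deriv Real.smoothTransition ((m + 1) * ρ - 1) * (m + 1) * cutoff r ρ := by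
        positivity
      have hρ0 := hρ.1
      have h8 : Real.smoothTransition ((m + 1) * ρ - 1)
          * deriv Real.smoothTransition (2 - 32 / r ^ 2 * ρ ^ 2) ≤ 1 * C :=
        mul_le_mul h6 h3 h2 zero_le_one
      have h9 := mul_le_mul_of_nonneg_right h8 (show 0 ≤ 64 / r ^ 2 * ρ by positivity)
      have h10 : Real.smoothTransition ((m + 1) * ρ - 1) *
          (deriv Real.smoothTransition (2 - 32 / r ^ 2 * ρ ^ 2) * -(32 / r ^ 2 * (2 * ρ)))
          = -(Real.smoothTransition ((m + 1) * ρ - 1)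
          * deriv Real.smoothTransition (2 - 32 / r ^ 2 * ρ ^ 2) * (64 / r ^ 2 * ρ)) := by ring
      rw [h10]
      linarith
  -- At a fixed point the sequence is eventually constant, as soon as m + 1 > 2/ρ.
  have hlim : ∀ x, Tendsto (fun m => ENNReal.ofReal (radial Φ r (hardyWeight (ψ m)) x *
      tensorInner g u u x)) atTop (𝓝 (ENNReal.ofReal (radial Φ r (hardyWeight (cutoff r)) x *
      tensorInner g u u x))) := by
    intro x
    refine tendsto_const_nhds.congr' ?_
    by_cases hx : x ∈ tube Φ r
    · obtain ⟨⟨ρ, θ⟩, ⟨hρ, -⟩, rfl⟩ := hx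
      obtain ⟨N, hN⟩ := exists_nat_gt (2 / ρ)
      filter_upwards [eventually_ge_atTop N] with m hm
      have h1 : 1 ≤ ((m : ℝ) + 1) * ρ - 1 := by
        have h2 : 2 / ρ < m + 1 := hN.trans_le (by exact_mod_cast hm.trans (Nat.le_succ m))
        have hρ0 : 0 < ρ := hρ.1
        rw [div_lt_iff₀ hρ0] at h2
        linarith
      rw [h.radial_apply _ hρ, h.radial_apply _ hρ]
      simp [hardyWeight, hψd, Real.smoothTransition.one_of_one_le h1]
    · refine Eventually.of_forall fun m => ?_
      simp only [radial_of_notMem _ hx]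
  have hmeas : ∀ m, AEMeasurable (fun x => ENNReal.ofReal (radial Φ r (hardyWeight (ψ m)) x *
      tensorInner g u u x)) (areaMeasure g S) := by
    intro m
    have hu0 : IsCr 0 S u := hu.of_le (by norm_num)
    refine AEMeasurable.ennreal_ofReal (aemeasurable_of_continuousOn hg.isOpen
      (ContinuousOn.mul ?_ (continuousOn_tensorInner hg hu0 hu0)))
    refine continuousOn_val (w := ofFun (radial Φ r (hardyWeight (ψ m)))) hg.isOpen
      ((h.isCr_radial hα hq (b := r / 4) (by linarith)
      (fun ρ hρ => contDiffAt_hardyWeight hρ.1 (hρ.2.trans_le hr) ?_)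
      (fun ρ hρ => by simp [hardyWeight, hψd, cutoff_eq_zero hr0 hρ])).of_le (by norm_num))
    exact (Real.smoothTransition.contDiffAt.comp ρ
        ((contDiffAt_const.mul contDiffAt_id).sub contDiffAt_const)).mul
        (Real.smoothTransition.contDiffAt.comp ρ
        (contDiffAt_const.sub (contDiffAt_const.mul (contDiffAt_id.pow 2))))
  -- Fatou's lemma: the uniform bounds pass to the integral of the pointwise limit.
  have h1 := lintegral_liminf_le' (u := atTop) hmeas
  simp only [(hlim _).liminf_eq] at h1
  refine h1.trans_lt (lt_of_le_of_lt (liminf_le_of_frequently_le'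
    (Eventually.of_forall key).frequently) ?_)
  exact ENNReal.add_lt_top.2 ⟨ENNReal.mul_lt_top ENNReal.ofReal_lt_top hs2,
    ENNReal.mul_lt_top ENNReal.ofReal_lt_top hu2⟩

end HardyIntegral

/-! ### Logarithmic cutoff functions at the cone points. -/

section Cutoffs

variable {M : Type*} [TopologicalSpace M] [ChartedSpace Plane M] [IsManifold (𝓡 2) 2 M]
variable {e : OpenPartialHomeomorph M Plane} {S : Set M} {g : TensorField M 2}
variable {q : M} {α r : ℝ} {Φ : ℝ × ℝ → M}

theorem IsCylindrical.mono (h : IsCylindrical g S q α r Φ) {r' : ℝ} (h0 : 0 < r') (hr : r' ≤ r) :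
    IsCylindrical g S q α r' Φ := by
  have h1 : Ioo 0 r' ⊆ Ioo 0 r := Ioo_subset_Ioo_right hr
  have h2 : Ioo 0 r' ×ˢ (univ : Set ℝ) ⊆ Ioo 0 r ×ˢ univ := Set.prod_mono h1 subset_rfl
  exact ⟨h0, fun z hz => h.mem z (h2 hz), h.contMDiffOn.mono h2,
    fun ρ hρ ρ' hρ' => h.eq_iff ρ (h1 hρ) ρ' (h1 hρ'), h.map_eq, fun z hz => h.metric_rho z (h2 hz),
    fun z hz => h.metric_mixed z (h2 hz), fun z hz => h.metric_theta z (h2 hz)⟩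

theorem comp_symCovDeriv_ofFun (hS : IsOpen S) (he : e ∈ IsManifold.maximalAtlas (𝓡 2) 2 M)
    {y : Plane} (hyS : y ∈ chartDom e S) {f : M → ℝ} (hf : IsCr 1 S (ofFun f)) (i : Fin 2) :
    comp e (symCovDeriv g (ofFun f)) y ![i] = pderiv i (fun z => f (e.symm z)) y :=
  comp_symCovDeriv_zero hS he hyS hf i

variable [MeasurableSpace M] [BorelSpace M] [CompactSpace M] [T2Space M] [IsManifold (𝓡 2) ∞ M]

theorem symCovDeriv_eq_zero_of_eventually_const (hS : IsOpen S) {f : M → ℝ}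
    (hf : IsCr 1 S (ofFun f)) {x : M} (hx : x ∈ S) {c : ℝ} (h : ∀ᶠ x' in 𝓝 x, f x' = c) :
    symCovDeriv g (ofFun f) x = 0 := by
  refine eq_zero_of_comp fun I => ?_
  rw [fin_one_eq I, comp_symCovDeriv_ofFun hS (chartAt_mem_maximalAtlas x)
    (chartAt_mem_chartDom hx) hf, pderiv_congr (f' := fun _ => c)]
  · simp [pderiv]
  · have h1 : Tendsto (chartAt Plane x).symm (𝓝 (chartAt Plane x x)) (𝓝 x) := by
      have := (chartAt Plane x).continuousAt_symm (mem_chart_target Plane x)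
      rwa [ContinuousAt, chartAt_symm_apply] at this
    exact h1.eventually h

theorem symCovDeriv_mul (hS : IsOpen S) {f f' : M → ℝ} (hf : IsCr 1 S (ofFun f))
    (hf' : IsCr 1 S (ofFun f')) {x : M} (hx : x ∈ S) :
    symCovDeriv g (ofFun fun z => f z * f' z) x
      = f' x • symCovDeriv g (ofFun f) x + f x • symCovDeriv g (ofFun f') x := by
  have hy := chartAt_mem_chartDom hx
  have he := chartAt_mem_maximalAtlas x
  have hff : IsCr 1 S (ofFun fun z => f z * f' z) := isCr_smul (u := ofFun f') hf hf'
  have d : DifferentiableAt ℝ (fun z => f ((chartAt Plane x).symm z)) (chartAt Plane x x) :=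
    differentiableAt_comp hS hf he hy ![]
  have d' : DifferentiableAt ℝ (fun z => f' ((chartAt Plane x).symm z)) (chartAt Plane x x) :=
    differentiableAt_comp hS hf' he hy ![]
  refine eq_of_comp_eq (u := symCovDeriv g (ofFun fun z => f z * f' z))
    (v := fun x => f' x • symCovDeriv g (ofFun f) x + f x • symCovDeriv g (ofFun f') x)
    he (mem_chart_source _ _) ?_
  funext I
  have h1 : comp (chartAt Plane x) (fun x => f' x • symCovDeriv g (ofFun f) x
      + f x • symCovDeriv g (ofFun f') x) (chartAt Plane x x) I
      = f' ((chartAt Plane x).symm (chartAt Plane x x)) *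
        comp (chartAt Plane x) (symCovDeriv g (ofFun f)) (chartAt Plane x x) I
      + f ((chartAt Plane x).symm (chartAt Plane x x)) *
        comp (chartAt Plane x) (symCovDeriv g (ofFun f')) (chartAt Plane x x) I := rfl
  rw [h1, fin_one_eq I, comp_symCovDeriv_ofFun hS he hy hff, comp_symCovDeriv_ofFun hS he hy hf,
    comp_symCovDeriv_ofFun hS he hy hf', pderiv_mul d d']
  ring

/-- Cutoff functions on `S` that vanish near the points of `F`, increase to `1`, and whose
gradients are controlled by a weight `W`. -/
structure IsCutoffSeq (S : Set M) (g : TensorField M 2) (F : Set M) (χ : ℕ → M → ℝ) (W : M → ℝ) :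
    Prop where
  isCr : ∀ N, IsCr 1 S (ofFun (χ N))
  mem : ∀ N x, χ N x ∈ Icc (0 : ℝ) 1
  eventually_eq : ∀ x ∈ S, ∀ᶠ N in atTop, χ N x = 1 ∧ symCovDeriv g (ofFun (χ N)) x = 0
  eventually_zero : ∀ N, ∀ q ∈ F, ∀ᶠ x in 𝓝[≠] q, χ N x = 0
  continuousOn : ContinuousOn W S
  le : ∀ N, ∀ x ∈ S,
    tensorInner g (symCovDeriv g (ofFun (χ N))) (symCovDeriv g (ofFun (χ N))) x ≤ W x
  lintegral_lt_top : ∀ u : TensorField M 1, IsCr 1 S u → normSq g S u < ⊤ →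
    normSq g S (symCovDeriv g u) < ⊤ →
    ∫⁻ x, ENNReal.ofReal (W x * tensorInner g u u x) ∂areaMeasure g S < ⊤

theorem isCr_const (c : ℝ) : IsCr 1 S (ofFun fun _ : M => c) := fun _ _ _ => contDiffOn_const

theorem isCutoffSeq_empty (hg : IsRiem S g) :
    IsCutoffSeq S g ∅ (fun _ _ => 1) (fun _ => 0) where
  isCr _ := isCr_const 1
  mem _ _ := by simp
  eventually_eq x hx := Eventually.of_forall fun N => ⟨rfl,
    symCovDeriv_eq_zero_of_eventually_const hg.isOpen (isCr_const 1) hx (c := 1) (by simp)⟩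
  eventually_zero _ q hq := hq.elim
  continuousOn := continuousOn_const
  le N x hx := by
    rw [tensorInner_zero_left (symCovDeriv_eq_zero_of_eventually_const hg.isOpen (isCr_const 1) hx
      (c := 1) (by simp))]
  lintegral_lt_top u _ _ _ := by simp

/-- Since both functions take values in [0, 1], |d(χχ')|² ≤ 2|dχ|² + 2|dχ'|². Finitely many cone
points are treated by iterating this. -/
theorem IsCutoffSeq.mul (hg : IsRiem S g) {F F' : Set M} {χ χ' : ℕ → M → ℝ} {W W' : M → ℝ}
    (h : IsCutoffSeq S g F χ W) (h' : IsCutoffSeq S g F' χ' W') :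
    IsCutoffSeq S g (F ∪ F') (fun N x => χ N x * χ' N x) (fun x => 2 * W x + 2 * W' x) where
  isCr N := isCr_smul (u := ofFun (χ' N)) (h.isCr N) (h'.isCr N)
  mem N x := ⟨mul_nonneg (h.mem N x).1 (h'.mem N x).1,
    mul_le_one₀ (h.mem N x).2 (h'.mem N x).1 (h'.mem N x).2⟩
  eventually_eq x hx := by
    filter_upwards [h.eventually_eq x hx, h'.eventually_eq x hx] with N h1 h2
    rw [symCovDeriv_mul hg.isOpen (h.isCr N) (h'.isCr N) hx, h1.1, h2.1, h1.2, h2.2]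
    simp
  eventually_zero N q hq := by
    rcases hq with hq | hq
    · filter_upwards [h.eventually_zero N q hq] with x hx
      simp [hx]
    · filter_upwards [h'.eventually_zero N q hq] with x hx
      simp [hx]
  continuousOn := (continuousOn_const.mul h.continuousOn).add
    (continuousOn_const.mul h'.continuousOn)
  le N x hx := by
    -- The sum is written as a difference so that `tensorInner_sub_self_le` applies.
    have h1 : symCovDeriv g (ofFun fun z => χ N z * χ' N z) x
        = ((fun z => χ' N z • symCovDeriv g (ofFun (χ N)) z)
          - fun z => (-χ N z) • symCovDeriv g (ofFun (χ' N)) z : TensorField M 1) x := by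
      rw [symCovDeriv_mul hg.isOpen (h.isCr N) (h'.isCr N) hx]
      have key : ∀ {V : Type _} [AddCommGroup V] [Module ℝ V] (a b : V) (c : ℝ),
          a + c • b = a - (-c) • b := by
        intros
        module
      exact key _ _ _
    rw [tensorInner_congr g h1 h1]
    refine (tensorInner_sub_self_le hg hx _ _).trans ?_
    rw [tensorInner_smul_left, tensorInner_smul_right, tensorInner_smul_left,
      tensorInner_smul_right]
    have k1 := tensorInner_self_nonneg hg hx (symCovDeriv g (ofFun (χ N)))
    have k2 := tensorInner_self_nonneg hg hx (symCovDeriv g (ofFun (χ' N)))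
    have l1 := h.le N x hx
    have l2 := h'.le N x hx
    have m1 := h.mem N x
    have m2 := h'.mem N x
    have n1 : χ N x * χ N x ≤ 1 := mul_le_one₀ m1.2 m1.1 m1.2
    have n2 : χ' N x * χ' N x ≤ 1 := mul_le_one₀ m2.2 m2.1 m2.2
    have o1 := mul_le_of_le_one_left k1 n2
    have o2 := mul_le_of_le_one_left k2 n1
    linarith
  lintegral_lt_top u hu hu2 hs2 := by
    have hu0 : IsCr 0 S u := hu.of_le (by norm_num)
    have hm : AEMeasurable (fun x => ENNReal.ofReal (W x * tensorInner g u u x))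
        (areaMeasure g S) := AEMeasurable.ennreal_ofReal (aemeasurable_of_continuousOn hg.isOpen
      (h.continuousOn.mul (continuousOn_tensorInner hg hu0 hu0)))
    have h1 : ∀ x, ENNReal.ofReal ((2 * W x + 2 * W' x) * tensorInner g u u x) ≤
        ENNReal.ofReal 2 * ENNReal.ofReal (W x * tensorInner g u u x)
        + ENNReal.ofReal 2 * ENNReal.ofReal (W' x * tensorInner g u u x) := fun x => by
      rw [← ENNReal.ofReal_mul (by norm_num), ← ENNReal.ofReal_mul (by norm_num), add_mul,
        mul_assoc, mul_assoc]
      exact ENNReal.ofReal_add_le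
    refine (lintegral_mono h1).trans_lt ?_
    rw [lintegral_add_left' (hm.const_mul _), lintegral_const_mul' _ _ ENNReal.ofReal_ne_top,
      lintegral_const_mul' _ _ ENNReal.ofReal_ne_top]
    exact ENNReal.add_lt_top.2
      ⟨ENNReal.mul_lt_top ENNReal.ofReal_lt_top (h.lintegral_lt_top u hu hu2 hs2),
        ENNReal.mul_lt_top ENNReal.ofReal_lt_top (h'.lintegral_lt_top u hu hu2 hs2)⟩

theorem deriv_smoothTransition_eq_zero {x : ℝ} (h : x < 0 ∨ 1 < x) :
    deriv Real.smoothTransition x = 0 := by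
  rcases h with hx | hx
  · have : Real.smoothTransition =ᶠ[𝓝 x] fun _ => 0 := by
      filter_upwards [eventually_lt_nhds hx] with t ht
        using Real.smoothTransition.zero_of_nonpos ht.le
    rw [this.deriv_eq]
    simp
  · have : Real.smoothTransition =ᶠ[𝓝 x] fun _ => 1 := by
      filter_upwards [eventually_gt_nhds hx] with t ht
        using Real.smoothTransition.one_of_one_le ht.le
    rw [this.deriv_eq]
    simp

/-- The logarithmic cutoff function. -/
def logCutoff (N ρ : ℝ) : ℝ := 1 - Real.smoothTransition (2 + Real.log ρ / N)

theorem hasDerivAt_logCutoff {N ρ : ℝ} (h0 : 0 < ρ) :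
    HasDerivAt (logCutoff N)
      (-(deriv Real.smoothTransition (2 + Real.log ρ / N) * (ρ⁻¹ / N))) ρ :=
  (hasDerivAt_smoothTransition_comp
    (((Real.hasDerivAt_log h0.ne').div_const N).const_add 2)).const_sub 1

theorem contDiffAt_logCutoff {N ρ : ℝ} (h0 : 0 < ρ) : ContDiffAt ℝ 1 (logCutoff N) ρ :=
  contDiffAt_const.sub (Real.smoothTransition.contDiffAt.comp ρ
    (contDiffAt_const.add ((Real.contDiffAt_log.2 h0.ne').div_const N)))

theorem logCutoff_eq_zero {N ρ : ℝ} (hN : 0 < N) (h : -N ≤ Real.log ρ) : logCutoff N ρ = 0 := by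
  have : -1 ≤ Real.log ρ / N := by rw [le_div_iff₀ hN]; linarith
  rw [logCutoff, Real.smoothTransition.one_of_one_le (by linarith), sub_self]

theorem logCutoff_eq_one {N ρ : ℝ} (hN : 0 < N) (h : Real.log ρ ≤ -(2 * N)) :
    logCutoff N ρ = 1 := by
  have : Real.log ρ / N ≤ -2 := by rw [div_le_iff₀ hN]; linarith
  rw [logCutoff, Real.smoothTransition.zero_of_nonpos (by linarith), sub_zero]

/-- The derivative is supported where N ≤ −log ρ ≤ 2N, so that 1/N ≤ 2κ there, and 1/ρ ≤ 2/sinh ρ.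
Together they give the factor 4, squared to 16. The condition on N puts this region inside ρ < r/8,
where the cutoff in the weight equals 1. -/
theorem deriv_logCutoff_sq_le {C : ℝ} (hC0 : 0 ≤ C)
    (hC : ∀ x, |deriv Real.smoothTransition x| ≤ C) {N ρ : ℝ} (hN : 0 < N) (h0 : 0 < ρ)
    (hr : r ≤ 1 / 4) (hρ : ρ < r) (hNr : -N < Real.log (r / 8)) :
    deriv (logCutoff N) ρ ^ 2 ≤ 16 * C ^ 2 * hardyWeight (cutoff r) ρ := by
  have hr0 : 0 < r := h0.trans hρ
  have hw : 0 ≤ 16 * C ^ 2 * hardyWeight (cutoff r) ρ :=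
    mul_nonneg (by positivity) (mul_nonneg (Real.smoothTransition.nonneg _) (by positivity))
  rw [(hasDerivAt_logCutoff h0).deriv]
  by_cases hx : 2 + Real.log ρ / N < 0 ∨ 1 < 2 + Real.log ρ / N
  · rw [deriv_smoothTransition_eq_zero hx]
    simpa using hw
  · push Not at hx
    have h1 : Real.log ρ ≤ -N := by
      have : Real.log ρ / N ≤ -1 := by linarith [hx.2]
      rw [div_le_iff₀ hN] at this
      linarith
    have h2 : -Real.log ρ ≤ 2 * N := by
      have : -2 ≤ Real.log ρ / N := by linarith [hx.1]
      rw [le_div_iff₀ hN] at this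
      linarith
    have h3 : ρ < r / 8 := (Real.log_lt_log_iff h0 (by positivity)).1 (h1.trans_lt hNr)
    have h4 := one_le_neg_log h0 (hρ.trans_le hr)
    have h5 := sinh_le_two_mul h0 (hρ.trans_le hr)
    have h6 : 0 < Real.sinh ρ := Real.sinh_pos_iff.2 h0
    rw [hardyWeight, cutoff_eq_one h0 h3, one_mul]
    have h7 : |deriv Real.smoothTransition (2 + Real.log ρ / N)| * (ρ⁻¹ / N)
        ≤ C * (4 * (invLog ρ * (Real.sinh ρ)⁻¹)) := by
      refine mul_le_mul (hC _) ?_ (by positivity) hC0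
      have h8 : ρ⁻¹ ≤ 2 * (Real.sinh ρ)⁻¹ := by
        rw [← div_eq_mul_inv, inv_eq_one_div, div_le_div_iff₀ h0 h6]
        linarith
      have h9 : N⁻¹ ≤ 2 * invLog ρ := by
        rw [invLog, ← div_eq_mul_inv, inv_eq_one_div, div_le_div_iff₀ hN (by linarith)]
        linarith
      calc ρ⁻¹ / N = ρ⁻¹ * N⁻¹ := div_eq_mul_inv _ _
        _ ≤ (2 * (Real.sinh ρ)⁻¹) * (2 * invLog ρ) :=
          mul_le_mul h8 h9 (by positivity) (by positivity)
        _ = _ := by ring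
    have h8 := pow_le_pow_left₀ (by positivity) h7 2
    rw [mul_pow, sq_abs] at h8
    calc _ = deriv Real.smoothTransition (2 + Real.log ρ / N) ^ 2 * (ρ⁻¹ / N) ^ 2 := by ring
      _ ≤ _ := h8
      _ = _ := by ring

/-- The functions are 1 minus `logCutoff`, and the weight is a multiple of the one in the Hardy
inequality, which provides the last condition on the sequence. -/
theorem IsCylindrical.exists_isCutoffSeq (hg : IsRiem S g) (h : IsCylindrical g S q α r Φ)
    (hr : r ≤ 1 / 4) (hα : 0 < α) (hq : q ∉ S) :
    ∃ (χ : ℕ → M → ℝ) (W : M → ℝ), IsCutoffSeq S g {q} χ W := by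
  have hr0 := h.radius_pos
  obtain ⟨C, hC0, hC⟩ := exists_abs_deriv_smoothTransition_le
  obtain ⟨N₀, hN₀⟩ := exists_nat_gt (-Real.log (r / 8))
  -- The shift by N₀ makes the transition region of every function lie in ρ < r/8; the shift by 1
  -- keeps ν positive.
  set ν : ℕ → ℝ := fun N => N + N₀ + 1 with hν
  have hν0 : ∀ N, 0 < ν N := fun N => by positivity
  have hνr : ∀ N, -ν N < Real.log (r / 8) := fun N => by
    have : (0 : ℝ) ≤ N := Nat.cast_nonneg N
    simp only [hν]
    linarith
  have hf : ∀ N, ∀ ρ ∈ Ioo 0 r, ContDiffAt ℝ 1 (logCutoff (ν N)) ρ := fun N ρ hρ =>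
    contDiffAt_logCutoff hρ.1
  have hf0 : ∀ N, ∀ ρ, r / 8 < ρ → logCutoff (ν N) ρ = 0 := fun N ρ hρ =>
    logCutoff_eq_zero (hν0 N) ((hνr N).le.trans
      (Real.log_le_log (by positivity) hρ.le))
  have hr8 : r / 8 < r := by linarith
  have hrad := fun N => h.isCr_radial hα hq hr8 (hf N) (hf0 N)
  have hcr : ∀ N, IsCr 1 S (ofFun fun x => 1 - radial Φ r (logCutoff (ν N)) x) := fun N e he I =>
    contDiffOn_const.sub (hrad N e he I)
  have hout : ∀ x ∈ S, x ∉ tube Φ r → ∀ N, ∀ᶠ x' in 𝓝 x,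
      1 - radial Φ r (logCutoff (ν N)) x' = 1 := fun x hx hxt N => by
    filter_upwards [h.eventually_radial_eq_zero hα hr8 (fun hxq => hq (hxq ▸ hx)) hxt] with x' hx'
    rw [hx' _ (hf0 N), sub_zero]
  -- A point of S has positive ρ or lies off the end. In both cases the functions with large N are 1
  -- in a whole neighbourhood, so the differential vanishes there as well.
  have hnear : ∀ x ∈ S, ∀ᶠ N in atTop, ∀ᶠ x' in 𝓝 x,
      1 - radial Φ r (logCutoff (ν N)) x' = 1 := fun x hx => by
    by_cases hxt : x ∈ tube Φ r
    · obtain ⟨e, he, hxe⟩ := h.exists_isCylChart hxt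
      have hy := e.map_source hxe
      obtain ⟨N₁, hN₁⟩ := exists_nat_gt (-Real.log (e x 0))
      filter_upwards [eventually_ge_atTop N₁] with N hN
      have hρ := (he.fst_mem _ hy).1
      have h1 : -ν N < Real.log (e x 0) := by
        have : (N₁ : ℝ) ≤ N := by exact_mod_cast hN
        have : (0 : ℝ) ≤ N₀ := Nat.cast_nonneg _
        simp only [hν]
        linarith
      have hc : ContinuousAt (fun x' => Real.log (e x' 0)) x :=
        ((EuclideanSpace.proj (0 : Fin 2) : Plane →L[ℝ] ℝ).continuous.continuousAt.comp
          (e.continuousAt hxe)).log hρ.ne'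
      filter_upwards [e.open_source.mem_nhds hxe, hc.eventually_const_lt h1] with x' hx' hx''
      have h2 := h.radial_symm_apply he (logCutoff (ν N)) (e.map_source hx')
      rw [e.left_inv hx'] at h2
      rw [h2, logCutoff_eq_zero (hν0 N) hx''.le, sub_zero]
    · exact Eventually.of_forall (hout x hx hxt)
  refine ⟨fun N x => 1 - radial Φ r (logCutoff (ν N)) x,
    fun x => 16 * C ^ 2 * radial Φ r (hardyWeight (cutoff r)) x, ?_⟩
  have hcut : ∀ ρ, cutoff r ρ ∈ Icc (0 : ℝ) 1 := fun ρ =>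
    ⟨Real.smoothTransition.nonneg _, Real.smoothTransition.le_one _⟩
  have hW0 : ∀ x, 0 ≤ radial Φ r (hardyWeight (cutoff r)) x :=
    radial_nonneg h (hardyWeight_nonneg hcut)
  refine ⟨hcr, fun N x => ?_, fun x hx => ?_, fun N q' hq' => ?_, ?_, fun N x hx => ?_,
    fun u hu hu2 hs2 => ?_⟩
  · by_cases hxt : x ∈ tube Φ r
    · obtain ⟨⟨ρ, θ⟩, ⟨hρ, -⟩, rfl⟩ := hxt
      rw [h.radial_apply _ hρ, logCutoff, sub_sub_cancel]
      exact ⟨Real.smoothTransition.nonneg _, Real.smoothTransition.le_one _⟩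
    · rw [radial_of_notMem _ hxt]
      simp
  · filter_upwards [hnear x hx] with N hN
    exact ⟨hN.self_of_nhds,
      symCovDeriv_eq_zero_of_eventually_const hg.isOpen (hcr N) hx hN⟩
  · rw [mem_singleton_iff] at hq'
    subst hq'
    -- Below the radius exp(−2ν) the function `logCutoff` equals 1, so its complement vanishes.
    have h1 : tube Φ (min r (Real.exp (-(2 * ν N)))) ∈ 𝓝[≠] q' := by
      rw [← h.map_eq]
      exact image_mem_map (prod_mem_prod (Ioo_mem_nhdsGT (lt_min hr0 (Real.exp_pos _))) univ_mem)
    filter_upwards [h1] with x hx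
    obtain ⟨⟨ρ, θ⟩, ⟨hρ, -⟩, rfl⟩ := hx
    have hρ2 := lt_min_iff.1 hρ.2
    rw [h.radial_apply _ ⟨hρ.1, hρ2.1⟩, logCutoff_eq_one (hν0 N), sub_self]
    exact (Real.log_le_iff_le_exp hρ.1).2 hρ2.2.le
  · refine continuousOn_const.mul (continuousOn_val
      (w := ofFun (radial Φ r (hardyWeight (cutoff r)))) hg.isOpen
      ((h.isCr_radial hα hq (b := r / 4) (by linarith)
      (fun ρ hρ => contDiffAt_hardyWeight hρ.1 (hρ.2.trans_le hr) ?_)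
      (fun ρ hρ => by simp [hardyWeight, cutoff_eq_zero hr0 hρ])).of_le (by norm_num)))
    exact Real.smoothTransition.contDiffAt.comp ρ
        (contDiffAt_const.sub (contDiffAt_const.mul (contDiffAt_id.pow 2)))
  · by_cases hxt : x ∈ tube Φ r
    · obtain ⟨e, he, hxe⟩ := h.exists_isCylChart hxt
      obtain ⟨y, hy, rfl⟩ : ∃ y ∈ e.target, e.symm y = x :=
        ⟨e x, e.map_source hxe, e.left_inv hxe⟩
      have hyS := h.symm_mem he hy
      have hρ := he.fst_mem y hy
      have hd := (contDiffAt_const (c := (1 : ℝ)) |>.sub (hf N _ hρ)).differentiableAt one_ne_zero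
      have h1 : (fun z => 1 - radial Φ r (logCutoff (ν N)) (e.symm z)) =ᶠ[𝓝 y]
          fun z => (fun t => 1 - logCutoff (ν N) t) (z 0) := by
        filter_upwards [e.open_target.mem_nhds hy] with z hz
        rw [h.radial_symm_apply he _ hz]
      have h2 := IsCylindrical.pderiv_fst hd
      have h3 : deriv (fun t => 1 - logCutoff (ν N) t) (y 0) = -deriv (logCutoff (ν N)) (y 0) := by
        rw [deriv_const_sub]
      rw [he.tensorInner_one_cyl hg hyS, comp_symCovDeriv_ofFun hg.isOpen he.mem hyS (hcr N),
        comp_symCovDeriv_ofFun hg.isOpen he.mem hyS (hcr N), pderiv_congr h1, pderiv_congr h1,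
        h2.2, h2.1, h3, h.radial_symm_apply he _ hy]
      have h4 := deriv_logCutoff_sq_le hC0 hC (hν0 N) hρ.1 hr hρ.2 (hνr N)
      calc _ = deriv (logCutoff (ν N)) (y 0) ^ 2 := by ring
        _ ≤ _ := h4
    · rw [tensorInner_zero_left (symCovDeriv_eq_zero_of_eventually_const hg.isOpen (hcr N) hx
        (hout x hx hxt N))]
      exact mul_nonneg (by positivity) (hW0 x)
  · have h1 := lintegral_hardy_lt_top hg h hr hα hq hu hu2 hs2
    simp only [mul_assoc (16 * C ^ 2), ENNReal.ofReal_mul (show 0 ≤ 16 * C ^ 2 by positivity)]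
    rw [lintegral_const_mul' _ _ ENNReal.ofReal_ne_top]
    exact ENNReal.mul_lt_top ENNReal.ofReal_lt_top h1

theorem exists_isCutoffSeq (hg : IsRiem S g) {F : Set M} (hF : F.Finite)
    (h : ∀ q ∈ F, q ∉ S ∧ ∃ (α r : ℝ) (Φ : ℝ × ℝ → M), 0 < α ∧ IsCylindrical g S q α r Φ) :
    ∃ (χ : ℕ → M → ℝ) (W : M → ℝ), IsCutoffSeq S g F χ W := by
  induction F, hF using Set.Finite.induction_on with
  | empty => exact ⟨_, _, isCutoffSeq_empty hg⟩
  | @insert q F _ _ ih =>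
    obtain ⟨χ', W', h'⟩ := ih fun q' hq' => h q' (mem_insert_of_mem _ hq')
    obtain ⟨hq, α, r, Φ, hα, hΦ⟩ := h q (mem_insert _ _)
    -- The end is shrunk to radius at most 1/4, as the elementary inequalities require.
    obtain ⟨χ, W, h1⟩ := (hΦ.mono (lt_min hΦ.radius_pos (show (0 : ℝ) < 1 / 4 by norm_num))
      (min_le_left _ _)).exists_isCutoffSeq hg (min_le_right _ _) hα hq
    exact ⟨_, _, h1.mul hg h'⟩

end Cutoffs

/-! ### Green's formulas on the punctured surface. -/

section GreenFormulas

variable {M : Type*} [TopologicalSpace M] [ChartedSpace Plane M] [IsManifold (𝓡 2) 2 M]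
variable {S F : Set M} {g : TensorField M 2}

/-- The tensor product of two `1`-forms. -/
def tensorProduct (d u : TensorField M 1) : TensorField M 2 := fun x =>
  ofComp x fun I : Fin 2 → Fin 2 => comp (chartAt Plane x) d (chartAt Plane x x) ![I 0] *
    comp (chartAt Plane x) u (chartAt Plane x x) ![I 1]

theorem gram_tensorProduct (d u : TensorField M 1) (x : M) (i j : Fin 2) :
    gram (chartAt Plane x) (tensorProduct d u) (chartAt Plane x x) i j =
      comp (chartAt Plane x) d (chartAt Plane x x) ![i] *
        comp (chartAt Plane x) u (chartAt Plane x x) ![j] :=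
  congrFun (comp_ofComp x fun x (I : Fin 2 → Fin 2) =>
    comp (chartAt Plane x) d (chartAt Plane x x) ![I 0] *
    comp (chartAt Plane x) u (chartAt Plane x x) ![I 1]) ![i, j]

theorem tensorInner_contract (hg : IsRiem S g) {x : M} (hx : x ∈ S) (d u : TensorField M 1) (h : TensorField M 2) :
    tensorInner g d (contract g h u) x = tensorInner g (tensorProduct d u) h x := by
  have he := chartAt_mem_maximalAtlas x
  have hy : chartAt Plane x x ∈ (chartAt Plane x).target := mem_chart_target _ _
  have h1 := tensorInner_one (g := g) he hy d (contract g h u)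
  have h2 := tensorInner_two (g := g) he hy (tensorProduct d u) h
  rw [chartAt_symm_apply] at h1 h2
  rw [h1, h2]
  simp only [comp_contract he hy, gram_tensorProduct, up, Fin.sum_univ_two,
    gramInv_comm hg (chartAt_mem_chartDom hx)]
  ring

theorem tensorInner_tensorProduct {x : M} (d u : TensorField M 1) :
    tensorInner g (tensorProduct d u) (tensorProduct d u) x
      = tensorInner g d d x * tensorInner g u u x := by
  have he := chartAt_mem_maximalAtlas x
  have hy : chartAt Plane x x ∈ (chartAt Plane x).target := mem_chart_target _ _
  have h1 := fun d => tensorInner_one (g := g) he hy d d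
  have h2 := tensorInner_two (g := g) he hy (tensorProduct d u) (tensorProduct d u)
  simp only [chartAt_symm_apply] at h1 h2
  rw [h1, h1, h2]
  simp only [gram_tensorProduct, Fin.sum_univ_two]
  ring

/-- Pairing d with h(u♯, ·) is pairing d ⊗ u with h, and |d ⊗ u| = |d||u|. So this is Cauchy–Schwarz
for 2-tensors. -/
theorem tensorInner_contract_sq_le (hg : IsRiem S g) {x : M} (hx : x ∈ S) (d u : TensorField M 1)
    (h : TensorField M 2) : tensorInner g d (contract g h u) x ^ 2 ≤
      tensorInner g d d x * tensorInner g u u x * tensorInner g h h x := by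
  rw [tensorInner_contract hg hx, ← tensorInner_tensorProduct]
  have h1 := abs_tensorInner_le hg hx (tensorProduct d u) h
  have h2 := pow_le_pow_left₀ (abs_nonneg _) h1 2
  rwa [sq_abs, mul_pow, Real.sq_sqrt (tensorInner_self_nonneg hg hx _),
    Real.sq_sqrt (tensorInner_self_nonneg hg hx _)] at h2

theorem tensorInner_sq_le {k : ℕ} (hg : IsRiem S g) {x : M} (hx : x ∈ S) (u v : TensorField M k) :
    tensorInner g u v x ^ 2 ≤ tensorInner g u u x * tensorInner g v v x := by
  have h2 := pow_le_pow_left₀ (abs_nonneg _) (abs_tensorInner_le hg hx u v) 2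
  rwa [sq_abs, mul_pow, Real.sq_sqrt (tensorInner_self_nonneg hg hx _),
    Real.sq_sqrt (tensorInner_self_nonneg hg hx _)] at h2

variable [MeasurableSpace M] [BorelSpace M] [CompactSpace M] [T2Space M] [IsManifold (𝓡 2) ∞ M]
variable {χ : ℕ → M → ℝ} {W : M → ℝ}

/-- The complement of an open set is compact because M is. The cone points lie in that open set: `χ
N` vanishes on a punctured neighbourhood of each, and at the cone point itself nothing is asked
since it is not in S. -/
theorem IsCutoffSeq.exists_compact (hχ : IsCutoffSeq S g F χ W) (hF : S = Fᶜ) (N : ℕ) :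
    ∃ K, IsCompact K ∧ K ⊆ S ∧ ∀ x ∈ S, x ∉ K → χ N x = 0 := by
  refine ⟨(interior {x | x ∈ S → χ N x = 0})ᶜ, isOpen_interior.isClosed_compl.isCompact, ?_, ?_⟩
  · intro x hx
    by_contra hxS
    apply hx
    have hxF : x ∈ F := by
      rw [hF] at hxS
      simpa using hxS
    rw [mem_interior_iff_mem_nhds]
    have h1 := hχ.eventually_zero N x hxF
    rw [eventually_nhdsWithin_iff] at h1
    filter_upwards [h1] with x' hx' hx'S
    exact hx' fun h => hxS (by rw [← mem_singleton_iff.1 h]; exact hx'S)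
  · intro x hxS hx
    rw [notMem_compl_iff] at hx
    exact interior_subset hx hxS

/-- The divergence theorem on `S` for fields that are controlled by a form `u` with square
integrable symmetrized derivative. -/
theorem IsCutoffSeq.integral_divergence (hg : IsRiem S g) (hχ : IsCutoffSeq S g F χ W)
    (hF : S = Fᶜ) {u γ : TensorField M 1} (hu : IsCr 1 S u) (hu2 : normSq g S u < ⊤)
    (hs2 : normSq g S (symCovDeriv g u) < ⊤) (hγ : IsCr 1 S γ)
    (hγi : Integrable (val (divergence g γ)) (areaMeasure g S)) {m : M → ℝ}
    (hm : Integrable m (areaMeasure g S)) (hm0 : ∀ x ∈ S, 0 ≤ m x)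
    (hb : ∀ d : TensorField M 1, ∀ x ∈ S,
      tensorInner g d γ x ^ 2 ≤ tensorInner g d d x * tensorInner g u u x * m x) :
    ∫ x, val (divergence g γ) x ∂areaMeasure g S = 0 := by
  have hu0 : IsCr 0 S u := hu.of_le (by norm_num)
  have hW : Integrable (fun x => W x * tensorInner g u u x) (areaMeasure g S) := by
    refine ⟨(aemeasurable_of_continuousOn hg.isOpen (hχ.continuousOn.mul
      (continuousOn_tensorInner hg hu0 hu0))).aestronglyMeasurable, ?_⟩
    refine lt_of_le_of_lt (lintegral_mono_ae ?_) (hχ.lintegral_lt_top u hu hu2 hs2)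
    filter_upwards [ae_mem (g := g) hg.isOpen] with x hx
    rw [Real.enorm_eq_ofReal]
    exact mul_nonneg ((tensorInner_self_nonneg hg hx _).trans (hχ.le 0 x hx))
      (tensorInner_self_nonneg hg hx u)
  -- By the Leibniz rule the integrand is the divergence of χ_N γ, which has compact support in S.
  have h1 : ∀ N, ∫ x, (χ N x * val (divergence g γ) x
      - tensorInner g (symCovDeriv g (ofFun (χ N))) γ x) ∂areaMeasure g S = 0 := by
    intro N
    obtain ⟨K, hK, hKS, hK0⟩ := hχ.exists_compact hF N
    rw [← ConeSurface.integral_divergence hg (isCr_smul (hχ.isCr N) hγ) hK hKS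
      (fun x hx hxK => by rw [hK0 x hx hxK, zero_smul])]
    refine integral_congr_ae ?_
    filter_upwards [ae_mem (g := g) hg.isOpen] with x hx
    rw [val_divergence_smul hg (hχ.isCr N) hγ hx]
  have h2 : Tendsto (fun N => ∫ x, (χ N x * val (divergence g γ) x
      - tensorInner g (symCovDeriv g (ofFun (χ N))) γ x) ∂areaMeasure g S) atTop
      (𝓝 (∫ x, val (divergence g γ) x ∂areaMeasure g S)) := by
    -- The bound does not depend on N: |div γ| dominates the main term, and W|u|² + m dominates the
    -- error.
    refine tendsto_integral_of_dominated_convergence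
      (fun x => |val (divergence g γ) x| + (W x * tensorInner g u u x + m x)) (fun N => ?_)
      (hγi.abs.add (hW.add hm)) (fun N => ?_) ?_
    · refine (aemeasurable_of_continuousOn hg.isOpen (ContinuousOn.sub (ContinuousOn.mul ?_ ?_)
        ?_)).aestronglyMeasurable
      · exact continuousOn_val (w := ofFun (χ N)) hg.isOpen ((hχ.isCr N).of_le (by norm_num))
      · exact continuousOn_val hg.isOpen (isCr_zero_divergence_one hg hγ)
      · exact continuousOn_tensorInner hg (isCr_zero_symCovDeriv_zero hg (hχ.isCr N))
          (hγ.of_le (by norm_num))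
    · filter_upwards [ae_mem (g := g) hg.isOpen] with x hx
      have k1 := hχ.mem N x
      have k2 : |χ N x * val (divergence g γ) x| ≤ |val (divergence g γ) x| := by
        rw [abs_mul, abs_of_nonneg k1.1]
        exact mul_le_of_le_one_left (abs_nonneg _) k1.2
      have k3 := hb (symCovDeriv g (ofFun (χ N))) x hx
      have k4 := tensorInner_self_nonneg hg hx u
      have k5 := mul_le_mul_of_nonneg_right (hχ.le N x hx) k4
      have k6 := mul_le_mul_of_nonneg_right k5 (hm0 x hx)
      have k7 : 0 ≤ W x * tensorInner g u u x :=
        (mul_nonneg (tensorInner_self_nonneg hg hx _) k4).trans k5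
      -- From x² ≤ (W|u|²) m and the arithmetic–geometric mean inequality.
      have k8 : |tensorInner g (symCovDeriv g (ofFun (χ N))) γ x|
          ≤ W x * tensorInner g u u x + m x := by
        refine abs_le_of_sq_le_sq ?_ (add_nonneg k7 (hm0 x hx))
        nlinarith [mul_nonneg k7 (hm0 x hx), sq_nonneg (W x * tensorInner g u u x),
          sq_nonneg (m x)]
      rw [Real.norm_eq_abs]
      exact (abs_sub _ _).trans (add_le_add k2 k8)
    · filter_upwards [ae_mem (g := g) hg.isOpen] with x hx
      refine tendsto_const_nhds.congr' ?_
      filter_upwards [hχ.eventually_eq x hx] with N hN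
      rw [hN.1, tensorInner_zero_left hN.2, one_mul, sub_zero]
  simp only [h1] at h2
  exact (tendsto_nhds_unique h2 tendsto_const_nhds)

/-- The field is h(u♯, ·), the Hardy inequality is applied to u, and m = |h|². Nothing beyond square
integrability of h and div h is needed. -/
theorem IsCutoffSeq.l2Inner_divergence_two (hg : IsRiem S g) (hχ : IsCutoffSeq S g F χ W)
    (hF : S = Fᶜ) {u : TensorField M 1} {h : TensorField M 2} (hu : IsCr 1 S u)
    (hu2 : normSq g S u < ⊤) (hs2 : normSq g S (symCovDeriv g u) < ⊤) (hh : IsC1Symm S h)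
    (hh2 : normSq g S h < ⊤) (hd2 : normSq g S (divergence g h) < ⊤) :
    l2Inner g S (divergence g h) u = l2Inner g S h (symCovDeriv g u) := by
  have mu := isMeas_of_isCr hg.isOpen (hu.of_le (zero_le_one (α := WithTop ℕ∞)))
  have mh := isMeas_of_isCr hg.isOpen (hh.1.of_le (zero_le_one (α := WithTop ℕ∞)))
  have ms := isMeas_of_isCr hg.isOpen (isCr_zero_symCovDeriv_one hg hu)
  have md := isMeas_of_isCr hg.isOpen (isCr_zero_divergence_two hg hh.1)
  have i1 := integrable_tensorInner hg md mu hd2 hu2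
  have i2 := integrable_tensorInner hg mh ms hh2 hs2
  have hae : ∀ᵐ x ∂areaMeasure g S, tensorInner g (divergence g h) u x
      - tensorInner g h (symCovDeriv g u) x = val (divergence g (contract g h u)) x := by
    filter_upwards [ae_mem (g := g) hg.isOpen] with x hx
    exact (val_divergence_contract hg hh hu hx).symm
  have h1 := hχ.integral_divergence hg hF hu hu2 hs2 (isCr_contract hg hh.1 hu)
    ((i1.sub i2).congr hae) (integrable_tensorInner hg mh mh hh2 hh2)
    (fun x hx => tensorInner_self_nonneg hg hx h)
    (fun d x hx => tensorInner_contract_sq_le hg hx d u h)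
  rw [← integral_congr_ae hae, integral_sub i1 i2] at h1
  exact sub_eq_zero.1 h1

/-- The field is fβ. Here β takes the part of u in the Hardy inequality, and m = f². -/
theorem IsCutoffSeq.l2Inner_divergence_one (hg : IsRiem S g) (hχ : IsCutoffSeq S g F χ W)
    (hF : S = Fᶜ) {β : TensorField M 1} {f : M → ℝ} (hβ : IsCr 1 S β)
    (hβ2 : normSq g S β < ⊤) (hs2 : normSq g S (symCovDeriv g β) < ⊤) (hf : IsCr 1 S (ofFun f))
    (hf2 : normSq g S (ofFun f) < ⊤) (hd2 : normSq g S (symCovDeriv g (ofFun f)) < ⊤) :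
    l2Inner g S (ofFun f) (divergence g β) = l2Inner g S (symCovDeriv g (ofFun f)) β := by
  have mβ := isMeas_of_isCr hg.isOpen (hβ.of_le (zero_le_one (α := WithTop ℕ∞)))
  have mf := isMeas_of_isCr hg.isOpen (hf.of_le (zero_le_one (α := WithTop ℕ∞)))
  have ms := isMeas_of_isCr hg.isOpen (isCr_zero_symCovDeriv_zero hg hf)
  have md := isMeas_of_isCr hg.isOpen (isCr_zero_divergence_one hg hβ)
  have hdβ : normSq g S (divergence g β) < ⊤ :=
    (normSq_divergence_le hg hβ).trans_lt (ENNReal.mul_lt_top (by simp) hs2)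
  have i1 := integrable_tensorInner hg mf md hf2 hdβ
  have i2 := integrable_tensorInner hg ms mβ hd2 hβ2
  have hae : ∀ᵐ x ∂areaMeasure g S, tensorInner g (ofFun f) (divergence g β) x
      - tensorInner g (symCovDeriv g (ofFun f)) β x
      = val (divergence g (fun x => f x • β x)) x := by
    filter_upwards [ae_mem (g := g) hg.isOpen] with x hx
    rw [val_divergence_smul hg hf hβ hx, tensorInner_val, val_ofFun]
  have h1 := hχ.integral_divergence hg hF hβ hβ2 hs2 (isCr_smul hf hβ)
    ((i1.sub i2).congr hae) (integrable_tensorInner hg mf mf hf2 hf2)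
    (fun x hx => tensorInner_self_nonneg hg hx _)
    (fun d x hx => by
      rw [tensorInner_smul_right, tensorInner_val (ofFun f), val_ofFun, mul_pow]
      have h2 := mul_le_mul_of_nonneg_left (tensorInner_sq_le hg hx d β) (sq_nonneg (f x))
      nlinarith [h2])
  rw [← integral_congr_ae hae, integral_sub i1 i2] at h1
  exact sub_eq_zero.1 h1

/-- The tensors χ_N β approximate β in the graph norm: div(χ_N β) − div β = (χ_N − 1) div β − (dχ_N,
β). Both terms vanish eventually at each point and have integrable squares bounded independently of
N. -/
theorem IsCutoffSeq.hasDelta (hg : IsRiem S g) (hχ : IsCutoffSeq S g F χ W)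
    (hF : S = Fᶜ) {β : TensorField M 1} (hβ : IsCr 1 S β)
    (hβ2 : normSq g S β < ⊤) (hs2 : normSq g S (symCovDeriv g β) < ⊤) :
    HasDelta g S β (divergence g β) := by
  have hβ0 : IsCr 0 S β := hβ.of_le (by norm_num)
  have mβ := isMeas_of_isCr hg.isOpen hβ0
  have md := isMeas_of_isCr hg.isOpen (isCr_zero_divergence_one hg hβ)
  have hdβ : normSq g S (divergence g β) < ⊤ :=
    (normSq_divergence_le hg hβ).trans_lt (ENNReal.mul_lt_top (by simp) hs2)
  have hH : ∀ N, IsCr 1 S (fun x => χ N x • β x) := fun N => isCr_smul (hχ.isCr N) hβ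
  have mH : ∀ N, IsMeas S (fun x => χ N x • β x) := fun N =>
    isMeas_of_isCr hg.isOpen ((hH N).of_le (zero_le_one (α := WithTop ℕ∞)))
  have mdH : ∀ N, IsMeas S (divergence g (fun x => χ N x • β x)) := fun N =>
    isMeas_of_isCr hg.isOpen (isCr_zero_divergence_one hg (hH N))
  refine ⟨⟨mβ, Eventually.of_forall (isSymmAt_one β), hβ2⟩,
    ⟨md, Eventually.of_forall (isSymmAt_zero _), hdβ⟩, fun N x => χ N x • β x, fun N => ?_, ?_, ?_⟩
  · obtain ⟨K, hK, hKS, hK0⟩ := hχ.exists_compact hF N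
    exact ⟨⟨hH N, fun x _ => isSymmAt_one _ x⟩, K, hK, hKS,
      fun x hx hxK => by beta_reduce; rw [hK0 x hx hxK, zero_smul]⟩
  · have h1 : ∀ N x, tensorInner g ((fun x => χ N x • β x) - β) ((fun x => χ N x • β x) - β) x
        = (χ N x - 1) ^ 2 * tensorInner g β β x := fun N x => by
      rw [tensorInner_sub_left, tensorInner_sub_right, tensorInner_sub_right,
        tensorInner_smul_left, tensorInner_smul_left, tensorInner_smul_right]
      ring
    have h2 := tendsto_lintegral_of_dominated_convergence' (μ := areaMeasure g S)
      (F := fun N x => ENNReal.ofReal (tensorInner g ((fun x => χ N x • β x) - β)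
        ((fun x => χ N x • β x) - β) x)) (f := fun _ => 0)
      (fun x => ENNReal.ofReal (tensorInner g β β x))
      (fun N => (aemeasurable_tensorInner hg ((mH N).sub mβ) ((mH N).sub mβ)).ennreal_ofReal)
      (fun N => by
        filter_upwards [ae_mem (g := g) hg.isOpen] with x hx
        rw [h1]
        have k := hχ.mem N x
        exact ENNReal.ofReal_le_ofReal (mul_le_of_le_one_left (tensorInner_self_nonneg hg hx β)
          (by nlinarith [k.1, k.2]))) hβ2.ne
      (by
        filter_upwards [ae_mem (g := g) hg.isOpen] with x hx
        refine tendsto_const_nhds.congr' ?_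
        filter_upwards [hχ.eventually_eq x hx] with N hN
        rw [h1, hN.1]
        simp)
    rwa [lintegral_zero] at h2
  · have h1 : ∀ N, ∀ x ∈ S, tensorInner g
        (divergence g (fun x => χ N x • β x) - divergence g β)
        (divergence g (fun x => χ N x • β x) - divergence g β) x
        = ((χ N x - 1) * val (divergence g β) x
          - tensorInner g (symCovDeriv g (ofFun (χ N))) β x) ^ 2 := fun N x hx => by
      have h3 : val (divergence g (fun x => χ N x • β x) - divergence g β) x
          = val (divergence g (fun x => χ N x • β x)) x - val (divergence g β) x := rfl
      rw [tensorInner_val, h3, val_divergence_smul hg (hχ.isCr N) hβ hx]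
      ring
    -- The dominating function 2|div β|² + 2W|β|² is integrable: the first term by |div β|² ≤
    -- 2|Sym∇β|², the second by the Hardy inequality.
    have hfin : ∫⁻ x, (ENNReal.ofReal 2 * ENNReal.ofReal (tensorInner g (divergence g β)
        (divergence g β) x) + ENNReal.ofReal 2 * ENNReal.ofReal (W x * tensorInner g β β x))
        ∂areaMeasure g S ≠ ⊤ := by
      rw [lintegral_add_left' ((aemeasurable_tensorInner hg md md).ennreal_ofReal.const_mul _),
        lintegral_const_mul' _ _ ENNReal.ofReal_ne_top,
        lintegral_const_mul' _ _ ENNReal.ofReal_ne_top]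
      exact (ENNReal.add_lt_top.2 ⟨ENNReal.mul_lt_top ENNReal.ofReal_lt_top hdβ,
        ENNReal.mul_lt_top ENNReal.ofReal_lt_top (hχ.lintegral_lt_top β hβ hβ2 hs2)⟩).ne
    have h2 := tendsto_lintegral_of_dominated_convergence' (μ := areaMeasure g S)
      (F := fun N x => ENNReal.ofReal (tensorInner g
        (divergence g (fun x => χ N x • β x) - divergence g β)
        (divergence g (fun x => χ N x • β x) - divergence g β) x)) (f := fun _ => 0)
      (fun x => ENNReal.ofReal 2 * ENNReal.ofReal (tensorInner g (divergence g β)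
        (divergence g β) x) + ENNReal.ofReal 2 * ENNReal.ofReal (W x * tensorInner g β β x))
      (fun N => (aemeasurable_tensorInner hg ((mdH N).sub md) ((mdH N).sub md)).ennreal_ofReal)
      (fun N => by
        filter_upwards [ae_mem (g := g) hg.isOpen] with x hx
        have k1 := hχ.mem N x
        have k2 := tensorInner_self_nonneg hg hx β
        have k3 := mul_le_mul_of_nonneg_right (hχ.le N x hx) k2
        have k4 := tensorInner_sq_le hg hx (symCovDeriv g (ofFun (χ N))) β
        have k5 := tensorInner_self_nonneg hg hx (divergence g β)
        have k6 : (χ N x - 1) ^ 2 ≤ 1 := by nlinarith [k1.1, k1.2]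
        rw [h1 N x hx, ← ENNReal.ofReal_mul (by norm_num), ← ENNReal.ofReal_mul (by norm_num),
          ← ENNReal.ofReal_add (by positivity)
            (mul_nonneg (by norm_num)
              ((mul_nonneg (tensorInner_self_nonneg hg hx _) k2).trans k3))]
        refine ENNReal.ofReal_le_ofReal ?_
        rw [tensorInner_val (divergence g β)]
        have k7 := mul_le_of_le_one_left (mul_self_nonneg (val (divergence g β) x)) k6
        nlinarith [sq_nonneg ((χ N x - 1) * val (divergence g β) x
          + tensorInner g (symCovDeriv g (ofFun (χ N))) β x)]) hfin
      (by
        filter_upwards [ae_mem (g := g) hg.isOpen] with x hx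
        refine tendsto_const_nhds.congr' ?_
        filter_upwards [hχ.eventually_eq x hx] with N hN
        rw [h1 N x hx, hN.1, tensorInner_zero_left hN.2]
        simp)
    rwa [lintegral_zero] at h2

end GreenFormulas

theorem IsHyperbolicConeMetric.isRiem {M : Type*} [TopologicalSpace M] [T2Space M]
    [ChartedSpace Plane M] [IsManifold (𝓡 2) 2 M] {n : ℕ} {p : Fin n → M} {α : Fin n → ℝ}
    {g : TensorField M 2} (hg : IsHyperbolicConeMetric p α g) : IsRiem (Set.range p)ᶜ g :=
  ⟨(Set.finite_range p).isClosed.isOpen_compl, hg.contDiff.of_le (by norm_num), hg.symm, hg.pos⟩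

theorem IsHyperbolicConeMetric.exists_isCutoffSeq {M : Type*} [TopologicalSpace M] [T2Space M]
    [CompactSpace M] [ChartedSpace Plane M] [IsManifold (𝓡 2) 2 M] [IsManifold (𝓡 2) ∞ M]
    [MeasurableSpace M] [BorelSpace M] {n : ℕ} {p : Fin n → M} {α : Fin n → ℝ}
    {g : TensorField M 2} (hα : ∀ i, 0 < α i) (hg : IsHyperbolicConeMetric p α g) :
    ∃ (χ : ℕ → M → ℝ) (W : M → ℝ), IsCutoffSeq (Set.range p)ᶜ g (Set.range p) χ W := by
  refine ConeSurface.exists_isCutoffSeq hg.isRiem (Set.finite_range p) ?_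
  rintro _ ⟨i, rfl⟩
  obtain ⟨r, Φ, h⟩ := hg.cone i
  exact ⟨fun h => h (Set.mem_range_self i), α i, r, Φ, hα i, h⟩

/-! ### Pairings with the abstract operators. -/

section Pairing

variable {M : Type*} [TopologicalSpace M] [ChartedSpace Plane M] [IsManifold (𝓡 2) 2 M]
  [MeasurableSpace M] [BorelSpace M] [CompactSpace M] [T2Space M] [IsManifold (𝓡 2) ∞ M]
variable {S F : Set M} {g : TensorField M 2} {χ : ℕ → M → ℝ} {W : M → ℝ}

theorem l2Inner_congr {k : ℕ} {u u' v v' : TensorField M k}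
    (hu : ∀ᵐ x ∂areaMeasure g S, u x = u' x) (hv : ∀ᵐ x ∂areaMeasure g S, v x = v' x) :
    l2Inner g S u v = l2Inner g S u' v' := by
  refine integral_congr_ae ?_
  filter_upwards [hu, hv] with x h1 h2 using tensorInner_congr g h1 h2

/-- The weak derivative v agrees almost everywhere with the classical Sym∇u, whose L² norm is
therefore finite. This is the hypothesis under which the Hardy inequality, and with it the classical
Green formula, applies. -/
theorem HasDeltaStar.green_two (hg : IsRiem S g) (hχ : IsCutoffSeq S g F χ W) (hF : S = Fᶜ)
    {u : TensorField M 1} {h v : TensorField M 2} (hu : IsCr 1 S u) (hv : HasDeltaStar g S u v)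
    (hh : IsC1Symm S h) (hh2 : IsL2Symm g S h) (hd : IsL2Symm g S (divergence g h)) :
    Integrable (tensorInner g v h) (areaMeasure g S) ∧
      Integrable (tensorInner g u (divergence g h)) (areaMeasure g S) ∧
      l2Inner g S v h = l2Inner g S u (divergence g h) := by
  have hae := hv.eq_symCovDeriv_one hg hu
  refine ⟨integrable_tensorInner hg hv.2.1.1 hh2.1 hv.2.1.2.2 hh2.2.2,
    integrable_tensorInner hg hv.1.1 hd.1 hv.1.2.2 hd.2.2, ?_⟩
  rw [l2Inner_comm hg v h, l2Inner_congr (Eventually.of_forall fun _ => rfl) hae,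
    l2Inner_comm hg u]
  exact (hχ.l2Inner_divergence_two hg hF hu hv.1.2.2 (normSq_congr hae ▸ hv.2.1.2.2) hh
    hh2.2.2 hd.2.2).symm

end Pairing

end ConeSurface

end

/-! ### The theorem. -/

theorem mainTheorem7 {M : Type*} [TopologicalSpace M] [T2Space M] [CompactSpace M]
    [ChartedSpace ConeSurface.Plane M] [IsManifold (𝓡 2) ∞ M]
    [MeasurableSpace M] [BorelSpace M]
    {n : ℕ} (p : Fin n → M) (hp : Function.Injective p)
    (α : Fin n → ℝ) (hα : ∀ i, 0 < α i ∧ α i < 1 / 2)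
    (g : ConeSurface.TensorField M 2) (hg : ConeSurface.IsHyperbolicConeMetric p α g)
    (S : Set M) (hS : S = (Set.range p)ᶜ) :
    -- 1-forms and symmetric 2-tensors
    (∀ (u : ConeSurface.TensorField M 1) (h v : ConeSurface.TensorField M 2)
        (w : ConeSurface.TensorField M 1),
      ConeSurface.IsC1Symm S u → ConeSurface.HasDeltaStar g S u v →
      ConeSurface.IsC1Symm S h → ConeSurface.HasDelta g S h w →
        (∀ᵐ x ∂(ConeSurface.areaMeasure g S), v x = ConeSurface.symCovDeriv g u x) ∧
        (∀ᵐ x ∂(ConeSurface.areaMeasure g S), w x = ConeSurface.divergence g h x) ∧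
        Integrable (ConeSurface.tensorInner g v h) (ConeSurface.areaMeasure g S) ∧
        Integrable (ConeSurface.tensorInner g u w) (ConeSurface.areaMeasure g S) ∧
        ConeSurface.l2Inner g S v h = ConeSurface.l2Inner g S u w) ∧
    -- the same identity when `h` and its classical divergence are only square integrable
    (∀ (u : ConeSurface.TensorField M 1) (h v : ConeSurface.TensorField M 2),
      ConeSurface.IsC1Symm S u → ConeSurface.HasDeltaStar g S u v →
      ConeSurface.IsC1Symm S h → ConeSurface.IsL2Symm g S h →
      ConeSurface.IsL2Symm g S (ConeSurface.divergence g h) →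
        Integrable (ConeSurface.tensorInner g v h) (ConeSurface.areaMeasure g S) ∧
        Integrable (ConeSurface.tensorInner g u (ConeSurface.divergence g h))
          (ConeSurface.areaMeasure g S) ∧
        ConeSurface.l2Inner g S v h =
          ConeSurface.l2Inner g S u (ConeSurface.divergence g h)) ∧
    -- functions and 1-forms
    (∀ (f : M → ℝ) (β w : ConeSurface.TensorField M 1) (v : ConeSurface.TensorField M 2),
      ConeSurface.IsC1Symm S (ConeSurface.ofFun f) →
      ConeSurface.HasDeltaStar g S (ConeSurface.ofFun f) w →
      ConeSurface.IsC1Symm S β → ConeSurface.HasDeltaStar g S β v →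
        (∀ᵐ x ∂(ConeSurface.areaMeasure g S),
          w x = ConeSurface.symCovDeriv g (ConeSurface.ofFun f) x) ∧
        (∀ᵐ x ∂(ConeSurface.areaMeasure g S), v x = ConeSurface.symCovDeriv g β x) ∧
        ConeSurface.HasDelta g S β (ConeSurface.divergence g β) ∧
        Integrable (ConeSurface.tensorInner g w β) (ConeSurface.areaMeasure g S) ∧
        Integrable (ConeSurface.tensorInner g (ConeSurface.ofFun f) (ConeSurface.divergence g β))
          (ConeSurface.areaMeasure g S) ∧
        ConeSurface.l2Inner g S w β =
          ConeSurface.l2Inner g S (ConeSurface.ofFun f) (ConeSurface.divergence g β)) := by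
  subst hS
  have : IsManifold (𝓡 2) 2 M := IsManifold.of_le (n := ∞) ENat.LEInfty.out
  have hR := hg.isRiem
  obtain ⟨χ, W, hχ⟩ := hg.exists_isCutoffSeq fun i => (hα i).1
  refine ⟨fun u h v w hu huv hh hhw => ?_, fun u h v hu huv hh hh2 hd =>
    huv.green_two hR hχ rfl hu.1 hh hh2 hd, fun f β w v hf hfw hβ hβv => ?_⟩
  · have hw := hhw.eq_divergence hR hh
    -- The classical divergence coincides almost everywhere with the L² section w = δh and so is
    -- square integrable. The first statement is thus a case of the more general one.
    have hd2 : ConeSurface.normSq g _ (ConeSurface.divergence g h) < ⊤ :=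
      ConeSurface.normSq_congr hw ▸ hhw.2.1.2.2
    have hd : ConeSurface.IsL2Symm g (Set.range p)ᶜ (ConeSurface.divergence g h) :=
      ⟨ConeSurface.isMeas_of_isCr hR.isOpen (ConeSurface.isCr_zero_divergence_two hR hh.1),
        Eventually.of_forall (ConeSurface.isSymmAt_one _), hd2⟩
    obtain ⟨i1, -, h1⟩ := huv.green_two hR hχ rfl hu.1 hh hhw.1 hd
    refine ⟨huv.eq_symCovDeriv_one hR hu.1, hw, i1, ConeSurface.integrable_tensorInner hR
      huv.1.1 hhw.2.1.1 huv.1.2.2 hhw.2.1.2.2, ?_⟩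
    rw [h1]
    exact (ConeSurface.l2Inner_congr (Eventually.of_forall fun _ => rfl) hw).symm
  · have hw := hfw.eq_symCovDeriv_zero hR hf.1
    have hv := hβv.eq_symCovDeriv_one hR hβ.1
    have hδ := hχ.hasDelta hR rfl hβ.1 hβv.1.2.2 (ConeSurface.normSq_congr hv ▸ hβv.2.1.2.2)
    refine ⟨hw, hv, hδ, ConeSurface.integrable_tensorInner hR hfw.2.1.1 hβv.1.1 hfw.2.1.2.2
      hβv.1.2.2, ConeSurface.integrable_tensorInner hR hfw.1.1 hδ.2.1.1 hfw.1.2.2 hδ.2.1.2.2, ?_⟩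
    rw [ConeSurface.l2Inner_congr hw (Eventually.of_forall fun _ => rfl)]
    exact (hχ.l2Inner_divergence_one hR rfl hβ.1 hβv.1.2.2
      (ConeSurface.normSq_congr hv ▸ hβv.2.1.2.2) hf.1 hfw.1.2.2
      (ConeSurface.normSq_congr hw ▸ hfw.2.1.2.2)).symm
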